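/- Setting (hard phase, units $\rho_0=G=c=1$). A spherically symmetric initial configuration with $B>0$ particles is given by functions of a label $\chi\in[0,B]$: the area radius $r$, its velocity $\partial_\phi r$, the exponent $\omega$ of the radial metric coefficient, and the particle density $n>0$, in comoving coordinates with metric $-e^{2\psi}d\phi^2+e^{2\omega}d\chi^2+r^2\mathring\gamma$, $e^{-\psi}=n$. Here $\rho=\tfrac12(n^2+1)$, $p=\rho-1$, $m(\chi)=\int_0^\chi 4\pi r^2\rho\,\partial_\chi r\,d\chi'$, and it is required that: $r(0)=0=\partial_\phi r(0)$; $r>0$, $\partial_\chi r>0$ and $2m<r$ on $(0,B]$; $r$, $\partial_\phi r$, $n$ are continuous on $[0,B]$, and $\partial_\chi r$, $\omega$ are continuous on $(0,B]$; the label counts particles, $\int_0^\chi n\,4\pi r^2e^{\omega}d\chi'=\chi$ for $\chi\in[0,B]$; and $$1-\frac{2m}{r}=-e^{-2\psi}(\partial_\phi r)^2+e^{-2\omega}(\partial_\chi r)^2\quad\text{on }(0,B].$$ The mass functional is $M=m(B)=\int_0^B\rho\,4\pi r^2\,\partial_\chi r\,d\chi$. A variation of a configuration is a family of configurations, with parameter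 $\lambda\in(-1,1)$, on the same interval $[0,B]$ (so the total particle number $B$ is preserved), equal to the given one at $\lambda=0$, and $C^2$ in $\lambda$ in the following sense: $4\pi r_\lambda^2\,\partial_\chi r_\lambda$ and $\partial_\phi r_\lambda$ are twice differentiable in $\lambda$ for $\chi\in(0,B]$, and they and their first two $\lambda$-derivatives extend to jointly continuous functions of $(\lambda,\chi)\in(-1,1)\times[0,B]$. A dot denotes $\frac{d}{d\lambda}$ at $\lambda=0$. A static hard star is a configuration with $\partial_\phi r\equiv0$, $p>0$ on $[0,B)$ and $p(B)=0$; it is a critical point of $M$ if $\dot M=0$ for all its variations. **Proposition.** There is $R_0>0$ such that for every $B>0$, every static hard star with label interval $[0,B]$ that is a critical point of the mass functional and has radius $R=r(B)<R_0$, and every variation of it, $M$ is twice differentiable at $\lambda=0$ with second variation $$\ddot M\ge 0,$$ and $\ddot M=0$ if and only if $\dot r(\chi)=0$ and $(\partial_\phi r)\dot{}\,(\chi)=0$ for all $\chi\in[0,B]$. -/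

import Mathlib

open Set Filter Topology

/-- Spherically symmetric initial data for the hard phase on a level set of the velocity potential
`φ`, in comoving coordinates in which the metric is
`-e^{2ψ} dφ² + e^{2ω} dχ² + r² (round metric)`.  All functions depend on the particle label `χ`. -/
structure StarData where
  /-- area radius of the shell with label `χ` -/
  r : ℝ → ℝ
  /-- the derivative `∂r/∂χ` (tied to `r` in `IsConfiguration`) -/
  rχ : ℝ → ℝ
  /-- the velocity `∂r/∂φ` -/
  rφ : ℝ → ℝ
  /-- the exponent of the radial metric coefficient `e^{2ω}` -/
  ω : ℝ → ℝ
  /-- particle number density; in the hard phase `n = σ = ‖dφ‖ = e^{-ψ}` -/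
  n : ℝ → ℝ

namespace StarData

/-- Energy density in the hard phase, in units with `ρ₀ = 1`. -/
noncomputable def rho (d : StarData) (χ : ℝ) : ℝ := ((d.n χ) ^ 2 + 1) / 2

/-- Pressure in the hard phase, `p = ρ - ρ₀`. -/
noncomputable def pressure (d : StarData) (χ : ℝ) : ℝ := d.rho χ - 1

/-- Number of particles in the ball bounded by the shell `χ`, `∫ n dμ` with proper volume element
`dμ = 4π r² e^ω dχ`. -/
noncomputable def particleNumber (d : StarData) (χ : ℝ) : ℝ :=
  ∫ x in (0 : ℝ)..χ, d.n x * (4 * Real.pi * (d.r x) ^ 2 * Real.exp (d.ω x))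

/-- The Hawking mass `m(χ) = ∫ 4π r² ρ (∂r/∂χ) dχ`, vanishing at the centre.  With `χ = B`, the
label of the boundary, this is the mass functional `M`. -/
noncomputable def mass (d : StarData) (χ : ℝ) : ℝ :=
  ∫ x in (0 : ℝ)..χ, d.rho x * (4 * Real.pi * (d.r x) ^ 2 * d.rχ x)

/-- `d` is an initial configuration on `[0, B]`, regular at the centre (`n` is continuous and
positive up to `χ = 0`) and without trapped shells, in the coordinate `χ` that counts the
particles. In particular the total particle number is `B`. -/
structure IsConfiguration (d : StarData) (B : ℝ) : Prop where
  r_zero : d.r 0 = 0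
  r_pos : ∀ χ ∈ Ioc 0 B, 0 < d.r χ
  r_cont : ContinuousOn d.r (Icc 0 B)
  r_deriv : ∀ χ ∈ Ioc 0 B, HasDerivWithinAt d.r (d.rχ χ) (Icc 0 B) χ
  rχ_cont : ContinuousOn d.rχ (Ioc 0 B)
  rχ_pos : ∀ χ ∈ Ioc 0 B, 0 < d.rχ χ
  rφ_zero : d.rφ 0 = 0
  rφ_cont : ContinuousOn d.rφ (Icc 0 B)
  ω_cont : ContinuousOn d.ω (Ioc 0 B)
  n_cont : ContinuousOn d.n (Icc 0 B)
  n_pos : ∀ χ ∈ Icc 0 B, 0 < d.n χ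
  counts : ∀ χ ∈ Icc 0 B, d.particleNumber χ = χ
  untrapped : ∀ χ ∈ Ioc 0 B, 2 * d.mass χ < d.r χ
  /-- definition of the Hawking mass, `1 - 2m/r = g(∇r, ∇r)`, where `e^{-2ψ} = n²` -/
  hawking : ∀ χ ∈ Ioc 0 B, 1 - 2 * d.mass χ / d.r χ
    = -(d.n χ) ^ 2 * (d.rφ χ) ^ 2 + Real.exp (-2 * d.ω χ) * (d.rχ χ) ^ 2

/-- A momentarily static hard star: `∂r/∂φ = 0`, and the pressure is non-negative and vanishes only
at the boundary `χ = B`. -/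
structure IsStaticHardStar (d : StarData) (B : ℝ) : Prop where
  config : d.IsConfiguration B
  static : ∀ χ ∈ Icc 0 B, d.rφ χ = 0
  pressure_pos : ∀ χ ∈ Ico 0 B, 0 < d.pressure χ
  pressure_boundary : d.pressure B = 0

end StarData

/-- A family `g l χ`, `-1 < l < 1`, `0 < χ ≤ B`, that is twice differentiable in the parameter `l`,
such that `g`, `∂g/∂l` and `∂²g/∂l²` extend to jointly continuous functions up to `χ = 0`. -/
def IsC2Family (B : ℝ) (g : ℝ → ℝ → ℝ) : Prop :=
  ∃ g₀ g₁ g₂ : ℝ → ℝ → ℝ,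
    ContinuousOn (fun q : ℝ × ℝ => g₀ q.1 q.2) (Ioo (-1) 1 ×ˢ Icc 0 B) ∧
    ContinuousOn (fun q : ℝ × ℝ => g₁ q.1 q.2) (Ioo (-1) 1 ×ˢ Icc 0 B) ∧
    ContinuousOn (fun q : ℝ × ℝ => g₂ q.1 q.2) (Ioo (-1) 1 ×ˢ Icc 0 B) ∧
    ∀ l ∈ Ioo (-1 : ℝ) 1, ∀ χ ∈ Ioc 0 B,
      g l χ = g₀ l χ ∧
      HasDerivAt (fun t => g t χ) (g₁ l χ) l ∧
      HasDerivAt (fun t => g₁ t χ) (g₂ l χ) l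

/-- A variation of `d`: a one-parameter family of initial configurations on the fixed label interval
`[0, B]` (hence with the same total number `B` of particles) through `d`, of class `C²` in the
parameter.  Since `r` behaves like `χ^{1/3}` at the centre, the regularity is expressed through
`∂/∂χ (4π r³ / 3) = 4π r² ∂r/∂χ`. -/
structure IsVariation (d : StarData) (B : ℝ) (D : ℝ → StarData) : Prop where
  base : D 0 = d
  config : ∀ l ∈ Ioo (-1 : ℝ) 1, (D l).IsConfiguration B
  r_C2 : IsC2Family B (fun l χ => 4 * Real.pi * ((D l).r χ) ^ 2 * (D l).rχ χ)
  rφ_C2 : IsC2Family B (fun l χ => (D l).rφ χ)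

/-- `d` is a critical point of the mass functional under variations which preserve the total number
of particles: the first variation vanishes along each of them. -/
def IsCriticalPoint (d : StarData) (B : ℝ) : Prop :=
  ∀ D : ℝ → StarData, IsVariation d B D → HasDerivAt (fun l => (D l).mass B) 0 0

/-- `M` is differentiable near `0` and its derivative has derivative `c` at `0`, i.e. `M̈ = c`. -/
def HasSecondVariation (M : ℝ → ℝ) (c : ℝ) : Prop :=
  ∃ M' : ℝ → ℝ, (∀ᶠ l in 𝓝 0, HasDerivAt M (M' l) l) ∧ HasDerivAt M' c 0

/-! Write w = 4πr²∂_χ r and v = ∂_φ r. Because the label counts particles, n·4πr²e^ω = 1, and the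
Hawking identity becomes n²(w² - v²) = 1 - 2m/r. Eliminating n turns the definition of the mass into
the linear equation m' = ½(w + τ) - (τ/r) m with τ = w/(w² - v²), where r is recovered from 4πr³/3 =
∫ w. So M is an explicit functional of w and v, and the constraint on the particle number is already
built in (`n_sq_mul`, `rho_mul_volDensity`, `mass_eq_linearSolution`).

The parameter derivative of a solution solves an equation with the same coefficient and a new
source, so the differentiation can be repeated (`BoundedFamily.linearSolution`). At a static state
M̈ is the integral, against a positive adjoint weight, of a part linear in ẅ and a quadratic form in
ẇ and v̇. The linear part is the first variation in the direction ẅ, which vanishes at a critical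
point. To see this (`IsCriticalPoint.firstVariation_eq_zero`), w is varied in the direction of the
first variation density itself; `exists_static_configuration` makes this an admissible variation.

A small radius must still be shown to bound the density. The Euler-Lagrange equation is the
Tolman-Oppenheimer-Volkoff equation, and an argument of Buchdahl type gives 1 - 2m/r > 1/25 for all
equilibria (`one_div_lt_gradSq`). As long as n is bounded, n²(1 - 2m/r) ≤ 1 + O(R²), so n, which is
continuous and equals 1 at the boundary, never reaches 8 (`n_le`). Then n, w and 1 - 2m/r are all
close to 1.

The quadratic form has the diagonal part (1 - 2m/r) w⁻³ (ẇ² + v̇²). Its other terms contain ṁ or ∫ẇ,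
and Cauchy-Schwarz bounds them by O(χ^{-1/3}) ∫ẇ² plus a small multiple of ẇ²
(`abs_quadraticDensity_sub_le`). As ∫χ^{-1/3} = O(B^{2/3}) is small, M̈ ≥ ¼ ∫(ẇ² + v̇²), which gives
both the sign and the case of equality. -/

open MeasureTheory intervalIntegral

/-! ### Primitives of functions that may be singular at the centre. -/

/-- Functions that are continuous on `(0, B]` and integrable up to the centre. -/
structure RegularOn (B : ℝ) (f : ℝ → ℝ) : Prop where
  cont : ContinuousOn f (Ioc 0 B)
  int : IntervalIntegrable f volume 0 B

namespace RegularOn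

variable {B : ℝ} {f g : ℝ → ℝ}

theorem mono (hf : RegularOn B f) {χ : ℝ} (hχ : χ ∈ Icc 0 B) : RegularOn χ f :=
  ⟨hf.cont.mono (Ioc_subset_Ioc_right hχ.2),
    hf.int.mono_set (by
      rw [uIcc_of_le hχ.1, uIcc_of_le (hχ.1.trans hχ.2)]; exact Icc_subset_Icc_right hχ.2)⟩

theorem of_continuousOn (hB : 0 ≤ B) (hf : ContinuousOn f (Icc 0 B)) : RegularOn B f :=
  ⟨hf.mono Ioc_subset_Icc_self, by
    apply ContinuousOn.intervalIntegrable; rwa [uIcc_of_le hB]⟩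

theorem of_bound (hB : 0 ≤ B) (hg : IntervalIntegrable g volume 0 B)
    (hf : ContinuousOn f (Ioc 0 B)) (h : ∀ χ ∈ Ioc 0 B, |f χ| ≤ g χ) : RegularOn B f := by
  refine ⟨hf, hg.mono_fun' ?_ ?_⟩
  · rw [uIoc_of_le hB]; exact hf.aestronglyMeasurable measurableSet_Ioc
  · rw [uIoc_of_le hB]
    filter_upwards [ae_restrict_mem measurableSet_Ioc] with x hx using h x hx

theorem congr (hB : 0 ≤ B) (hf : RegularOn B f) (h : EqOn g f (Ioc 0 B)) : RegularOn B g :=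
  ⟨hf.cont.congr h, hf.int.congr (by rw [uIoc_of_le hB]; exact fun x hx => (h hx).symm)⟩

theorem add (hf : RegularOn B f) (hg : RegularOn B g) : RegularOn B (fun x => f x + g x) :=
  ⟨hf.cont.add hg.cont, hf.int.add hg.int⟩

theorem sub (hf : RegularOn B f) (hg : RegularOn B g) : RegularOn B (fun x => f x - g x) :=
  ⟨hf.cont.sub hg.cont, hf.int.sub hg.int⟩

theorem const_mul (hf : RegularOn B f) (c : ℝ) : RegularOn B (fun x => c * f x) :=
  ⟨continuousOn_const.mul hf.cont, hf.int.const_mul c⟩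

theorem continuousOn_mul (hB : 0 ≤ B) (hg : ContinuousOn g (Icc 0 B)) (hf : RegularOn B f) :
    RegularOn B (fun x => g x * f x) :=
  ⟨(hg.mono Ioc_subset_Icc_self).mul hf.cont,
    hf.int.continuousOn_mul (by rwa [uIcc_of_le hB])⟩

theorem continuousOn_primitive (hB : 0 ≤ B) (hf : RegularOn B f) :
    ContinuousOn (fun χ => ∫ x in (0 : ℝ)..χ, f x) (Icc 0 B) := by
  have h := continuousOn_primitive_interval (μ := volume) (f := f) (a := 0) (b := B)
    (by rw [uIcc_of_le hB]; exact (intervalIntegrable_iff_integrableOn_Icc_of_le hB).1 hf.int)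
  rwa [uIcc_of_le hB] at h

theorem hasDerivAt_primitive (hf : RegularOn B f) {χ : ℝ} (hχ : χ ∈ Ioo 0 B) :
    HasDerivAt (fun χ => ∫ x in (0 : ℝ)..χ, f x) (f χ) χ := by
  have hn : Ioo 0 B ∈ 𝓝 χ := isOpen_Ioo.mem_nhds hχ
  have hc : ContinuousOn f (Ioo 0 B) := hf.cont.mono Ioo_subset_Ioc_self
  exact integral_hasDerivAt_right (hf.mono ⟨hχ.1.le, hχ.2.le⟩).int
    (hc.stronglyMeasurableAtFilter isOpen_Ioo χ hχ) (hc.continuousAt hn)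

theorem hasDerivWithinAt_primitive (hf : RegularOn B f) {χ : ℝ} (hχ : χ ∈ Ioc 0 B) :
    HasDerivWithinAt (fun χ => ∫ x in (0 : ℝ)..χ, f x) (f χ) (Icc 0 B) χ := by
  rcases hχ.2.lt_or_eq with h | h
  · exact (hf.hasDerivAt_primitive ⟨hχ.1, h⟩).hasDerivWithinAt
  · subst h
    -- At the right end point continuity holds from the left only, so the one-sided fundamental
    -- theorem is used.
    have hc : ContinuousWithinAt f (Iic χ) χ := by
      refine (hf.cont χ ⟨hχ.1, le_rfl⟩).mono_of_mem_nhdsWithin ?_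
      exact Ioc_mem_nhdsLE hχ.1
    have hm : StronglyMeasurableAtFilter f (𝓝[Iic χ] χ) volume :=
      ⟨Ioc 0 χ, Ioc_mem_nhdsLE hχ.1, hf.cont.aestronglyMeasurable measurableSet_Ioc⟩
    exact (integral_hasDerivWithinAt_right (s := Iic χ) (t := Iic χ) hf.int hm hc).mono
      Icc_subset_Iic_self

end RegularOn

/-! ### Linear equations of first order, solved by an integrating factor. -/

/-- The solution of the linear equation `m' = σ - k m` that vanishes at the centre. -/
noncomputable def linearSolution (k σ : ℝ → ℝ) (χ : ℝ) : ℝ :=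
  Real.exp (-∫ x in (0 : ℝ)..χ, k x) *
    ∫ x in (0 : ℝ)..χ, Real.exp (∫ y in (0 : ℝ)..x, k y) * σ x

section LinearSolution

variable {B : ℝ} {k σ m : ℝ → ℝ}

theorem RegularOn.continuousOn_exp_primitive (hB : 0 ≤ B) (hk : RegularOn B k) :
    ContinuousOn (fun χ => Real.exp (∫ x in (0 : ℝ)..χ, k x)) (Icc 0 B) :=
  Real.continuous_exp.comp_continuousOn (hk.continuousOn_primitive hB)

theorem RegularOn.exp_primitive_mul (hB : 0 ≤ B) (hk : RegularOn B k) (hσ : RegularOn B σ) :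
    RegularOn B (fun x => Real.exp (∫ y in (0 : ℝ)..x, k y) * σ x) :=
  hσ.continuousOn_mul hB (hk.continuousOn_exp_primitive hB)

theorem linearSolution_zero : linearSolution k σ 0 = 0 := by simp [linearSolution]

theorem continuousOn_linearSolution (hB : 0 ≤ B) (hk : RegularOn B k) (hσ : RegularOn B σ) :
    ContinuousOn (linearSolution k σ) (Icc 0 B) :=
  (Real.continuous_exp.comp_continuousOn (hk.continuousOn_primitive hB).neg).mul
    ((hk.exp_primitive_mul hB hσ).continuousOn_primitive hB)

theorem hasDerivWithinAt_linearSolution (hB : 0 ≤ B) (hk : RegularOn B k) (hσ : RegularOn B σ)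
    {χ : ℝ} (hχ : χ ∈ Ioc 0 B) :
    HasDerivWithinAt (linearSolution k σ) (σ χ - k χ * linearSolution k σ χ) (Icc 0 B) χ := by
  have h1 := (hk.hasDerivWithinAt_primitive hχ).neg.exp
  have h2 := (hk.exp_primitive_mul hB hσ).hasDerivWithinAt_primitive hχ
  refine (h1.mul h2).congr_deriv ?_
  simp only [Pi.neg_apply, linearSolution]
  rw [← mul_assoc (Real.exp (-_)) (Real.exp _) (σ χ), ← Real.exp_add]
  simp only [neg_add_cancel, Real.exp_zero]
  ring

/-- Any continuous solution that vanishes at the centre, multiplied by the integrating factor, is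
the integral of the source. -/
theorem exp_mul_eq_integral (hB : 0 ≤ B) (hk : RegularOn B k) (hσ : RegularOn B σ)
    (hm : ContinuousOn m (Icc 0 B)) (h0 : m 0 = 0)
    (hd : ∀ χ ∈ Ioo 0 B, HasDerivAt m (σ χ - k χ * m χ) χ) {χ : ℝ} (hχ : χ ∈ Icc 0 B) :
    Real.exp (∫ x in (0 : ℝ)..χ, k x) * m χ
      = ∫ x in (0 : ℝ)..χ, Real.exp (∫ y in (0 : ℝ)..x, k y) * σ x := by
  have hs : Icc 0 χ ⊆ Icc 0 B := Icc_subset_Icc_right hχ.2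
  rw [integral_eq_sub_of_hasDerivAt_of_le (f := fun χ => Real.exp (∫ x in (0 : ℝ)..χ, k x) * m χ)
    hχ.1 (((hk.continuousOn_exp_primitive hB).mul hm).mono hs) ?_
    ((hk.exp_primitive_mul hB hσ).mono hχ).int]
  · simp [h0]
  · intro x hx
    have hx' : x ∈ Ioo 0 B := ⟨hx.1, hx.2.trans_le hχ.2⟩
    refine ((hk.hasDerivAt_primitive hx').exp.mul (hd x hx')).congr_deriv ?_
    ring

/-- Uniqueness: the integrating factor never vanishes. This is what identifies the mass of a
configuration with the explicit formula. -/
theorem eq_linearSolution (hB : 0 ≤ B) (hk : RegularOn B k) (hσ : RegularOn B σ)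
    (hm : ContinuousOn m (Icc 0 B)) (h0 : m 0 = 0)
    (hd : ∀ χ ∈ Ioo 0 B, HasDerivAt m (σ χ - k χ * m χ) χ) {χ : ℝ} (hχ : χ ∈ Icc 0 B) :
    m χ = linearSolution k σ χ := by
  rw [linearSolution, ← exp_mul_eq_integral hB hk hσ hm h0 hd hχ, ← mul_assoc, ← Real.exp_add]
  simp

end LinearSolution

/-! ### Differentiation with respect to the parameter of a variation. -/

/-- A family `g l χ`, `l ∈ J`, `χ ∈ (0, B]`, with derivative `g₁` in `l`, both continuous in `χ` and
bounded by a multiple of the envelope `e`. -/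
structure BoundedFamily (J : Set ℝ) (B : ℝ) (e : ℝ → ℝ) (g g₁ : ℝ → ℝ → ℝ) : Prop where
  isOpen : IsOpen J
  cont : ∀ l ∈ J, ContinuousOn (g l) (Ioc 0 B)
  cont_deriv : ∀ l ∈ J, ContinuousOn (g₁ l) (Ioc 0 B)
  bound : ∃ C, 0 ≤ C ∧ ∀ l ∈ J, ∀ χ ∈ Ioc 0 B, |g l χ| ≤ C * e χ ∧ |g₁ l χ| ≤ C * e χ
  deriv : ∀ l ∈ J, ∀ χ ∈ Ioc 0 B, HasDerivAt (fun t => g t χ) (g₁ l χ) l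

namespace BoundedFamily

variable {J : Set ℝ} {B : ℝ} {e e' : ℝ → ℝ} {g g₁ h h₁ : ℝ → ℝ → ℝ}

theorem mono (hg : BoundedFamily J B e g g₁) {c : ℝ} (hc : 0 ≤ c)
    (he : ∀ χ ∈ Ioc 0 B, e χ ≤ c * e' χ) :
    BoundedFamily J B e' g g₁ := by
  obtain ⟨C, hC, hb⟩ := hg.bound
  refine ⟨hg.isOpen, hg.cont, hg.cont_deriv, ⟨C * c, by positivity, fun l hl χ hχ => ?_⟩, hg.deriv⟩
  have h1 : C * e χ ≤ C * c * e' χ := by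
    rw [mul_assoc]; exact mul_le_mul_of_nonneg_left (he χ hχ) hC
  exact ⟨(hb l hl χ hχ).1.trans h1, (hb l hl χ hχ).2.trans h1⟩

theorem congr (hg : BoundedFamily J B e g g₁) (h0 : ∀ l ∈ J, ∀ χ ∈ Ioc 0 B, h l χ = g l χ)
    (h1 : ∀ l ∈ J, ∀ χ ∈ Ioc 0 B, h₁ l χ = g₁ l χ) : BoundedFamily J B e h h₁ := by
  obtain ⟨C, hC, hb⟩ := hg.bound
  refine ⟨hg.isOpen, fun l hl => (hg.cont l hl).congr (h0 l hl),
    fun l hl => (hg.cont_deriv l hl).congr (h1 l hl), ⟨C, hC, fun l hl χ hχ => ?_⟩,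
    fun l hl χ hχ => ?_⟩
  · rw [h0 l hl χ hχ, h1 l hl χ hχ]; exact hb l hl χ hχ
  · rw [h1 l hl χ hχ]
    refine (hg.deriv l hl χ hχ).congr_of_eventuallyEq ?_
    filter_upwards [hg.isOpen.mem_nhds hl] with t ht using h0 t ht χ hχ

theorem add (hg : BoundedFamily J B e g g₁) (hh : BoundedFamily J B e h h₁) :
    BoundedFamily J B e (fun l χ => g l χ + h l χ) (fun l χ => g₁ l χ + h₁ l χ) := by
  obtain ⟨C, hC, hb⟩ := hg.bound
  obtain ⟨C', hC', hb'⟩ := hh.bound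
  refine ⟨hg.isOpen, fun l hl => (hg.cont l hl).add (hh.cont l hl),
    fun l hl => (hg.cont_deriv l hl).add (hh.cont_deriv l hl),
    ⟨C + C', by positivity, fun l hl χ hχ => ?_⟩,
    fun l hl χ hχ => (hg.deriv l hl χ hχ).add (hh.deriv l hl χ hχ)⟩
  have h1 := hb l hl χ hχ
  have h2 := hb' l hl χ hχ
  rw [add_mul]
  exact ⟨(abs_add_le _ _).trans (add_le_add h1.1 h2.1),
    (abs_add_le _ _).trans (add_le_add h1.2 h2.2)⟩

theorem const_mul (hg : BoundedFamily J B e g g₁) (c : ℝ) :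
    BoundedFamily J B e (fun l χ => c * g l χ) (fun l χ => c * g₁ l χ) := by
  obtain ⟨C, hC, hb⟩ := hg.bound
  refine ⟨hg.isOpen, fun l hl => continuousOn_const.mul (hg.cont l hl),
    fun l hl => continuousOn_const.mul (hg.cont_deriv l hl),
    ⟨|c| * C, by positivity, fun l hl χ hχ => ?_⟩,
    fun l hl χ hχ => (hg.deriv l hl χ hχ).const_mul c⟩
  have h1 := hb l hl χ hχ
  rw [abs_mul, abs_mul, mul_assoc]
  exact ⟨mul_le_mul_of_nonneg_left h1.1 (abs_nonneg c),
    mul_le_mul_of_nonneg_left h1.2 (abs_nonneg c)⟩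

theorem sub (hg : BoundedFamily J B e g g₁) (hh : BoundedFamily J B e h h₁) :
    BoundedFamily J B e (fun l χ => g l χ - h l χ) (fun l χ => g₁ l χ - h₁ l χ) :=
  (hg.add (hh.const_mul (-1))).congr (fun _ _ _ _ => by ring) (fun _ _ _ _ => by ring)

theorem mul (hg : BoundedFamily J B e g g₁) (hh : BoundedFamily J B e' h h₁) :
    BoundedFamily J B (fun χ => e χ * e' χ) (fun l χ => g l χ * h l χ)
      (fun l χ => g₁ l χ * h l χ + g l χ * h₁ l χ) := by
  obtain ⟨C, hC, hb⟩ := hg.bound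
  obtain ⟨C', hC', hb'⟩ := hh.bound
  refine ⟨hg.isOpen, fun l hl => (hg.cont l hl).mul (hh.cont l hl),
    fun l hl => ((hg.cont_deriv l hl).mul (hh.cont l hl)).add
      ((hg.cont l hl).mul (hh.cont_deriv l hl)),
    ⟨2 * (C * C'), by positivity, fun l hl χ hχ => ?_⟩,
    fun l hl χ hχ => (hg.deriv l hl χ hχ).mul (hh.deriv l hl χ hχ)⟩
  have h1 := hb l hl χ hχ
  have h2 := hb' l hl χ hχ
  have key : ∀ {x y : ℝ}, |x| ≤ C * e χ → |y| ≤ C' * e' χ → |x * y| ≤ C * C' * (e χ * e' χ) := by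
    intro x y hx hy
    rw [abs_mul, mul_mul_mul_comm]
    exact mul_le_mul hx hy (abs_nonneg _) ((abs_nonneg _).trans hx)
  have h3 := key h1.1 h2.1
  have h4 := key h1.2 h2.1
  have h5 := key h1.1 h2.2
  refine ⟨?_, (abs_add_le _ _).trans ?_⟩
  · linarith [(abs_nonneg _).trans h3]
  · linarith

/-- Composition with a function that is `C¹` on a set containing the values. The envelope `e'` has
to bound the result. -/
theorem comp (hg : BoundedFamily J B e g g₁) {s : Set ℝ} {φ φ' : ℝ → ℝ}
    (hs : ∀ l ∈ J, ∀ χ ∈ Ioc 0 B, g l χ ∈ s) (hφ : ∀ x ∈ s, HasDerivAt φ (φ' x) x)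
    (hφ' : ContinuousOn φ' s)
    (hb : ∃ C, 0 ≤ C ∧ ∀ l ∈ J, ∀ χ ∈ Ioc 0 B,
      |φ (g l χ)| ≤ C * e' χ ∧ |φ' (g l χ) * g₁ l χ| ≤ C * e' χ) :
    BoundedFamily J B e' (fun l χ => φ (g l χ)) (fun l χ => φ' (g l χ) * g₁ l χ) :=
  ⟨hg.isOpen,
    fun l hl => ContinuousOn.comp (fun x hx => (hφ x hx).continuousAt.continuousWithinAt)
      (hg.cont l hl) (hs l hl),
    fun l hl => (hφ'.comp (hg.cont l hl) (hs l hl)).mul (hg.cont_deriv l hl),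
    hb, fun l hl χ hχ => (hφ _ (hs l hl χ hχ)).comp l (hg.deriv l hl χ hχ)⟩

/-- Composition of a uniformly bounded family with a function that is `C¹` near its values. -/
theorem comp_compact (hg : BoundedFamily J B (fun _ => 1) g g₁) {s : Set ℝ} {φ φ' : ℝ → ℝ}
    (hK : IsCompact s)
    (hs : ∀ l ∈ J, ∀ χ ∈ Ioc 0 B, g l χ ∈ s) (hφ : ∀ x ∈ s, HasDerivAt φ (φ' x) x)
    (hφ' : ContinuousOn φ' s) :
    BoundedFamily J B (fun _ => 1) (fun l χ => φ (g l χ)) (fun l χ => φ' (g l χ) * g₁ l χ) := by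
  refine hg.comp hs hφ hφ' ?_
  obtain ⟨C, hC, hb⟩ := hg.bound
  obtain ⟨C1, h1⟩ := hK.exists_bound_of_continuousOn
    (fun x hx => (hφ x hx).continuousAt.continuousWithinAt : ContinuousOn φ s)
  obtain ⟨C2, h2⟩ := hK.exists_bound_of_continuousOn hφ'
  refine ⟨|C1| + |C2| * C, by positivity, fun l hl χ hχ => ?_⟩
  have h3 := h1 _ (hs l hl χ hχ)
  have h4 := h2 _ (hs l hl χ hχ)
  have h5 := (hb l hl χ hχ).2
  rw [Real.norm_eq_abs] at h3 h4
  rw [mul_one] at h5 ⊢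
  have h6 : |φ' (g l χ) * g₁ l χ| ≤ |C2| * C := by
    rw [abs_mul]
    exact mul_le_mul (h4.trans (le_abs_self _)) h5 (abs_nonneg _) (abs_nonneg _)
  have h7 : 0 ≤ |C2| * C := by positivity
  exact ⟨by linarith [le_abs_self C1], by linarith [abs_nonneg C1]⟩

theorem exp (hg : BoundedFamily J B (fun _ => 1) g g₁) :
    BoundedFamily J B (fun _ => 1) (fun l χ => Real.exp (g l χ))
      (fun l χ => Real.exp (g l χ) * g₁ l χ) := by
  obtain ⟨C, hC, hb⟩ := hg.bound
  exact hg.comp_compact (s := Icc (-C) C) isCompact_Icc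
    (fun l hl χ hχ => abs_le.1 (by simpa using (hb l hl χ hχ).1))
    (fun x _ => Real.hasDerivAt_exp x) Real.continuous_exp.continuousOn

theorem regularOn (hg : BoundedFamily J B e g g₁) (hB : 0 ≤ B)
    (he : IntervalIntegrable e volume 0 B) {l : ℝ} (hl : l ∈ J) : RegularOn B (g l) := by
  obtain ⟨C, hC, hb⟩ := hg.bound
  exact RegularOn.of_bound hB (he.const_mul C) (hg.cont l hl) fun χ hχ => (hb l hl χ hχ).1

theorem regularOn_deriv (hg : BoundedFamily J B e g g₁) (hB : 0 ≤ B)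
    (he : IntervalIntegrable e volume 0 B) {l : ℝ} (hl : l ∈ J) : RegularOn B (g₁ l) := by
  obtain ⟨C, hC, hb⟩ := hg.bound
  exact RegularOn.of_bound hB (he.const_mul C) (hg.cont_deriv l hl) fun χ hχ => (hb l hl χ hχ).2

/-- Differentiation under the integral sign. -/
theorem integral (hg : BoundedFamily J B e g g₁) (hB : 0 ≤ B)
    (he : IntervalIntegrable e volume 0 B) :
    BoundedFamily J B (fun χ => ∫ x in (0 : ℝ)..χ, e x) (fun l χ => ∫ x in (0 : ℝ)..χ, g l x)
      (fun l χ => ∫ x in (0 : ℝ)..χ, g₁ l x) := by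
  obtain ⟨C, hC, hb⟩ := hg.bound
  have hmem : ∀ {χ}, χ ∈ Ioc 0 B → χ ∈ Icc 0 B := fun h => ⟨h.1.le, h.2⟩
  have hei : ∀ χ ∈ Ioc 0 B, IntervalIntegrable e volume 0 χ := fun χ hχ =>
    he.mono_set (by
      rw [uIcc_of_le hχ.1.le, uIcc_of_le hB]; exact Icc_subset_Icc_right hχ.2)
  refine ⟨hg.isOpen,
    fun l hl => ((hg.regularOn hB he hl).continuousOn_primitive hB).mono Ioc_subset_Icc_self,
    fun l hl => ((hg.regularOn_deriv hB he hl).continuousOn_primitive hB).mono Ioc_subset_Icc_self,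
    ⟨C, hC, fun l hl χ hχ => ?_⟩, fun l hl χ hχ => ?_⟩
  · rw [← intervalIntegral.integral_const_mul]
    exact ⟨intervalIntegral.norm_integral_le_of_norm_le (f := g l) hχ.1.le
        (Eventually.of_forall fun t ht => (hb l hl t ⟨ht.1, ht.2.trans hχ.2⟩).1)
        ((hei χ hχ).const_mul C),
      intervalIntegral.norm_integral_le_of_norm_le (f := g₁ l) hχ.1.le
        (Eventually.of_forall fun t ht => (hb l hl t ⟨ht.1, ht.2.trans hχ.2⟩).2)
        ((hei χ hχ).const_mul C)⟩
  · refine (intervalIntegral.hasDerivAt_integral_of_dominated_loc_of_deriv_le (F := g) (F' := g₁)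
      (bound := fun x => C * e x) (hg.isOpen.mem_nhds hl) ?_
      ((hg.regularOn hB he hl).mono (hmem hχ)).int
      ((hg.regularOn_deriv hB he hl).mono (hmem hχ)).int.def'.aestronglyMeasurable ?_
      ((hei χ hχ).const_mul C) ?_).2
    · filter_upwards [hg.isOpen.mem_nhds hl] with t ht
      exact ((hg.regularOn hB he ht).mono (hmem hχ)).int.def'.aestronglyMeasurable
    · refine Eventually.of_forall fun t ht x hx => ?_
      rw [uIoc_of_le hχ.1.le] at ht
      exact (hb x hx t ⟨ht.1, ht.2.trans hχ.2⟩).2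
    · refine Eventually.of_forall fun t ht x hx => ?_
      rw [uIoc_of_le hχ.1.le] at ht
      exact hg.deriv x hx t ⟨ht.1, ht.2.trans hχ.2⟩

/-- Primitives lose the singular envelope, so they can be exponentiated by `exp`. -/
theorem integral_one (hg : BoundedFamily J B e g g₁) (hB : 0 ≤ B)
    (he : IntervalIntegrable e volume 0 B) (he0 : ∀ χ ∈ Ioc 0 B, 0 ≤ e χ) :
    BoundedFamily J B (fun _ => 1) (fun l χ => ∫ x in (0 : ℝ)..χ, g l x)
      (fun l χ => ∫ x in (0 : ℝ)..χ, g₁ l x) := by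
  refine (hg.integral hB he).mono (c := ∫ x in (0 : ℝ)..B, e x) ?_ ?_
  · rw [intervalIntegral.integral_of_le hB]
    exact setIntegral_nonneg measurableSet_Ioc he0
  · intro χ hχ
    rw [mul_one]
    refine integral_mono_interval le_rfl hχ.1.le hχ.2 ?_ he
    filter_upwards [ae_restrict_mem measurableSet_Ioc] with x hx using he0 x hx

/-- Differentiation of the solution of a linear equation with respect to a parameter. -/
theorem linearSolution {k k₁ σ σ₁ : ℝ → ℝ → ℝ} (hB : 0 ≤ B)
    (he : IntervalIntegrable e volume 0 B) (he0 : ∀ χ ∈ Ioc 0 B, 0 ≤ e χ)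
    (hk : BoundedFamily J B e k k₁) (hσ : BoundedFamily J B e σ σ₁) :
    BoundedFamily J B (fun _ => 1) (fun l => linearSolution (k l) (σ l))
      (fun l => _root_.linearSolution (k l)
        (fun x => σ₁ l x - k₁ l x * _root_.linearSolution (k l) (σ l) x)) := by
  have hA := hk.integral_one hB he he0
  have hI := (hA.exp.mul hσ).mono (e' := e) (c := 1) zero_le_one (fun χ _ => by simp)
  have hI' := hI.integral_one hB he he0
  have hE := ((hA.const_mul (-1)).exp.mul hI').mono (e' := fun _ => 1) (c := 1) zero_le_one
    (fun χ _ => by simp)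
  refine hE.congr (fun l hl χ hχ => by simp [_root_.linearSolution]) fun l hl χ hχ => ?_
  have hχ' : χ ∈ Icc 0 B := ⟨hχ.1.le, hχ.2⟩
  have rk := hk.regularOn hB he hl
  have rk1 := hk.regularOn_deriv hB he hl
  have rσ := hσ.regularOn hB he hl
  have rσ1 := hσ.regularOn_deriv hB he hl
  have rI := rk.exp_primitive_mul hB rσ
  have cI := rI.continuousOn_primitive hB
  have cA1 := rk1.continuousOn_primitive hB
  have hint : ∀ x, Real.exp (∫ y in (0 : ℝ)..x, k l y) *
      (σ₁ l x - k₁ l x * _root_.linearSolution (k l) (σ l) x)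
      = Real.exp (∫ y in (0 : ℝ)..x, k l y) * σ₁ l x
        - (∫ y in (0 : ℝ)..x, Real.exp (∫ z in (0 : ℝ)..y, k l z) * σ l y) * k₁ l x := by
    intro x
    have : Real.exp (∫ y in (0 : ℝ)..x, k l y) * Real.exp (-∫ y in (0 : ℝ)..x, k l y) = 1 := by
      rw [← Real.exp_add]; simp
    rw [_root_.linearSolution]
    linear_combination (-(k₁ l x * ∫ y in (0 : ℝ)..x, Real.exp (∫ z in (0 : ℝ)..y, k l z) * σ l y))
      * this
  -- The product rule leaves double integrals containing ∫k₁. Integrating by parts combines them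
  -- into one source term -k₁ m, so the derivative is again a `linearSolution` and can be
  -- differentiated once more.
  have hparts := integral_mul_deriv_eq_deriv_mul_of_hasDerivAt (a := 0) (b := χ)
    (u := fun x => ∫ y in (0 : ℝ)..x, k₁ l y) (u' := k₁ l)
    (v := fun x => ∫ y in (0 : ℝ)..x, Real.exp (∫ z in (0 : ℝ)..y, k l z) * σ l y)
    (v' := fun y => Real.exp (∫ z in (0 : ℝ)..y, k l z) * σ l y)
    (by rw [uIcc_of_le hχ.1.le]; exact cA1.mono (Icc_subset_Icc_right hχ.2))
    (by rw [uIcc_of_le hχ.1.le]; exact cI.mono (Icc_subset_Icc_right hχ.2))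
    (fun x hx => by
      rw [min_eq_left hχ.1.le, max_eq_right hχ.1.le] at hx
      exact rk1.hasDerivAt_primitive ⟨hx.1, hx.2.trans_le hχ.2⟩)
    (fun x hx => by
      rw [min_eq_left hχ.1.le, max_eq_right hχ.1.le] at hx
      exact rI.hasDerivAt_primitive ⟨hx.1, hx.2.trans_le hχ.2⟩)
    (rk1.mono hχ').int (rI.mono hχ').int
  have r1 := (rI.continuousOn_mul hB cA1).mono hχ'
  have r2 := (rk.exp_primitive_mul hB rσ1).mono hχ'
  have r3 := (rk1.continuousOn_mul hB cI).mono hχ'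
  rw [_root_.linearSolution]
  simp only [hint]
  rw [intervalIntegral.integral_sub r2.int r3.int]
  have e1 : (∫ x in (0 : ℝ)..χ, (Real.exp (∫ y in (0 : ℝ)..x, k l y) *
        (∫ y in (0 : ℝ)..x, k₁ l y) * σ l x + Real.exp (∫ y in (0 : ℝ)..x, k l y) * σ₁ l x))
      = (∫ x in (0 : ℝ)..χ, (∫ y in (0 : ℝ)..x, k₁ l y) *
          (Real.exp (∫ y in (0 : ℝ)..x, k l y) * σ l x))
        + ∫ x in (0 : ℝ)..χ, Real.exp (∫ y in (0 : ℝ)..x, k l y) * σ₁ l x := by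
    rw [← intervalIntegral.integral_add r1.int r2.int]
    congr 1; ext x; ring
  have e2 : (∫ x in (0 : ℝ)..χ, (∫ y in (0 : ℝ)..x, Real.exp (∫ z in (0 : ℝ)..y, k l z) * σ l y)
      * k₁ l x) = ∫ x in (0 : ℝ)..χ, k₁ l x *
        ∫ y in (0 : ℝ)..x, Real.exp (∫ z in (0 : ℝ)..y, k l z) * σ l y := by
    congr 1; ext x; ring
  rw [e1, e2, hparts]
  simp only [intervalIntegral.integral_same, neg_one_mul]
  ring

end BoundedFamily

/-- Second variation of the solution of a linear equation depending on a parameter. -/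
theorem hasSecondVariation_linearSolution {J : Set ℝ} {B : ℝ} {e : ℝ → ℝ} (h0 : (0 : ℝ) ∈ J)
    {k k₁ k₂ σ σ₁ σ₂ : ℝ → ℝ → ℝ} (hB : 0 < B)
    (he : IntervalIntegrable e volume 0 B) (he1 : ∃ c, 0 ≤ c ∧ ∀ χ ∈ Ioc 0 B, 1 ≤ c * e χ)
    (hk : BoundedFamily J B e k k₁) (hk' : BoundedFamily J B e k₁ k₂)
    (hσ : BoundedFamily J B e σ σ₁) (hσ' : BoundedFamily J B e σ₁ σ₂) :
    ∃ m m₁ : ℝ → ℝ, m = linearSolution (k 0) (σ 0) ∧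
    m₁ = linearSolution (k 0) (fun x => σ₁ 0 x - k₁ 0 x * m x) ∧
    HasDerivAt (fun l => linearSolution (k l) (σ l) B) (m₁ B) 0 ∧
    HasSecondVariation (fun l => linearSolution (k l) (σ l) B)
      (linearSolution (k 0) (fun x => σ₂ 0 x - k₂ 0 x * m x - 2 * k₁ 0 x * m₁ x) B) := by
  obtain ⟨c, hc, he1⟩ := he1
  have he0 : ∀ χ ∈ Ioc 0 B, 0 ≤ e χ := fun χ hχ => by
    by_contra hneg
    have := he1 χ hχ
    nlinarith
  have hm := BoundedFamily.linearSolution hB.le he he0 hk hσ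
  -- The source σ₁ - k₁ m contributes -k₁ m₁ on differentiation, and differentiating the coefficient
  -- contributes the same term again; hence the factor 2 in the result.
  have h1 := (hσ'.sub ((hk'.mul hm).mono (e' := e) (c := 1) zero_le_one (fun χ _ => by simp)))
  have hm' := BoundedFamily.linearSolution hB.le he he0 hk h1
  have hBm : B ∈ Ioc 0 B := ⟨hB, le_rfl⟩
  refine ⟨_, _, rfl, rfl, hm.deriv 0 h0 B hBm,
    fun l => linearSolution (k l) (fun x => σ₁ l x - k₁ l x * linearSolution (k l) (σ l) x) B,
    ?_, ?_⟩
  · filter_upwards [hm.isOpen.mem_nhds h0] with l hl using hm.deriv l hl B hBm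
  · refine (hm'.deriv 0 h0 B hBm).congr_deriv ?_
    congr 1
    ext x
    ring

/-! ### Identities and regularity for a single configuration. -/

namespace StarData

/-- The quantity `1 - 2m/r = g(∇r, ∇r)`. -/
noncomputable def gradSq (d : StarData) (χ : ℝ) : ℝ := 1 - 2 * d.mass χ / d.r χ

/-- The continuous extension to the centre of `4π r² ∂r/∂χ`, for a configuration. -/
noncomputable def volDensity (d : StarData) (χ : ℝ) : ℝ :=
  √(d.gradSq χ / d.n χ ^ 2 + d.rφ χ ^ 2)

/-- The Euclidean volume `4π r³ / 3`. -/
noncomputable def vol (d : StarData) (χ : ℝ) : ℝ := 4 * Real.pi / 3 * d.r χ ^ 3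

namespace IsConfiguration

variable {d : StarData} {B : ℝ}

theorem r_nonneg (h : d.IsConfiguration B) {χ : ℝ} (hχ : χ ∈ Icc 0 B) : 0 ≤ d.r χ := by
  rcases hχ.1.eq_or_lt with h0 | h0
  · rw [← h0, h.r_zero]
  · exact (h.r_pos χ ⟨h0, hχ.2⟩).le

/-- Differentiating the particle count in the label; this determines e^ω from r and n. -/
theorem n_mul_area_eq_one (h : d.IsConfiguration B) (hB : 0 < B) {χ : ℝ} (hχ : χ ∈ Ioc 0 B) :
    d.n χ * (4 * Real.pi * (d.r χ) ^ 2 * Real.exp (d.ω χ)) = 1 := by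
  have hreg : RegularOn B (fun x => d.n x * (4 * Real.pi * (d.r x) ^ 2 * Real.exp (d.ω x))) := by
    refine ⟨?_, ?_⟩
    · exact (h.n_cont.mono Ioc_subset_Icc_self).mul ((continuousOn_const.mul
        ((h.r_cont.mono Ioc_subset_Icc_self).pow 2)).mul h.ω_cont.rexp)
    -- A non-integrable integrand would have integral 0 by convention, whereas the count at the
    -- boundary is B > 0.
    · by_contra hn
      have := h.counts B ⟨hB.le, le_rfl⟩
      rw [particleNumber, integral_undef hn] at this
      exact hB.ne this
  have h1 := hreg.hasDerivWithinAt_primitive hχ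
  have h2 : HasDerivWithinAt (fun χ => ∫ x in (0 : ℝ)..χ,
      d.n x * (4 * Real.pi * (d.r x) ^ 2 * Real.exp (d.ω x))) 1 (Icc 0 B) χ :=
    (hasDerivWithinAt_id χ _).congr (fun x hx => h.counts x hx) (h.counts χ ⟨hχ.1.le, hχ.2⟩)
  exact (uniqueDiffOn_Icc hB χ ⟨hχ.1.le, hχ.2⟩).eq_deriv _ h1 h2

/-- The Hawking identity with ω eliminated by the particle count: n is expressed through w, v and m.
-/
theorem n_sq_mul (h : d.IsConfiguration B) (hB : 0 < B) {χ : ℝ} (hχ : χ ∈ Ioc 0 B) :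
    d.n χ ^ 2 * ((4 * Real.pi * d.r χ ^ 2 * d.rχ χ) ^ 2 - d.rφ χ ^ 2) = d.gradSq χ := by
  have h1 := h.n_mul_area_eq_one hB hχ
  have h2 := h.hawking χ hχ
  have h3 : Real.exp (-2 * d.ω χ) = (d.n χ * (4 * Real.pi * (d.r χ) ^ 2)) ^ 2 := by
    have h4 : Real.exp (-2 * d.ω χ) * Real.exp (d.ω χ) ^ 2 = 1 := by
      rw [← Real.exp_nat_mul, ← Real.exp_add]; simp
    have h5 : (d.n χ * (4 * Real.pi * (d.r χ) ^ 2)) ^ 2 * Real.exp (d.ω χ) ^ 2 = 1 := by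
      rw [← mul_pow, mul_assoc, h1, one_pow]
    exact mul_right_cancel₀ (pow_ne_zero 2 (Real.exp_pos _).ne') (h4.trans h5.symm)
  rw [gradSq, h2, h3]
  ring

theorem gradSq_pos (h : d.IsConfiguration B) {χ : ℝ} (hχ : χ ∈ Icc 0 B) : 0 < d.gradSq χ := by
  rcases hχ.1.eq_or_lt with h0 | h0
  -- At the centre the quotient by r = 0 is 0 by convention, so `gradSq` has there its correct limit
  -- 1.
  · simp [gradSq, ← h0, h.r_zero]
  · have h1 := h.r_pos χ ⟨h0, hχ.2⟩
    have h2 := h.untrapped χ ⟨h0, hχ.2⟩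
    rw [gradSq, sub_pos, div_lt_one h1]
    exact h2

theorem density_pos (h : d.IsConfiguration B) {χ : ℝ} (hχ : χ ∈ Ioc 0 B) :
    0 < 4 * Real.pi * d.r χ ^ 2 * d.rχ χ := by
  have := h.r_pos χ hχ
  have := h.rχ_pos χ hχ
  positivity

/-- Solving `n_sq_mul` for the positive root. The right side makes sense at the centre, where ∂r/∂χ
need not. -/
theorem density_eq (h : d.IsConfiguration B) (hB : 0 < B) {χ : ℝ} (hχ : χ ∈ Ioc 0 B) :
    4 * Real.pi * d.r χ ^ 2 * d.rχ χ = d.volDensity χ := by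
  have hn := h.n_pos χ ⟨hχ.1.le, hχ.2⟩
  rw [volDensity, ← h.n_sq_mul hB hχ, mul_div_cancel_left₀ _ (pow_ne_zero 2 hn.ne'),
    sub_add_cancel, Real.sqrt_sq (h.density_pos hχ).le]

theorem volDensity_sq (h : d.IsConfiguration B) {χ : ℝ} (hχ : χ ∈ Icc 0 B) :
    d.n χ ^ 2 * (d.volDensity χ ^ 2 - d.rφ χ ^ 2) = d.gradSq χ := by
  have hn := h.n_pos χ hχ
  have ha := h.gradSq_pos hχ
  rw [volDensity, Real.sq_sqrt (by positivity)]
  field_simp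
  ring

theorem volDensity_pos (h : d.IsConfiguration B) {χ : ℝ} (hχ : χ ∈ Icc 0 B) :
    0 < d.volDensity χ := by
  have hn := h.n_pos χ hχ
  have ha := h.gradSq_pos hχ
  rw [volDensity]
  positivity

theorem sq_lt_volDensity_sq (h : d.IsConfiguration B) {χ : ℝ} (hχ : χ ∈ Icc 0 B) :
    d.rφ χ ^ 2 < d.volDensity χ ^ 2 := by
  have hn := h.n_pos χ hχ
  have ha := h.gradSq_pos hχ
  rw [← h.volDensity_sq hχ] at ha
  have := pos_of_mul_pos_right ha (by positivity)
  linarith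

theorem vol_zero (h : d.IsConfiguration B) : d.vol 0 = 0 := by simp [vol, h.r_zero]

theorem hasDerivWithinAt_vol (h : d.IsConfiguration B) {χ : ℝ} (hχ : χ ∈ Ioc 0 B) :
    HasDerivWithinAt d.vol (4 * Real.pi * d.r χ ^ 2 * d.rχ χ) (Icc 0 B) χ := by
  refine (((h.r_deriv χ hχ).pow 3).const_mul (4 * Real.pi / 3)).congr_deriv ?_
  push_cast
  ring

theorem vol_continuousOn (h : d.IsConfiguration B) : ContinuousOn d.vol (Icc 0 B) :=
  continuousOn_const.mul (h.r_cont.pow 3)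

/-- Integrability up to the centre costs nothing: this is the non-negative derivative of a
continuous function, the Euclidean volume. -/
theorem density_regularOn (h : d.IsConfiguration B) (hB : 0 < B) :
    RegularOn B (fun χ => 4 * Real.pi * d.r χ ^ 2 * d.rχ χ) := by
  refine ⟨(continuousOn_const.mul ((h.r_cont.mono Ioc_subset_Icc_self).pow 2)).mul h.rχ_cont, ?_⟩
  rw [intervalIntegrable_iff_integrableOn_Ioc_of_le hB.le]
  refine integrableOn_deriv_of_nonneg h.vol_continuousOn (fun x hx => ?_)
    (fun x hx => (h.density_pos ⟨hx.1, hx.2.le⟩).le)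
  exact (h.hasDerivWithinAt_vol ⟨hx.1, hx.2.le⟩).hasDerivAt (Icc_mem_nhds hx.1 hx.2)

theorem integral_density (h : d.IsConfiguration B) (hB : 0 < B) {χ : ℝ} (hχ : χ ∈ Icc 0 B) :
    ∫ x in (0 : ℝ)..χ, 4 * Real.pi * d.r x ^ 2 * d.rχ x = d.vol χ := by
  rw [integral_eq_sub_of_hasDerivAt_of_le hχ.1
    (h.vol_continuousOn.mono (Icc_subset_Icc_right hχ.2)) (fun x hx => ?_)
    ((h.density_regularOn hB).mono hχ).int, h.vol_zero, sub_zero]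
  exact (h.hasDerivWithinAt_vol ⟨hx.1, hx.2.le.trans hχ.2⟩).hasDerivAt
    (Icc_mem_nhds hx.1 (hx.2.trans_le hχ.2))

theorem rho_continuousOn (h : d.IsConfiguration B) : ContinuousOn d.rho (Icc 0 B) :=
  ((h.n_cont.pow 2).add continuousOn_const).div_const 2

theorem rho_pos (d : StarData) (χ : ℝ) : 0 < d.rho χ := by
  rw [rho]; positivity

theorem massDensity_regularOn (h : d.IsConfiguration B) (hB : 0 < B) :
    RegularOn B (fun x => d.rho x * (4 * Real.pi * (d.r x) ^ 2 * d.rχ x)) :=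
  (h.density_regularOn hB).continuousOn_mul hB.le h.rho_continuousOn

theorem mass_continuousOn (h : d.IsConfiguration B) (hB : 0 < B) :
    ContinuousOn d.mass (Icc 0 B) :=
  (h.massDensity_regularOn hB).continuousOn_primitive hB.le

theorem mass_zero (d : StarData) : d.mass 0 = 0 := by simp [mass]

theorem hasDerivWithinAt_mass (h : d.IsConfiguration B) (hB : 0 < B) {χ : ℝ} (hχ : χ ∈ Ioc 0 B) :
    HasDerivWithinAt d.mass (d.rho χ * d.volDensity χ) (Icc 0 B) χ := by
  rw [← h.density_eq hB hχ]
  exact (h.massDensity_regularOn hB).hasDerivWithinAt_primitive hχ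

theorem mass_le (h : d.IsConfiguration B) (hB : 0 < B) {C χ : ℝ} (hχ : χ ∈ Icc 0 B)
    (hC : ∀ x ∈ Ioc 0 χ, d.rho x ≤ C) : d.mass χ ≤ C * d.vol χ := by
  rw [← h.integral_density hB hχ, ← intervalIntegral.integral_const_mul, mass]
  refine integral_mono_on_of_le_Ioo hχ.1 ((h.massDensity_regularOn hB).mono hχ).int
    (((h.density_regularOn hB).const_mul C).mono hχ).int fun x hx => ?_
  exact mul_le_mul_of_nonneg_right (hC x ⟨hx.1, hx.2.le⟩)
    (h.density_pos ⟨hx.1, hx.2.le.trans hχ.2⟩).le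

theorem le_mass (h : d.IsConfiguration B) (hB : 0 < B) {c χ : ℝ} (hχ : χ ∈ Icc 0 B)
    (hc : ∀ x ∈ Ioc 0 χ, c ≤ d.rho x) : c * d.vol χ ≤ d.mass χ := by
  rw [← h.integral_density hB hχ, ← intervalIntegral.integral_const_mul, mass]
  refine integral_mono_on_of_le_Ioo hχ.1 (((h.density_regularOn hB).const_mul c).mono hχ).int
    ((h.massDensity_regularOn hB).mono hχ).int fun x hx => ?_
  exact mul_le_mul_of_nonneg_right (hc x ⟨hx.1, hx.2.le⟩)
    (h.density_pos ⟨hx.1, hx.2.le.trans hχ.2⟩).le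

theorem vol_pos (h : d.IsConfiguration B) {χ : ℝ} (hχ : χ ∈ Ioc 0 B) : 0 < d.vol χ := by
  have := h.r_pos χ hχ
  rw [vol]; positivity

theorem mass_nonneg (h : d.IsConfiguration B) (hB : 0 < B) {χ : ℝ} (hχ : χ ∈ Icc 0 B) :
    0 ≤ d.mass χ := by
  simpa using h.le_mass hB (c := 0) hχ fun x _ => (rho_pos d x).le

theorem gradSq_le_one (h : d.IsConfiguration B) (hB : 0 < B) {χ : ℝ} (hχ : χ ∈ Icc 0 B) :
    d.gradSq χ ≤ 1 := by
  have h1 := h.mass_nonneg hB hχ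
  have h2 := h.r_nonneg hχ
  have : 0 ≤ 2 * d.mass χ / d.r χ := by positivity
  rw [gradSq]; linarith

theorem gradSq_ge (h : d.IsConfiguration B) (hB : 0 < B) {C χ : ℝ} (hχ : χ ∈ Icc 0 B)
    (hC : ∀ x ∈ Ioc 0 χ, d.rho x ≤ C) : 1 - 8 * Real.pi / 3 * C * d.r χ ^ 2 ≤ d.gradSq χ := by
  rcases hχ.1.eq_or_lt with h0 | h0
  · simp [gradSq, ← h0, h.r_zero]
  · have h1 := h.mass_le hB hχ hC
    have h2 := h.r_pos χ ⟨h0, hχ.2⟩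
    rw [gradSq, sub_le_sub_iff_left, div_le_iff₀ h2]
    rw [vol] at h1
    linarith

/-- Only the centre needs an argument: ρ is bounded, so m = O(r³) and 2m/r = O(r²). -/
theorem gradSq_continuousOn (h : d.IsConfiguration B) (hB : 0 < B) :
    ContinuousOn d.gradSq (Icc 0 B) := by
  intro χ hχ
  rcases hχ.1.eq_or_lt with h0 | h0
  · subst h0
    obtain ⟨C, hC⟩ := isCompact_Icc.exists_bound_of_continuousOn h.rho_continuousOn
    have hr : Tendsto d.r (𝓝[Icc 0 B] 0) (𝓝 0) := by
      have := h.r_cont 0 hχ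
      rwa [ContinuousWithinAt, h.r_zero] at this
    have h1 : Tendsto (fun χ => 1 - 8 * Real.pi / 3 * C * d.r χ ^ 2) (𝓝[Icc 0 B] 0) (𝓝 1) := by
      have := (hr.pow 2).const_mul (8 * Real.pi / 3 * C)
      simpa using this.const_sub 1
    rw [ContinuousWithinAt]
    have : d.gradSq 0 = 1 := by simp [gradSq, h.r_zero]
    rw [this]
    refine tendsto_of_tendsto_of_tendsto_of_le_of_le' h1 tendsto_const_nhds ?_ ?_
    · filter_upwards [self_mem_nhdsWithin] with x hx
      exact h.gradSq_ge hB hx fun y hy =>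
        (le_abs_self _).trans (hC y ⟨hy.1.le, hy.2.trans hx.2⟩)
    · filter_upwards [self_mem_nhdsWithin] with x hx using h.gradSq_le_one hB hx
  · exact continuousWithinAt_const.sub ((continuousWithinAt_const.mul
      (h.mass_continuousOn hB χ hχ)).div (h.r_cont χ hχ) (h.r_pos χ ⟨h0, hχ.2⟩).ne')

theorem volDensity_continuousOn (h : d.IsConfiguration B) (hB : 0 < B) :
    ContinuousOn d.volDensity (Icc 0 B) :=
  (((h.gradSq_continuousOn hB).div (h.n_cont.pow 2)
    fun χ hχ => (pow_pos (h.n_pos χ hχ) 2).ne').add (h.rφ_cont.pow 2)).sqrt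

theorem integral_volDensity (h : d.IsConfiguration B) (hB : 0 < B) {χ : ℝ} (hχ : χ ∈ Icc 0 B) :
    ∫ x in (0 : ℝ)..χ, d.volDensity x = d.vol χ := by
  rw [← h.integral_density hB hχ]
  refine integral_congr_ae (Eventually.of_forall fun x hx => ?_)
  rw [uIoc_of_le hχ.1] at hx
  exact (h.density_eq hB ⟨hx.1, hx.2.trans hχ.2⟩).symm

end IsConfiguration

end StarData

/-! ### The singularity of 1/r at the centre. -/

/-- The weight `χ^{-1/3}`, to which `1/r` is comparable near the centre. -/
noncomputable def centralWeight (χ : ℝ) : ℝ := χ ^ (-1 / 3 : ℝ)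

section CentralWeight

theorem centralWeight_pos {χ : ℝ} (hχ : 0 < χ) : 0 < centralWeight χ := Real.rpow_pos_of_pos hχ _

theorem centralWeight_cube {χ : ℝ} (hχ : 0 < χ) : centralWeight χ ^ 3 * χ = 1 := by
  rw [centralWeight, ← Real.rpow_natCast, ← Real.rpow_mul hχ.le]
  norm_num
  rw [Real.rpow_neg_one, inv_mul_cancel₀ hχ.ne']

theorem intervalIntegrable_centralWeight (a b : ℝ) :
    IntervalIntegrable centralWeight volume a b :=
  intervalIntegrable_rpow' (by norm_num)

theorem integral_centralWeight {B : ℝ} (hB : 0 < B) :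
    ∫ x in (0 : ℝ)..B, centralWeight x = 3 / 2 * (B * centralWeight B) := by
  simp only [centralWeight]
  rw [integral_rpow (Or.inl (by norm_num))]
  norm_num
  have : B ^ (2 / 3 : ℝ) = B * B ^ (-1 / 3 : ℝ) := by
    nth_rewrite 2 [← Real.rpow_one B]
    rw [← Real.rpow_add hB]; norm_num
  rw [this]; norm_num; ring

theorem centralWeight_continuousOn (B : ℝ) : ContinuousOn centralWeight (Ioc 0 B) :=
  fun _ hχ => (Real.continuousAt_rpow_const _ _ (Or.inl hχ.1.ne')).continuousWithinAt

theorem centralWeight_regularOn (B : ℝ) : RegularOn B centralWeight :=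
  ⟨centralWeight_continuousOn B, intervalIntegrable_centralWeight 0 B⟩

/-- Lets bounded families enter sums controlled by the singular envelope. -/
theorem one_le_mul_centralWeight (B : ℝ) :
    ∃ c, 0 ≤ c ∧ ∀ χ ∈ Ioc 0 B, 1 ≤ c * centralWeight χ := by
  -- With c = max B 1 one has χ ≤ c ≤ c³, which is the claim cubed and multiplied by χ.
  refine ⟨(max B 1) , by positivity, fun χ hχ => ?_⟩
  have h1 := centralWeight_pos hχ.1
  have h2 := centralWeight_cube hχ.1
  have h3 : (1 : ℝ) ≤ max B 1 := le_max_right _ _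
  have h4 : χ ≤ max B 1 := hχ.2.trans (le_max_left _ _)
  by_contra! hlt
  have h5 : (max B 1 * centralWeight χ) ^ 3 < 1 :=
    pow_lt_one₀ (by positivity) hlt (by norm_num)
  have h6 : centralWeight χ ^ 3 * χ ≤ centralWeight χ ^ 3 * max B 1 ^ 3 := by
    refine mul_le_mul_of_nonneg_left (h4.trans ?_) (by positivity)
    exact le_self_pow₀ h3 (by norm_num)
  rw [mul_pow] at h5
  linarith

end CentralWeight

/-- The inverse area radius as a function of the Euclidean volume `V = 4π r³ / 3`. -/
noncomputable def invRadius (V : ℝ) : ℝ := (3 / (4 * Real.pi) * V) ^ (-1 / 3 : ℝ)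

section InvRadius

theorem invRadius_pos {V : ℝ} (hV : 0 < V) : 0 < invRadius V :=
  Real.rpow_pos_of_pos (by positivity) _

theorem invRadius_cube {V : ℝ} (hV : 0 < V) : invRadius V ^ 3 * V = 4 * Real.pi / 3 := by
  have h0 : 0 < 3 / (4 * Real.pi) * V := by positivity
  have : invRadius V ^ 3 = (3 / (4 * Real.pi) * V)⁻¹ := by
    rw [invRadius, ← Real.rpow_natCast, ← Real.rpow_mul h0.le]
    norm_num
    rw [Real.rpow_neg_one]
    field_simp
  rw [this]
  field_simp

theorem invRadius_vol {r : ℝ} (hr : 0 < r) : invRadius (4 * Real.pi / 3 * r ^ 3) = r⁻¹ := by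
  have h1 := invRadius_cube (V := 4 * Real.pi / 3 * r ^ 3) (by positivity)
  have h2 := invRadius_pos (V := 4 * Real.pi / 3 * r ^ 3) (by positivity)
  refine (pow_left_inj₀ h2.le (by positivity) three_ne_zero).1 ?_
  field_simp at h1 ⊢
  linarith

theorem hasDerivAt_invRadius {V : ℝ} (hV : 0 < V) :
    HasDerivAt invRadius (-(1 / (4 * Real.pi)) * invRadius V ^ 4) V := by
  have h0 : 0 < 3 / (4 * Real.pi) * V := by positivity
  have h1 := ((hasDerivAt_id V).const_mul (3 / (4 * Real.pi))).rpow_const (p := (-1 / 3 : ℝ))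
    (Or.inl h0.ne')
  refine h1.congr_deriv ?_
  have h2 : (3 / (4 * Real.pi) * V) ^ ((-1 / 3 : ℝ) - 1) = invRadius V ^ 4 := by
    rw [invRadius, ← Real.rpow_natCast, ← Real.rpow_mul h0.le]; norm_num
  simp only [id]
  rw [h2]
  field_simp

theorem invRadius_continuousOn : ContinuousOn invRadius (Ioi 0) :=
  fun _ hV => (hasDerivAt_invRadius hV).continuousAt.continuousWithinAt

theorem invRadius_le {c χ V : ℝ} (hc : 0 < c) (hχ : 0 < χ) (hV : c * χ ≤ V) :
    invRadius V ≤ (4 * Real.pi / (3 * c) + 1) * centralWeight χ := by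
  have hV0 : 0 < V := (mul_pos hc hχ).trans_le hV
  have h1 := invRadius_cube hV0
  have h2 := centralWeight_cube hχ
  have h3 := invRadius_pos hV0
  have h4 := centralWeight_pos hχ
  refine le_of_pow_le_pow_left₀ three_ne_zero (by positivity) ?_
  set K := 4 * Real.pi / (3 * c) with hK
  have hK0 : 0 < K := by positivity
  have h5 : invRadius V ^ 3 * (c * χ) ≤ 4 * Real.pi / 3 := by
    rw [← h1]; exact mul_le_mul_of_nonneg_left hV (by positivity)
  have h6 : invRadius V ^ 3 * χ ≤ K := by
    rw [hK, le_div_iff₀ (by positivity)]; nlinarith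
  -- The cubed inequality only needs a constant whose cube exceeds K; K + 1 avoids a cube root.
  have h7 : K ≤ (K + 1) ^ 3 := by nlinarith [sq_nonneg K, mul_pos hK0 (mul_pos hK0 hK0)]
  have h8 : invRadius V ^ 3 * χ ≤ ((K + 1) * centralWeight χ) ^ 3 * χ := by
    rw [mul_pow, mul_assoc, h2, mul_one]; exact h6.trans h7
  exact le_of_mul_le_mul_right h8 hχ

end InvRadius

namespace BoundedFamily

variable {J : Set ℝ} {B : ℝ} {V V₁ V₂ g g₁ g₂ : ℝ → ℝ → ℝ}

/-- Differentiation does not worsen the singularity: the derivative is of the order q⁴V₁ with q =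
O(χ^{-1/3}) and V₁ = O(χ), hence again O(χ^{-1/3}). -/
theorem invRadius (hV : BoundedFamily J B (fun χ => χ) V V₁) {c : ℝ} (hc : 0 < c)
    (hpos : ∀ l ∈ J, ∀ χ ∈ Ioc 0 B, c * χ ≤ V l χ) :
    BoundedFamily J B centralWeight (fun l χ => _root_.invRadius (V l χ))
      (fun l χ => -(1 / (4 * Real.pi)) * _root_.invRadius (V l χ) ^ 4 * V₁ l χ) := by
  refine hV.comp (s := Ioi 0) (φ' := fun x => -(1 / (4 * Real.pi)) * _root_.invRadius x ^ 4)
    (fun l hl χ hχ => (mul_pos hc hχ.1).trans_le (hpos l hl χ hχ))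
    (fun x hx => hasDerivAt_invRadius hx) (continuousOn_const.mul (invRadius_continuousOn.pow 4)) ?_
  obtain ⟨C, hC, hb⟩ := hV.bound
  set K := 4 * Real.pi / (3 * c) + 1 with hK
  have hK0 : 0 < K := by positivity
  refine ⟨K + (1 / (4 * Real.pi)) * K ^ 4 * C, by positivity, fun l hl χ hχ => ?_⟩
  have hq := invRadius_le hc hχ.1 (hpos l hl χ hχ)
  have hq0 := invRadius_pos ((mul_pos hc hχ.1).trans_le (hpos l hl χ hχ))
  have he := centralWeight_pos hχ.1
  have he3 := centralWeight_cube hχ.1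
  have h1 : 0 ≤ (1 / (4 * Real.pi)) * K ^ 4 * C * centralWeight χ := by positivity
  rw [add_mul]
  refine ⟨by rw [abs_of_pos hq0]; linarith, ?_⟩
  have h2 : |(-(1 / (4 * Real.pi)) * _root_.invRadius (V l χ) ^ 4) * V₁ l χ|
      ≤ (1 / (4 * Real.pi)) * (K * centralWeight χ) ^ 4 * (C * χ) := by
    rw [abs_mul, abs_mul, abs_neg, abs_of_pos (by positivity : 0 < 1 / (4 * Real.pi)),
      abs_of_pos (by positivity : 0 < _root_.invRadius (V l χ) ^ 4)]
    gcongr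
    exact (hb l hl χ hχ).2
  have h3 : (1 / (4 * Real.pi)) * (K * centralWeight χ) ^ 4 * (C * χ)
      = (1 / (4 * Real.pi)) * K ^ 4 * C * centralWeight χ * (centralWeight χ ^ 3 * χ) := by ring
  rw [h3, he3, mul_one] at h2
  have : 0 ≤ K * centralWeight χ := by positivity
  linarith

theorem invRadius_deriv (hV : BoundedFamily J B (fun χ => χ) V V₁)
    (hV' : BoundedFamily J B (fun χ => χ) V₁ V₂) {c : ℝ} (hc : 0 < c)
    (hpos : ∀ l ∈ J, ∀ χ ∈ Ioc 0 B, c * χ ≤ V l χ) :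
    BoundedFamily J B centralWeight
      (fun l χ => -(1 / (4 * Real.pi)) * _root_.invRadius (V l χ) ^ 4 * V₁ l χ)
      (fun l χ => 1 / (4 * Real.pi ^ 2) * _root_.invRadius (V l χ) ^ 7 * V₁ l χ ^ 2
        - 1 / (4 * Real.pi) * _root_.invRadius (V l χ) ^ 4 * V₂ l χ) := by
  have hq := hV.invRadius hc hpos
  have h4 := (((hq.mul hq).mul (hq.mul hq)).mul hV').const_mul (-(1 / (4 * Real.pi)))
  refine (h4.mono (e' := centralWeight) (c := 1) zero_le_one fun χ hχ => ?_).congr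
    (fun l hl χ hχ => by ring) (fun l hl χ hχ => ?_)
  · have := centralWeight_cube hχ.1
    refine le_of_eq ?_
    linear_combination centralWeight χ * this
  · have := Real.pi_pos
    field_simp
    ring

theorem inv (hg : BoundedFamily J B (fun _ => 1) g g₁) {c : ℝ} (hc : 0 < c)
    (hpos : ∀ l ∈ J, ∀ χ ∈ Ioc 0 B, c ≤ g l χ) :
    BoundedFamily J B (fun _ => 1) (fun l χ => (g l χ)⁻¹)
      (fun l χ => -((g l χ)⁻¹ * (g l χ)⁻¹ * g₁ l χ)) := by
  obtain ⟨C, hC, hb⟩ := hg.bound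
  refine (hg.comp_compact (s := Icc c C) (φ := fun x => x⁻¹) (φ' := fun x => -(x ^ 2)⁻¹)
    isCompact_Icc (fun l hl χ hχ => ?_)
    (fun x hx => hasDerivAt_inv (hc.trans_le hx.1).ne') ?_).congr (fun l hl χ hχ => rfl)
      (fun l hl χ hχ => ?_)
  · refine ⟨hpos l hl χ hχ, ?_⟩
    simpa using (le_abs_self _).trans (hb l hl χ hχ).1
  · exact ((continuousOn_id.pow 2).inv₀ fun x hx => (pow_pos (hc.trans_le hx.1) 2).ne').neg
  · rw [sq, mul_inv]; ring

theorem integral_id (hB : 0 ≤ B)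
    (hg : BoundedFamily J B (fun _ => 1) g g₁) :
    BoundedFamily J B (fun χ => χ) (fun l χ => ∫ x in (0 : ℝ)..χ, g l x)
      (fun l χ => ∫ x in (0 : ℝ)..χ, g₁ l x) :=
  (hg.integral hB (by simp)).mono (c := 1) zero_le_one fun χ _ => by simp

theorem mul_one_env (hg : BoundedFamily J B (fun _ => 1) g g₁)
    {e : ℝ → ℝ} {h h₁ : ℝ → ℝ → ℝ} (hh : BoundedFamily J B e h h₁) :
    BoundedFamily J B e (fun l χ => g l χ * h l χ) (fun l χ => g₁ l χ * h l χ + g l χ * h₁ l χ) :=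
  (hg.mul hh).mono (c := 1) zero_le_one fun χ _ => by simp

end BoundedFamily

/-- The centre itself carries no mass, so coefficients may be replaced where identities are known
only for χ > 0. -/
theorem linearSolution_congr {k k' σ σ' : ℝ → ℝ} {χ : ℝ} (hχ : 0 ≤ χ)
    (hk : EqOn k k' (Ioc 0 χ)) (hσ : EqOn σ σ' (Ioc 0 χ)) :
    linearSolution k σ χ = linearSolution k' σ' χ := by
  have key : ∀ x ∈ Icc 0 χ, ∫ y in (0 : ℝ)..x, k y = ∫ y in (0 : ℝ)..x, k' y := fun x hx =>
    integral_congr_ae (Eventually.of_forall fun y hy => by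
      rw [uIoc_of_le hx.1] at hy
      exact hk ⟨hy.1, hy.2.trans hx.2⟩)
  rw [linearSolution, linearSolution, key χ ⟨hχ, le_rfl⟩]
  congr 1
  refine integral_congr_ae (Eventually.of_forall fun y hy => ?_)
  rw [uIoc_of_le hχ] at hy
  rw [key y ⟨hy.1.le, hy.2⟩, hσ hy]

/-! ### The mass as the solution of a linear equation. -/

namespace StarData

/-- The coefficient `w / (w² - (∂r/∂φ)²)` of the mass equation, where `w = 4π r² ∂r/∂χ`. -/
noncomputable def massCoeff (d : StarData) (χ : ℝ) : ℝ :=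
  d.volDensity χ * (d.volDensity χ * d.volDensity χ - d.rφ χ * d.rφ χ)⁻¹

namespace IsConfiguration

variable {d : StarData} {B : ℝ}

theorem inv_r_eq (h : d.IsConfiguration B) {χ : ℝ} (hχ : χ ∈ Ioc 0 B) :
    invRadius (d.vol χ) = (d.r χ)⁻¹ := invRadius_vol (h.r_pos χ hχ)

theorem exists_le_volDensity (h : d.IsConfiguration B) (hB : 0 < B) :
    ∃ c, 0 < c ∧ ∀ χ ∈ Icc 0 B, c ≤ d.volDensity χ := by
  obtain ⟨x, hx, hmin⟩ := isCompact_Icc.exists_isMinOn (nonempty_Icc.2 hB.le)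
    (h.volDensity_continuousOn hB)
  exact ⟨_, h.volDensity_pos hx, fun χ hχ => hmin hχ⟩

theorem le_vol (h : d.IsConfiguration B) (hB : 0 < B) {c : ℝ}
    (hc : ∀ χ ∈ Icc 0 B, c ≤ d.volDensity χ) {χ : ℝ} (hχ : χ ∈ Icc 0 B) :
    c * χ ≤ d.vol χ := by
  rw [← h.integral_volDensity hB hχ]
  have : c * χ = ∫ _ in (0 : ℝ)..χ, c := by simp [mul_comm]
  rw [this]
  exact integral_mono_on hχ.1 (by simp)
    ((RegularOn.of_continuousOn hB.le (h.volDensity_continuousOn hB)).mono hχ).int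
    fun x hx => hc x ⟨hx.1, hx.2.trans hχ.2⟩

/-- Since w has a positive lower bound, the volume is at least cχ and 1/r is at most a multiple of
χ^{-1/3}. -/
theorem inv_r_regularOn (h : d.IsConfiguration B) (hB : 0 < B) :
    RegularOn B (fun χ => (d.r χ)⁻¹) := by
  obtain ⟨c, hc, hw⟩ := h.exists_le_volDensity hB
  refine RegularOn.of_bound hB.le
    ((intervalIntegrable_centralWeight 0 B).const_mul (4 * Real.pi / (3 * c) + 1))
    ((h.r_cont.mono Ioc_subset_Icc_self).inv₀ fun χ hχ => (h.r_pos χ hχ).ne') fun χ hχ => ?_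
  rw [abs_of_pos (inv_pos.2 (h.r_pos χ hχ)), ← h.inv_r_eq hχ]
  exact invRadius_le hc hχ.1 (h.le_vol hB hw ⟨hχ.1.le, hχ.2⟩)

theorem massCoeff_continuousOn (h : d.IsConfiguration B) (hB : 0 < B) :
    ContinuousOn d.massCoeff (Icc 0 B) :=
  (h.volDensity_continuousOn hB).mul (((h.volDensity_continuousOn hB).mul
    (h.volDensity_continuousOn hB)).sub (h.rφ_cont.mul h.rφ_cont) |>.inv₀ fun χ hχ => by
      have := h.sq_lt_volDensity_sq hχ
      simp only [Pi.sub_apply, ← sq]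
      exact (sub_pos.2 this).ne')

theorem massCoeff_mul_inv_r_regularOn (h : d.IsConfiguration B) (hB : 0 < B) :
    RegularOn B (fun χ => d.massCoeff χ * (d.r χ)⁻¹) :=
  (h.inv_r_regularOn hB).continuousOn_mul hB.le (h.massCoeff_continuousOn hB)

/-- The decisive linearity: in the hard phase ρ is affine in n², and n² is affine in m by
`volDensity_sq`. -/
theorem rho_mul_volDensity (h : d.IsConfiguration B) {χ : ℝ} (hχ : χ ∈ Icc 0 B) :
    d.rho χ * d.volDensity χ = (1 / 2) * (d.volDensity χ + d.massCoeff χ)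
      - d.massCoeff χ * (d.r χ)⁻¹ * d.mass χ := by
  have h1 := h.volDensity_sq hχ
  have h2 := h.sq_lt_volDensity_sq hχ
  have h3 : d.volDensity χ * d.volDensity χ - d.rφ χ * d.rφ χ ≠ 0 := by nlinarith
  have h4 : d.massCoeff χ * d.gradSq χ = d.n χ ^ 2 * d.volDensity χ := by
    rw [massCoeff, ← h1, ← sub_eq_zero]
    linear_combination (d.n χ ^ 2 * d.volDensity χ) * (inv_mul_cancel₀ h3)
  rw [rho]
  rw [gradSq] at h4
  linear_combination (-1 / 2 : ℝ) * h4

theorem mass_eq_linearSolution (h : d.IsConfiguration B) (hB : 0 < B) {χ : ℝ} (hχ : χ ∈ Icc 0 B) :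
    d.mass χ = linearSolution (fun x => d.massCoeff x * (d.r x)⁻¹)
      (fun x => (1 / 2) * (d.volDensity x + d.massCoeff x)) χ := by
  refine eq_linearSolution hB.le (h.massCoeff_mul_inv_r_regularOn hB)
    (RegularOn.of_continuousOn hB.le (continuousOn_const.mul
      ((h.volDensity_continuousOn hB).add (h.massCoeff_continuousOn hB))))
    (h.mass_continuousOn hB) (mass_zero d) (fun x hx => ?_) hχ
  change HasDerivAt d.mass ((1 / 2) * (d.volDensity x + d.massCoeff x)
    - d.massCoeff x * (d.r x)⁻¹ * d.mass x) x
  rw [← h.rho_mul_volDensity ⟨hx.1.le, hx.2.le⟩]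
  exact (h.hasDerivWithinAt_mass hB ⟨hx.1, hx.2.le⟩).hasDerivAt (Icc_mem_nhds hx.1 hx.2)

end IsConfiguration

end StarData

/-! ### Variations, and the raw formula for the second variation. -/

/-- The parameter interval on which a variation is uniformly controlled. -/
abbrev halfInterval : Set ℝ := Ioo (-(1 / 2)) (1 / 2)

theorem halfInterval_subset : Icc (-(1 / 2) : ℝ) (1 / 2) ⊆ Ioo (-1) 1 := fun _ h =>
  ⟨by linarith [h.1], by linarith [h.2]⟩

theorem zero_mem_halfInterval : (0 : ℝ) ∈ halfInterval := ⟨by norm_num, by norm_num⟩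

/-- A `C²` family, with each member continuously extended to the centre, is jointly continuous and
has two uniformly bounded derivatives in the parameter. -/
theorem IsC2Family.exists_boundedFamily {B : ℝ} (hB : 0 < B) {g G : ℝ → ℝ → ℝ}
    (hg : IsC2Family B g) (hG : ∀ l ∈ Ioo (-1 : ℝ) 1, ContinuousOn (G l) (Icc 0 B))
    (hgG : ∀ l ∈ Ioo (-1 : ℝ) 1, ∀ χ ∈ Ioc 0 B, g l χ = G l χ) :
    ∃ g₁ g₂ : ℝ → ℝ → ℝ,
      ContinuousOn (fun q : ℝ × ℝ => G q.1 q.2) (Ioo (-1) 1 ×ˢ Icc 0 B) ∧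
      BoundedFamily halfInterval B (fun _ => 1) G g₁ ∧
      BoundedFamily halfInterval B (fun _ => 1) g₁ g₂ := by
  obtain ⟨g₀, g₁, g₂, c0, c1, c2, hd⟩ := hg
  have slice : ∀ {f : ℝ → ℝ → ℝ},
      ContinuousOn (fun q : ℝ × ℝ => f q.1 q.2) (Ioo (-1) 1 ×ˢ Icc 0 B) →
      ∀ l ∈ Ioo (-1 : ℝ) 1, ContinuousOn (f l) (Icc 0 B) := fun hf l hl =>
    hf.comp (f := fun χ => (l, χ)) (by fun_prop) fun χ hχ => ⟨hl, hχ⟩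
  have hGg : ∀ l ∈ Ioo (-1 : ℝ) 1, EqOn (G l) (g₀ l) (Icc 0 B) := by
    intro l hl
    have : EqOn (G l) (g₀ l) (Ioc 0 B) := fun χ hχ =>
      (hgG l hl χ hχ).symm.trans (hd l hl χ hχ).1
    exact this.of_subset_closure (hG l hl) (slice c0 l hl) Ioc_subset_Icc_self
      (by rw [closure_Ioc hB.ne])
  have cG : ContinuousOn (fun q : ℝ × ℝ => G q.1 q.2) (Ioo (-1) 1 ×ˢ Icc 0 B) :=
    c0.congr fun q hq => hGg q.1 hq.1 hq.2
  have hJ : ∀ {l}, l ∈ halfInterval → l ∈ Ioo (-1 : ℝ) 1 := fun h =>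
    halfInterval_subset (Ioo_subset_Icc_self h)
  have bd : ∀ {f : ℝ → ℝ → ℝ},
      ContinuousOn (fun q : ℝ × ℝ => f q.1 q.2) (Ioo (-1) 1 ×ˢ Icc 0 B) →
      ∃ C, ∀ l ∈ halfInterval, ∀ χ ∈ Ioc 0 B, |f l χ| ≤ C := fun hf => by
    obtain ⟨C, hC⟩ := (isCompact_Icc.prod isCompact_Icc).exists_bound_of_continuousOn
      (hf.mono (prod_mono halfInterval_subset (Subset.refl (Icc 0 B))))
    exact ⟨C, fun l hl χ hχ => hC (l, χ) ⟨Ioo_subset_Icc_self hl, Ioc_subset_Icc_self hχ⟩⟩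
  have mk : ∀ {f f₁ : ℝ → ℝ → ℝ},
      ContinuousOn (fun q : ℝ × ℝ => f q.1 q.2) (Ioo (-1) 1 ×ˢ Icc 0 B) →
      ContinuousOn (fun q : ℝ × ℝ => f₁ q.1 q.2) (Ioo (-1) 1 ×ˢ Icc 0 B) →
      (∀ l ∈ halfInterval, ∀ χ ∈ Ioc 0 B, HasDerivAt (fun t => f t χ) (f₁ l χ) l) →
      BoundedFamily halfInterval B (fun _ => 1) f f₁ := by
    intro f f₁ hf hf₁ hder
    obtain ⟨C, hC⟩ := bd hf
    obtain ⟨C', hC'⟩ := bd hf₁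
    refine ⟨isOpen_Ioo, fun l hl => (slice hf l (hJ hl)).mono Ioc_subset_Icc_self,
      fun l hl => (slice hf₁ l (hJ hl)).mono Ioc_subset_Icc_self,
      ⟨|C| + |C'|, by positivity, fun l hl χ hχ => ?_⟩, hder⟩
    have h1 := hC l hl χ hχ
    have h2 := hC' l hl χ hχ
    exact ⟨by linarith [le_abs_self C, abs_nonneg C'], by linarith [le_abs_self C', abs_nonneg C]⟩
  refine ⟨g₁, g₂, cG, mk cG c1 fun l hl χ hχ => ?_, mk c1 c2 fun l hl χ hχ => ?_⟩
  · refine (hd l (hJ hl) χ hχ).2.1.congr_of_eventuallyEq ?_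
    filter_upwards [isOpen_Ioo.mem_nhds (hJ hl)] with t ht using (hgG t ht χ hχ).symm
  · exact (hd l (hJ hl) χ hχ).2.2

/-- The derivatives along a variation of `w = 4π r² ∂r/∂χ` and of `∂r/∂φ`, with bounds. -/
structure VariationDerivatives (B : ℝ) (D : ℝ → StarData) (w₁ w₂ v₁ v₂ : ℝ → ℝ → ℝ) : Prop where
  w_deriv : BoundedFamily halfInterval B (fun _ => 1) (fun l => (D l).volDensity) w₁
  w₁_deriv : BoundedFamily halfInterval B (fun _ => 1) w₁ w₂
  v_deriv : BoundedFamily halfInterval B (fun _ => 1) (fun l => (D l).rφ) v₁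
  v₁_deriv : BoundedFamily halfInterval B (fun _ => 1) v₁ v₂
  lower : ∃ c, 0 < c ∧ ∀ l ∈ halfInterval, ∀ χ ∈ Icc 0 B, c ≤ (D l).volDensity χ ∧
    c ≤ (D l).volDensity χ * (D l).volDensity χ - (D l).rφ χ * (D l).rφ χ
  config : ∀ l ∈ halfInterval, (D l).IsConfiguration B

/-- On |l| ≤ 1/2 compactness supplies uniform bounds, in particular positive lower bounds for w and
w² - v², by which the mass equation divides. -/
theorem IsVariation.exists_derivatives {d : StarData} {B : ℝ} {D : ℝ → StarData} (hB : 0 < B)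
    (h : IsVariation d B D) : ∃ w₁ w₂ v₁ v₂, VariationDerivatives B D w₁ w₂ v₁ v₂ := by
  obtain ⟨w₁, w₂, cw, hw, hw'⟩ := h.r_C2.exists_boundedFamily hB (G := fun l => (D l).volDensity)
    (fun l hl => (h.config l hl).volDensity_continuousOn hB)
    (fun l hl χ hχ => (h.config l hl).density_eq hB hχ)
  obtain ⟨v₁, v₂, cv, hv, hv'⟩ := h.rφ_C2.exists_boundedFamily hB (G := fun l => (D l).rφ)
    (fun l hl => (h.config l hl).rφ_cont) (fun _ _ _ _ => rfl)
  have hJ : ∀ {l}, l ∈ halfInterval → l ∈ Ioo (-1 : ℝ) 1 := fun h =>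
    halfInterval_subset (Ioo_subset_Icc_self h)
  have low : ∀ {f : ℝ → ℝ → ℝ},
      ContinuousOn (fun q : ℝ × ℝ => f q.1 q.2) (Ioo (-1) 1 ×ˢ Icc 0 B) →
      (∀ l ∈ Ioo (-1 : ℝ) 1, ∀ χ ∈ Icc 0 B, 0 < f l χ) →
      ∃ c, 0 < c ∧ ∀ l ∈ halfInterval, ∀ χ ∈ Icc 0 B, c ≤ f l χ := by
    intro f hf hpos
    obtain ⟨x, hx, hmin⟩ := (isCompact_Icc.prod isCompact_Icc).exists_isMinOn
      (s := Icc (-(1 / 2) : ℝ) (1 / 2) ×ˢ Icc 0 B)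
      ⟨(0, 0), ⟨by norm_num, by norm_num⟩, ⟨le_rfl, hB.le⟩⟩
      (hf.mono (prod_mono halfInterval_subset (Subset.refl (Icc 0 B))))
    exact ⟨_, hpos x.1 (halfInterval_subset hx.1) x.2 hx.2,
      fun l hl χ hχ => hmin (a := (l, χ)) ⟨Ioo_subset_Icc_self hl, hχ⟩⟩
  obtain ⟨c, hc, hcw⟩ := low cw fun l hl χ hχ => (h.config l hl).volDensity_pos hχ
  obtain ⟨c', hc', hcw'⟩ := low (f := fun l χ => (D l).volDensity χ * (D l).volDensity χ
      - (D l).rφ χ * (D l).rφ χ) ((cw.mul cw).sub (cv.mul cv)) fun l hl χ hχ => by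
    have := (h.config l hl).sq_lt_volDensity_sq hχ
    nlinarith
  exact ⟨w₁, w₂, v₁, v₂, hw, hw', hv, hv', ⟨min c c', lt_min hc hc', fun l hl χ hχ =>
    ⟨(min_le_left _ _).trans (hcw l hl χ hχ), (min_le_right _ _).trans (hcw' l hl χ hχ)⟩⟩,
    fun l hl => h.config l (hJ hl)⟩

namespace VariationDerivatives

variable {B : ℝ} {D : ℝ → StarData} {w₁ w₂ v₁ v₂ : ℝ → ℝ → ℝ}

theorem vol_deriv (h : VariationDerivatives B D w₁ w₂ v₁ v₂) (hB : 0 < B) :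
    BoundedFamily halfInterval B (fun χ => χ) (fun l => (D l).vol)
      (fun l χ => ∫ x in (0 : ℝ)..χ, w₁ l x) :=
  (BoundedFamily.integral_id hB.le h.w_deriv).congr
    (fun l hl _ hχ => ((h.config l hl).integral_volDensity hB ⟨hχ.1.le, hχ.2⟩).symm)
    (fun _ _ _ _ => rfl)

/-- The second variation formula at a static configuration, before the use of the
Euler-Lagrange equation. -/
theorem hasSecondVariation (h : VariationDerivatives B D w₁ w₂ v₁ v₂) (hB : 0 < B)
    (hstat : ∀ χ ∈ Icc 0 B, (D 0).rφ χ = 0) {w q m m₁ V₁ V₂ p k : ℝ → ℝ}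
    (hw : w = (D 0).volDensity) (hq : q = fun χ => ((D 0).r χ)⁻¹) (hm : m = (D 0).mass)
    (hp : p = (D 0).pressure)
    (hV₁ : V₁ = fun χ => ∫ x in (0 : ℝ)..χ, w₁ 0 x)
    (hV₂ : V₂ = fun χ => ∫ x in (0 : ℝ)..χ, w₂ 0 x)
    (hk : k = fun χ => q χ / w χ)
    (hm₁ : m₁ = linearSolution k
      (fun χ => -p χ * w₁ 0 χ + m χ * q χ ^ 4 / (4 * Real.pi * w χ) * V₁ χ)) :
    HasDerivAt (fun l => (D l).mass B) (m₁ B) 0 ∧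
    HasSecondVariation (fun l => (D l).mass B)
      (linearSolution k (fun χ =>
        (-p χ * w₂ 0 χ + m χ * q χ ^ 4 / (4 * Real.pi * w χ) * V₂ χ)
        + ((1 - 2 * m χ * q χ) / w χ ^ 3 * (w₁ 0 χ ^ 2 + v₁ 0 χ ^ 2)
        - m χ * q χ ^ 7 / (4 * Real.pi ^ 2 * w χ) * V₁ χ ^ 2
        - m χ * q χ ^ 4 / (2 * Real.pi * w χ ^ 2) * V₁ χ * w₁ 0 χ
        + m₁ χ * q χ ^ 4 / (2 * Real.pi * w χ) * V₁ χ
        + 2 * m₁ χ * q χ * w₁ 0 χ / w χ ^ 2)) B) := by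
  obtain ⟨c, hc, hlow⟩ := h.lower
  have h0 := zero_mem_halfInterval
  have hV' : BoundedFamily halfInterval B (fun χ => χ) (fun l χ => ∫ x in (0 : ℝ)..χ, w₁ l x)
      (fun l χ => ∫ x in (0 : ℝ)..χ, w₂ l x) :=
    BoundedFamily.integral_id hB.le h.w₁_deriv
  have hVlow : ∀ l ∈ halfInterval, ∀ χ ∈ Ioc 0 B, c * χ ≤ (D l).vol χ := fun l hl χ hχ =>
    (h.config l hl).le_vol hB (fun x hx => (hlow l hl x hx).1) ⟨hχ.1.le, hχ.2⟩
  have hq1 := (h.vol_deriv hB).invRadius hc hVlow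
  have hq2 := (h.vol_deriv hB).invRadius_deriv hV' hc hVlow
  have hD := (h.w_deriv.mul_one_env h.w_deriv).sub (h.v_deriv.mul_one_env h.v_deriv)
  have hD' := ((h.w₁_deriv.mul_one_env h.w_deriv).add (h.w_deriv.mul_one_env h.w₁_deriv)).sub
    ((h.v₁_deriv.mul_one_env h.v_deriv).add (h.v_deriv.mul_one_env h.v₁_deriv))
  have hI := hD.inv hc fun l hl χ hχ => (hlow l hl χ ⟨hχ.1.le, hχ.2⟩).2
  have hI' := ((hI.mul_one_env hI).mul_one_env hD').const_mul (-1)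
  -- Restates the family in exactly the form of the derivative in `hI`, so that the two can be
  -- chained.
  have hI' := hI'.congr (h := fun l χ => _) (h₁ := fun l χ => _)
    (fun l hl χ hχ => (neg_one_mul _).symm) (fun l hl χ hχ => rfl)
  have hτ := h.w_deriv.mul_one_env hI
  have hτ' := (h.w₁_deriv.mul_one_env hI).add (h.w_deriv.mul_one_env hI')
  have hk1 := hτ.mul_one_env hq1
  have hk2 := (hτ'.mul_one_env hq1).add (hτ.mul_one_env hq2)
  obtain ⟨cB, hcB, hcB1⟩ := one_le_mul_centralWeight B
  have up : ∀ {g g₁}, BoundedFamily halfInterval B (fun _ => 1) g g₁ →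
      BoundedFamily halfInterval B centralWeight g g₁ := fun hg => hg.mono hcB hcB1
  have hS1 := up ((h.w_deriv.add hτ).const_mul (1 / 2))
  have hS2 := up ((h.w₁_deriv.add hτ').const_mul (1 / 2))
  obtain ⟨m', m₁', hm', hm₁', key⟩ := hasSecondVariation_linearSolution h0 hB (intervalIntegrable_centralWeight 0 B)
    ⟨cB, hcB, hcB1⟩ hk1 hk2 hS1 hS2
  have hcfg := h.config 0 h0
  have hM : (fun l => (D l).mass B) =ᶠ[𝓝 0] fun l => linearSolution
      (fun χ => (D l).volDensity χ * ((D l).volDensity χ * (D l).volDensity χ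
        - (D l).rφ χ * (D l).rφ χ)⁻¹ * invRadius ((D l).vol χ))
      (fun χ => (1 / 2) * ((D l).volDensity χ + (D l).volDensity χ *
        ((D l).volDensity χ * (D l).volDensity χ - (D l).rφ χ * (D l).rφ χ)⁻¹)) B := by
    filter_upwards [isOpen_Ioo.mem_nhds h0] with l hl
    rw [(h.config l hl).mass_eq_linearSolution hB ⟨hB.le, le_rfl⟩]
    refine linearSolution_congr hB.le (fun χ hχ => ?_) fun χ hχ => rfl
    rw [(h.config l hl).inv_r_eq hχ, StarData.massCoeff]
  -- At l = 0 the velocity vanishes, so τ = 1/w and n² = (1 - 2mq)/w². The last identity makes the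
  -- terms in w₁ collect into -p w₁.
  have hpt : ∀ χ ∈ Ioc 0 B, 0 < w χ ∧ (D 0).rφ χ = 0 ∧ (D 0).volDensity χ = w χ ∧
      invRadius ((D 0).vol χ) = q χ ∧ p χ = ((1 - 2 * m χ * q χ) / w χ ^ 2 - 1) / 2 := by
    intro χ hχ
    have hχ' : χ ∈ Icc 0 B := ⟨hχ.1.le, hχ.2⟩
    have hw0 : 0 < w χ := by rw [hw]; exact hcfg.volDensity_pos hχ'
    have hn := hcfg.volDensity_sq hχ'
    refine ⟨hw0, hstat χ hχ', by rw [hw], by rw [hq, hcfg.inv_r_eq hχ], ?_⟩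
    rw [hstat χ hχ', ← hw] at hn
    have : 1 - 2 * m χ * q χ = (D 0).n χ ^ 2 * w χ ^ 2 := by
      rw [StarData.gradSq, div_eq_mul_inv] at hn
      rw [hm, hq]; linarith
    rw [this, mul_div_cancel_right₀ _ (pow_pos hw0 2).ne', hp, StarData.pressure, StarData.rho]
    ring
  have hmχ : ∀ χ ∈ Icc 0 B, m' χ = m χ := by
    intro χ hχ
    rw [hm', hm, hcfg.mass_eq_linearSolution hB hχ]
    refine linearSolution_congr hχ.1 (fun x hx => ?_) fun x hx => rfl
    rw [hcfg.inv_r_eq ⟨hx.1, hx.2.trans hχ.2⟩, StarData.massCoeff]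
  have hkχ : EqOn (fun χ => (D 0).volDensity χ * ((D 0).volDensity χ * (D 0).volDensity χ
        - (D 0).rφ χ * (D 0).rφ χ)⁻¹ * invRadius ((D 0).vol χ)) k (Ioc 0 B) := by
    intro χ hχ
    obtain ⟨h1, h2, h3, h4, -⟩ := hpt χ hχ
    simp only [h2, h3, h4, hk]
    field_simp
    simp
  have hm₁χ : ∀ χ ∈ Icc 0 B, m₁' χ = m₁ χ := fun χ hχ => by
    rw [hm₁', hm₁]
    refine linearSolution_congr hχ.1 (hkχ.mono (Ioc_subset_Ioc_right hχ.2)) fun x hx => ?_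
    have hx' : x ∈ Ioc 0 B := ⟨hx.1, hx.2.trans hχ.2⟩
    obtain ⟨h1, h2, h3, h4, h5⟩ := hpt x hx'
    simp only [hmχ x ⟨hx'.1.le, hx'.2⟩, h2, h3, h4, h5, hV₁]
    field_simp
    ring
  constructor
  · refine (key.1.congr_of_eventuallyEq hM).congr_deriv ?_
    exact hm₁χ B ⟨hB.le, le_rfl⟩
  · obtain ⟨M', e1, e2⟩ := key.2
    refine ⟨M', ?_, e2.congr_deriv ?_⟩
    · filter_upwards [e1, hM.eventually_nhds] with l hl hl'
      exact hl.congr_of_eventuallyEq hl'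
    · refine linearSolution_congr hB.le hkχ fun x hx => ?_
      obtain ⟨h1, h2, h3, h4, h5⟩ := hpt x hx
      simp only [hmχ x ⟨hx.1.le, hx.2⟩, hm₁χ x ⟨hx.1.le, hx.2⟩, h2, h3, h4, h5, hV₁, hV₂]
      field_simp
      ring

end VariationDerivatives

/-! ### Bounds for linear equations, and the construction of static trial states. -/

section LinearSolutionBounds

variable {B : ℝ} {k σ g : ℝ → ℝ}

theorem primitive_mono (hk : RegularOn B k) (hk0 : ∀ χ ∈ Ioc 0 B, 0 ≤ k χ) {x y : ℝ}
    (hx : 0 ≤ x) (hxy : x ≤ y) (hy : y ≤ B) :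
    ∫ z in (0 : ℝ)..x, k z ≤ ∫ z in (0 : ℝ)..y, k z := by
  refine integral_mono_interval le_rfl hx hxy ?_ (hk.mono ⟨hx.trans hxy, hy⟩).int
  filter_upwards [ae_restrict_mem measurableSet_Ioc] with z hz using hk0 z ⟨hz.1, hz.2.trans hy⟩

/-- A non-negative coefficient only damps: the factor exp(-∫k) from the source point onwards is at
most 1. -/
theorem abs_linearSolution_le (hB : 0 ≤ B) (hk : RegularOn B k) (hk0 : ∀ χ ∈ Ioc 0 B, 0 ≤ k χ)
    (hg : IntervalIntegrable g volume 0 B) (hσg : ∀ χ ∈ Ioc 0 B, |σ χ| ≤ g χ) {χ : ℝ}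
    (hχ : χ ∈ Icc 0 B) : |linearSolution k σ χ| ≤ ∫ x in (0 : ℝ)..χ, g x := by
  have hgχ : IntervalIntegrable g volume 0 χ := hg.mono_set (by
    rw [uIcc_of_le hχ.1, uIcc_of_le hB]; exact Icc_subset_Icc_right hχ.2)
  have h1 : |∫ x in (0 : ℝ)..χ, Real.exp (∫ y in (0 : ℝ)..x, k y) * σ x|
      ≤ ∫ x in (0 : ℝ)..χ, Real.exp (∫ y in (0 : ℝ)..χ, k y) * g x := by
    refine intervalIntegral.norm_integral_le_of_norm_le
      (f := fun x => Real.exp (∫ y in (0 : ℝ)..x, k y) * σ x) hχ.1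
      (Eventually.of_forall fun x hx => ?_) (hgχ.const_mul _)
    rw [Real.norm_eq_abs, abs_mul, abs_of_pos (Real.exp_pos _)]
    exact mul_le_mul (Real.exp_le_exp.2 (primitive_mono hk hk0 hx.1.le hx.2 hχ.2))
      (hσg x ⟨hx.1, hx.2.trans hχ.2⟩) (abs_nonneg _) (Real.exp_pos _).le
  rw [intervalIntegral.integral_const_mul] at h1
  rw [linearSolution, abs_mul, abs_of_pos (Real.exp_pos _)]
  calc _ ≤ Real.exp (-∫ x in (0 : ℝ)..χ, k x) * (Real.exp (∫ y in (0 : ℝ)..χ, k y) *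
        ∫ x in (0 : ℝ)..χ, g x) := mul_le_mul_of_nonneg_left h1 (Real.exp_pos _).le
    _ = _ := by rw [← mul_assoc, ← Real.exp_add]; simp

theorem linearSolution_pos (hB : 0 ≤ B) (hk : RegularOn B k) (hσ : RegularOn B σ)
    (hσ0 : ∀ χ ∈ Ioc 0 B, 0 < σ χ) {χ : ℝ} (hχ : χ ∈ Ioc 0 B) : 0 < linearSolution k σ χ := by
  refine mul_pos (Real.exp_pos _) (intervalIntegral_pos_of_pos_on
    ((hk.exp_primitive_mul hB hσ).mono ⟨hχ.1.le, hχ.2⟩).int (fun x hx => ?_) hχ.1)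
  exact mul_pos (Real.exp_pos _) (hσ0 x ⟨hx.1, hx.2.le.trans hχ.2⟩)

end LinearSolutionBounds

/-- A static configuration with prescribed `4π r² ∂r/∂χ`. If `4π R² < 1` for the radius `R` of the
boundary, then there are no trapped shells. -/
theorem exists_static_configuration {B R : ℝ} {W : ℝ → ℝ} (hB : 0 < B)
    (hWc : ContinuousOn W (Icc 0 B)) (hW : ∀ χ ∈ Icc 0 B, 0 < W χ) (hR : 0 ≤ R)
    (hV : ∫ x in (0 : ℝ)..B, W x ≤ 4 * Real.pi / 3 * R ^ 3) (hR1 : 4 * Real.pi * R ^ 2 < 1) :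
    ∃ d : StarData, d.IsConfiguration B ∧ (∀ χ, d.rφ χ = 0) ∧
      ∀ χ ∈ Ioc 0 B, 4 * Real.pi * d.r χ ^ 2 * d.rχ χ = W χ := by
  have hπ := Real.pi_pos
  have hWr := RegularOn.of_continuousOn hB.le hWc
  obtain ⟨x₀, hx₀, hmin⟩ := isCompact_Icc.exists_isMinOn (nonempty_Icc.2 hB.le) hWc
  set c := W x₀ with hc_def
  have hc : 0 < c := hW x₀ hx₀
  have hcW : ∀ χ ∈ Icc 0 B, c ≤ W χ := fun χ hχ => hmin hχ
  set V : ℝ → ℝ := fun χ => ∫ x in (0 : ℝ)..χ, W x with hV_def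
  have hVpos : ∀ χ ∈ Ioc 0 B, 0 < V χ := fun χ hχ =>
    intervalIntegral_pos_of_pos_on (hWr.mono ⟨hχ.1.le, hχ.2⟩).int
      (fun x hx => hW x ⟨hx.1.le, hx.2.le.trans hχ.2⟩) hχ.1
  have hVlow : ∀ χ ∈ Icc 0 B, c * χ ≤ V χ := fun χ hχ => by
    have : c * χ = ∫ _ in (0 : ℝ)..χ, c := by simp [mul_comm]
    rw [this]
    exact integral_mono_on hχ.1 (by simp) (hWr.mono hχ).int
      fun x hx => hcW x ⟨hx.1, hx.2.trans hχ.2⟩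
  have hV0 : V 0 = 0 := by simp [hV_def]
  have hVnn : ∀ χ ∈ Icc 0 B, 0 ≤ V χ := fun χ hχ => (mul_nonneg hc.le hχ.1).trans (hVlow χ hχ)
  have hVc : ContinuousOn V (Icc 0 B) := hWr.continuousOn_primitive hB.le
  have hVR : ∀ χ ∈ Icc 0 B, V χ ≤ 4 * Real.pi / 3 * R ^ 3 := fun χ hχ =>
    (primitive_mono hWr (fun x hx => (hW x ⟨hx.1.le, hx.2⟩).le) hχ.1 hχ.2 le_rfl).trans hV
  set r : ℝ → ℝ := fun χ => (3 / (4 * Real.pi) * V χ) ^ (1 / 3 : ℝ) with hr_def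
  have hr0 : r 0 = 0 := by simp [hr_def, hV0]
  have hrpos : ∀ χ ∈ Ioc 0 B, 0 < r χ := fun χ hχ =>
    Real.rpow_pos_of_pos (mul_pos (by positivity) (hVpos χ hχ)) _
  have hr3 : ∀ χ ∈ Icc 0 B, 4 * Real.pi / 3 * r χ ^ 3 = V χ := fun χ hχ => by
    have h0 : 0 ≤ 3 / (4 * Real.pi) * V χ := mul_nonneg (by positivity) (hVnn χ hχ)
    rw [hr_def]
    simp only
    rw [← Real.rpow_natCast, ← Real.rpow_mul h0]
    norm_num
    field_simp
  have hrc : ContinuousOn r (Icc 0 B) :=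
    (continuousOn_const.mul hVc).rpow_const fun χ hχ => Or.inr (by norm_num)
  have hrR : ∀ χ ∈ Ioc 0 B, 4 * Real.pi * r χ ^ 2 < 1 := fun χ hχ => by
    have h1 := hVR χ ⟨hχ.1.le, hχ.2⟩
    rw [← hr3 χ ⟨hχ.1.le, hχ.2⟩] at h1
    have h2 : r χ ≤ R := le_of_pow_le_pow_left₀ three_ne_zero hR
      (le_of_mul_le_mul_left h1 (by positivity))
    have h3 : r χ ^ 2 ≤ R ^ 2 := pow_le_pow_left₀ (hrpos χ hχ).le h2 2
    nlinarith
  have hrd : ∀ χ ∈ Ioc 0 B,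
      HasDerivWithinAt r (W χ / (4 * Real.pi * r χ ^ 2)) (Icc 0 B) χ := by
    intro χ hχ
    have h0 : 0 < 3 / (4 * Real.pi) * V χ := mul_pos (by positivity) (hVpos χ hχ)
    refine (((hWr.hasDerivWithinAt_primitive hχ).const_mul (3 / (4 * Real.pi))).rpow_const
      (p := (1 / 3 : ℝ)) (Or.inl h0.ne')).congr_deriv ?_
    have h1 : (3 / (4 * Real.pi) * V χ) ^ ((1 / 3 : ℝ) - 1) = (r χ ^ 2)⁻¹ := by
      rw [hr_def]
      simp only
      rw [← Real.rpow_natCast, ← Real.rpow_mul h0.le, ← Real.rpow_neg h0.le]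
      norm_num
    rw [h1]
    have := hrpos χ hχ
    field_simp
  have hrχc : ContinuousOn (fun χ => W χ / (4 * Real.pi * r χ ^ 2)) (Ioc 0 B) :=
    (hWc.mono Ioc_subset_Icc_self).div (continuousOn_const.mul
      ((hrc.mono Ioc_subset_Icc_self).pow 2)) fun χ hχ => by
        have := hrpos χ hχ
        positivity
  have hrχpos : ∀ χ ∈ Ioc 0 B, 0 < W χ / (4 * Real.pi * r χ ^ 2) := fun χ hχ => by
    have := hrpos χ hχ
    have := hW χ ⟨hχ.1.le, hχ.2⟩
    positivity
  have hrχr : RegularOn B (fun χ => W χ / (4 * Real.pi * r χ ^ 2)) := by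
    refine ⟨hrχc, ?_⟩
    rw [intervalIntegrable_iff_integrableOn_Ioc_of_le hB.le]
    exact integrableOn_deriv_of_nonneg hrc (fun x hx => (hrd x ⟨hx.1, hx.2.le⟩).hasDerivAt
      (Icc_mem_nhds hx.1 hx.2)) fun x hx => (hrχpos x ⟨hx.1, hx.2.le⟩).le
  have hWic : ContinuousOn (fun χ => (W χ)⁻¹) (Icc 0 B) := hWc.inv₀ fun χ hχ => (hW χ hχ).ne'
  have hq : RegularOn B (fun χ => (r χ)⁻¹) := by
    refine RegularOn.of_bound hB.le
      ((intervalIntegrable_centralWeight 0 B).const_mul (4 * Real.pi / (3 * c) + 1))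
      ((hrc.mono Ioc_subset_Icc_self).inv₀ fun χ hχ => (hrpos χ hχ).ne') fun χ hχ => ?_
    rw [abs_of_pos (inv_pos.2 (hrpos χ hχ)), ← invRadius_vol (hrpos χ hχ),
      hr3 χ ⟨hχ.1.le, hχ.2⟩]
    exact invRadius_le hc hχ.1 (hVlow χ ⟨hχ.1.le, hχ.2⟩)
  set k : ℝ → ℝ := fun χ => (W χ)⁻¹ * (r χ)⁻¹ with hk_def
  have hk : RegularOn B k := hq.continuousOn_mul hB.le hWic
  have hk0 : ∀ χ ∈ Ioc 0 B, 0 ≤ k χ := fun χ hχ => by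
    have := hrpos χ hχ
    have := hW χ ⟨hχ.1.le, hχ.2⟩
    simp only [hk_def]; positivity
  set S : ℝ → ℝ := fun χ => (1 / 2) * (W χ + (W χ)⁻¹) with hS_def
  have hS : RegularOn B S :=
    RegularOn.of_continuousOn hB.le (continuousOn_const.mul (hWc.add hWic))
  set m : ℝ → ℝ := linearSolution k S with hm_def
  have hm0 : m 0 = 0 := linearSolution_zero
  have hmc : ContinuousOn m (Icc 0 B) := continuousOn_linearSolution hB.le hk hS
  have hmd : ∀ χ ∈ Ioc 0 B, HasDerivWithinAt m ((1 / 2) * (W χ + (W χ)⁻¹)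
      - (W χ)⁻¹ * (r χ)⁻¹ * m χ) (Icc 0 B) χ :=
    fun χ hχ => hasDerivWithinAt_linearSolution hB.le hk hS hχ
  have hmpos : ∀ χ ∈ Ioc 0 B, 0 < m χ := fun χ hχ => linearSolution_pos hB.le hk hS
    (fun x hx => by have := hW x ⟨hx.1.le, hx.2⟩; simp only [hS_def]; positivity) hχ
  -- The difference r - 2m solves an equation with the same coefficient k and source ∂r/∂χ - W =
  -- W/(4πr²) - W, positive since 4πr² < 1. So no shell is trapped.
  have hb : ∀ χ ∈ Ioc 0 B, 0 < r χ - 2 * m χ := by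
    intro χ hχ
    have hσ : RegularOn B (fun χ => W χ / (4 * Real.pi * r χ ^ 2) - W χ) := hrχr.sub hWr
    have h1 := eq_linearSolution (m := fun χ => r χ - 2 * m χ) hB.le hk hσ
      (hrc.sub (continuousOn_const.mul hmc)) (by simp [hr0, hm0]) (fun x hx => ?_)
      (χ := χ) ⟨hχ.1.le, hχ.2⟩
    · rw [h1]
      refine linearSolution_pos hB.le hk hσ (fun x hx => ?_) hχ
      have h2 := hrR x hx
      have h3 := hrpos x hx
      have h4 := hW x ⟨hx.1.le, hx.2⟩
      rw [sub_pos, lt_div_iff₀ (by positivity)]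
      nlinarith
    · have hx' : x ∈ Ioc 0 B := ⟨hx.1, hx.2.le⟩
      have hn : Icc 0 B ∈ 𝓝 x := Icc_mem_nhds hx.1 hx.2
      refine (((hrd x hx').hasDerivAt hn).sub (((hmd x hx').hasDerivAt hn).const_mul 2)).congr_deriv
        ?_
      have h3 := hrpos x hx'
      have h4 := hW x ⟨hx'.1.le, hx'.2⟩
      simp only [hk_def]
      field_simp
      ring
  set a : ℝ → ℝ := fun χ => 1 - 2 * m χ / r χ with ha_def
  have ha0 : a 0 = 1 := by simp [ha_def, hr0]
  have hapos : ∀ χ ∈ Icc 0 B, 0 < a χ := by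
    intro χ hχ
    rcases hχ.1.eq_or_lt with h0 | h0
    · rw [← h0, ha0]; exact one_pos
    · have h1 := hrpos χ ⟨h0, hχ.2⟩
      have h2 := hb χ ⟨h0, hχ.2⟩
      simp only [ha_def]
      rw [sub_pos, div_lt_one h1]; linarith
  have hale : ∀ χ ∈ Icc 0 B, a χ ≤ 1 := by
    intro χ hχ
    rcases hχ.1.eq_or_lt with h0 | h0
    · rw [← h0, ha0]
    · have h1 := hrpos χ ⟨h0, hχ.2⟩
      have h2 := hmpos χ ⟨h0, hχ.2⟩
      have : 0 ≤ 2 * m χ / r χ := by positivity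
      simp only [ha_def]; linarith
  have hmle : ∀ χ ∈ Icc 0 B, m χ ≤ (1 + (c ^ 2)⁻¹) * V χ := by
    intro χ hχ
    rw [hV_def]
    simp only
    rw [← intervalIntegral.integral_const_mul]
    refine (le_abs_self _).trans (abs_linearSolution_le hB.le hk hk0 (hWr.const_mul _).int
      (fun x hx => ?_) hχ)
    have h1 := hcW x ⟨hx.1.le, hx.2⟩
    have h2 := hW x ⟨hx.1.le, hx.2⟩
    have h3 : (W x)⁻¹ ≤ (c ^ 2)⁻¹ * W x := by
      rw [← div_eq_inv_mul, le_div_iff₀ (by positivity), inv_mul_le_iff₀ h2]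
      nlinarith
    have h4 : 0 < (W x)⁻¹ := by positivity
    simp only [hS_def]
    rw [abs_of_pos (by positivity)]
    linarith
  have hac : ContinuousOn a (Icc 0 B) := by
    intro χ hχ
    rcases hχ.1.eq_or_lt with h0 | h0
    · subst h0
      have hr' : Tendsto r (𝓝[Icc 0 B] 0) (𝓝 0) := by
        have := hrc 0 hχ
        rwa [ContinuousWithinAt, hr0] at this
      have h1 : Tendsto (fun χ => 1 - 8 * Real.pi / 3 * (1 + (c ^ 2)⁻¹) * r χ ^ 2)
          (𝓝[Icc 0 B] 0) (𝓝 1) := by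
        have := (hr'.pow 2).const_mul (8 * Real.pi / 3 * (1 + (c ^ 2)⁻¹))
        simpa using this.const_sub 1
      rw [ContinuousWithinAt, ha0]
      refine tendsto_of_tendsto_of_tendsto_of_le_of_le' h1 tendsto_const_nhds ?_ ?_
      · filter_upwards [self_mem_nhdsWithin] with x hx
        rcases hx.1.eq_or_lt with hx0 | hx0
        · rw [← hx0, ha0, hr0]; simp
        · have h2 := hmle x hx
          have h3 := hrpos x ⟨hx0, hx.2⟩
          rw [← hr3 x hx] at h2
          simp only [ha_def]
          rw [sub_le_sub_iff_left, div_le_iff₀ h3]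
          linarith
      · filter_upwards [self_mem_nhdsWithin] with x hx using hale x hx
    · exact continuousWithinAt_const.sub ((continuousWithinAt_const.mul
        (hmc χ hχ)).div (hrc χ hχ) (hrpos χ ⟨h0, hχ.2⟩).ne')
  -- Forced by the Hawking identity for vanishing velocity; the exponent ω below is forced by the
  -- particle count.
  set n : ℝ → ℝ := fun χ => √(a χ) * (W χ)⁻¹ with hn_def
  have hnc : ContinuousOn n (Icc 0 B) := hac.sqrt.mul hWic
  have hnpos : ∀ χ ∈ Icc 0 B, 0 < n χ := fun χ hχ =>
    mul_pos (Real.sqrt_pos.2 (hapos χ hχ)) (inv_pos.2 (hW χ hχ))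
  have hnsq : ∀ χ ∈ Icc 0 B, n χ ^ 2 * W χ ^ 2 = a χ := fun χ hχ => by
    have := hW χ hχ
    simp only [hn_def]
    rw [mul_pow, Real.sq_sqrt (hapos χ hχ).le]
    field_simp
  let d : StarData :=
    { r := r
      rχ := fun χ => W χ / (4 * Real.pi * r χ ^ 2)
      rφ := fun _ => 0
      ω := fun χ => -Real.log (4 * Real.pi * r χ ^ 2 * n χ)
      n := n }
  have hdens : ∀ χ ∈ Ioc 0 B, 4 * Real.pi * d.r χ ^ 2 * d.rχ χ = W χ := fun χ hχ => by
    have := hrpos χ hχ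
    change 4 * Real.pi * r χ ^ 2 * (W χ / (4 * Real.pi * r χ ^ 2)) = W χ
    field_simp
  have hexp : ∀ χ ∈ Ioc 0 B, Real.exp (d.ω χ) = (4 * Real.pi * r χ ^ 2 * n χ)⁻¹ := fun χ hχ => by
    have := hrpos χ hχ
    have := hnpos χ ⟨hχ.1.le, hχ.2⟩
    change Real.exp (-Real.log (4 * Real.pi * r χ ^ 2 * n χ)) = _
    rw [Real.exp_neg, Real.exp_log (by positivity)]
  -- Closes the circle: n was built from the solution m of the linear equation, and with this n the
  -- derivative of m is ρW.
  have hmass : ∀ χ ∈ Icc 0 B, d.mass χ = m χ := by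
    intro χ hχ
    have hreg : RegularOn B (fun x => (n x ^ 2 + 1) / 2 * W x) :=
      hWr.continuousOn_mul hB.le (((hnc.pow 2).add continuousOn_const).div_const 2)
    have h1 : d.mass χ = ∫ x in (0 : ℝ)..χ, (n x ^ 2 + 1) / 2 * W x := by
      refine integral_congr_ae (Eventually.of_forall fun x hx => ?_)
      rw [uIoc_of_le hχ.1] at hx
      rw [hdens x ⟨hx.1, hx.2.trans hχ.2⟩]
      rfl
    rw [h1, integral_eq_sub_of_hasDerivAt_of_le hχ.1 (hmc.mono (Icc_subset_Icc_right hχ.2))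
      (fun x hx => ?_) (hreg.mono hχ).int, hm0, sub_zero]
    have hx' : x ∈ Ioc 0 B := ⟨hx.1, hx.2.le.trans hχ.2⟩
    refine ((hmd x hx').hasDerivAt (Icc_mem_nhds hx.1 (hx.2.trans_le hχ.2))).congr_deriv ?_
    have h2 := hnsq x ⟨hx'.1.le, hx'.2⟩
    have h3 := hrpos x hx'
    have h4 := hW x ⟨hx'.1.le, hx'.2⟩
    have h5 : n x ^ 2 = a x / W x ^ 2 := by rw [← h2]; field_simp
    rw [h5]
    simp only [ha_def]
    field_simp
    ring
  refine ⟨d, ⟨hr0, hrpos, hrc, hrd, hrχc, hrχpos, rfl, continuousOn_const, ?_, hnc, hnpos, ?_, ?_,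
    ?_⟩, fun χ => rfl, hdens⟩
  · refine ContinuousOn.neg (ContinuousOn.log ((continuousOn_const.mul
      ((hrc.mono Ioc_subset_Icc_self).pow 2)).mul (hnc.mono Ioc_subset_Icc_self)) fun χ hχ => ?_)
    have := hrpos χ hχ
    have := hnpos χ ⟨hχ.1.le, hχ.2⟩
    exact (by positivity : 0 < 4 * Real.pi * r χ ^ 2 * n χ).ne'
  · intro χ hχ
    have h1 : d.particleNumber χ = ∫ _ in (0 : ℝ)..χ, (1 : ℝ) := by
      refine integral_congr_ae (Eventually.of_forall fun x hx => ?_)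
      rw [uIoc_of_le hχ.1] at hx
      have hx' : x ∈ Ioc 0 B := ⟨hx.1, hx.2.trans hχ.2⟩
      rw [hexp x hx']
      have := hrpos x hx'
      have := hnpos x ⟨hx'.1.le, hx'.2⟩
      change n x * (4 * Real.pi * r x ^ 2 * (4 * Real.pi * r x ^ 2 * n x)⁻¹) = 1
      field_simp
    rw [h1]; simp
  · intro χ hχ
    rw [hmass χ ⟨hχ.1.le, hχ.2⟩]
    exact sub_pos.1 (hb χ hχ)
  · intro χ hχ
    have hχ' : χ ∈ Icc 0 B := ⟨hχ.1.le, hχ.2⟩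
    have h1 : Real.exp (-2 * d.ω χ) = (4 * Real.pi * r χ ^ 2 * n χ) ^ 2 := by
      have : Real.exp (-2 * d.ω χ) = (Real.exp (d.ω χ) ^ 2)⁻¹ := by
        rw [← Real.exp_nat_mul, ← Real.exp_neg]; congr 1; push_cast; ring
      rw [this, hexp χ hχ, inv_pow, inv_inv]
    rw [hmass χ hχ', h1]
    have h2 := hnsq χ hχ'
    have h3 := hdens χ hχ
    change 1 - 2 * m χ / r χ = -(n χ) ^ 2 * 0 ^ 2 + _
    change a χ = _
    rw [← h2, ← h3]
    change n χ ^ 2 * (4 * Real.pi * r χ ^ 2 * d.rχ χ) ^ 2 = _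
    ring

/-! ### The adjoint state and the first variation. -/

theorem linearSolution_eq_integral (k σ : ℝ → ℝ) (B : ℝ) :
    linearSolution k σ B = ∫ x in (0 : ℝ)..B,
      Real.exp ((∫ y in (0 : ℝ)..x, k y) - ∫ y in (0 : ℝ)..B, k y) * σ x := by
  rw [linearSolution, ← intervalIntegral.integral_const_mul]
  congr 1
  ext x
  rw [← mul_assoc, ← Real.exp_add]
  congr 2
  ring

namespace StarData

/-- The decay rate `1 / (r w)` of mass perturbations of a static configuration. -/
noncomputable def rate (d : StarData) (χ : ℝ) : ℝ := (d.r χ)⁻¹ / d.volDensity χ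

/-- The adjoint state: the response of the total mass to a change of the mass at `χ`. -/
noncomputable def adjoint (d : StarData) (B χ : ℝ) : ℝ :=
  Real.exp ((∫ y in (0 : ℝ)..χ, d.rate y) - ∫ y in (0 : ℝ)..B, d.rate y)

/-- The derivative of the mass density in the direction of a change of the volume. -/
noncomputable def gravity (d : StarData) (χ : ℝ) : ℝ :=
  d.mass χ * (d.r χ)⁻¹ ^ 4 / (4 * Real.pi * d.volDensity χ)

/-- The first variation of the mass functional, as a density against the variation of `w`. -/
noncomputable def firstVariation (d : StarData) (B χ : ℝ) : ℝ :=
  ((∫ x in (0 : ℝ)..B, d.adjoint B x * d.gravity x) -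
    ∫ x in (0 : ℝ)..χ, d.adjoint B x * d.gravity x) - d.adjoint B χ * d.pressure χ

theorem adjoint_pos (d : StarData) (B χ : ℝ) : 0 < d.adjoint B χ := Real.exp_pos _

namespace IsConfiguration

variable {d : StarData} {B : ℝ}

theorem rate_regularOn (h : d.IsConfiguration B) (hB : 0 < B) : RegularOn B d.rate := by
  refine ((h.inv_r_regularOn hB).continuousOn_mul hB.le
    ((h.volDensity_continuousOn hB).inv₀ fun χ hχ => (h.volDensity_pos hχ).ne')).congr hB.le
    fun χ _ => ?_
  rw [rate, div_eq_mul_inv, mul_comm]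
  rfl

theorem rate_nonneg (h : d.IsConfiguration B) {χ : ℝ} (hχ : χ ∈ Ioc 0 B) : 0 ≤ d.rate χ := by
  have h1 := h.r_pos χ hχ
  have h2 := h.volDensity_pos ⟨hχ.1.le, hχ.2⟩
  rw [rate]; positivity

theorem adjoint_continuousOn (h : d.IsConfiguration B) (hB : 0 < B) :
    ContinuousOn (d.adjoint B) (Icc 0 B) :=
  (((h.rate_regularOn hB).continuousOn_primitive hB.le).sub continuousOn_const).rexp

theorem adjoint_le_one (h : d.IsConfiguration B) (hB : 0 < B) {χ : ℝ} (hχ : χ ∈ Icc 0 B) :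
    d.adjoint B χ ≤ 1 := by
  rw [adjoint, Real.exp_le_one_iff, sub_nonpos]
  exact primitive_mono (h.rate_regularOn hB) (fun x hx => h.rate_nonneg hx) hχ.1 hχ.2 le_rfl

theorem hasDerivAt_adjoint (h : d.IsConfiguration B) (hB : 0 < B) {χ : ℝ} (hχ : χ ∈ Ioo 0 B) :
    HasDerivAt (d.adjoint B) (d.adjoint B χ * d.rate χ) χ :=
  (((h.rate_regularOn hB).hasDerivAt_primitive hχ).sub_const _).exp

theorem pressure_continuousOn (h : d.IsConfiguration B) : ContinuousOn d.pressure (Icc 0 B) :=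
  h.rho_continuousOn.sub continuousOn_const

theorem inv_r_cube (h : d.IsConfiguration B) {χ : ℝ} (hχ : χ ∈ Ioc 0 B) :
    (d.r χ)⁻¹ ^ 3 * d.vol χ = 4 * Real.pi / 3 := by
  rw [← h.inv_r_eq hχ]; exact invRadius_cube (h.vol_pos hχ)

theorem gravity_nonneg (h : d.IsConfiguration B) (hB : 0 < B) {χ : ℝ} (hχ : χ ∈ Ioc 0 B) :
    0 ≤ d.gravity χ := by
  have hχ' : χ ∈ Icc 0 B := ⟨hχ.1.le, hχ.2⟩
  have h1 := h.r_pos χ hχ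
  have h2 := h.volDensity_pos hχ'
  have h3 := h.mass_nonneg hB hχ'
  rw [gravity]; positivity

/-- With ρ ≤ C the mass is at most C times the volume, so three powers of 1/r are absorbed and what
remains is at most (C/3) `rate`, which is integrable. -/
theorem gravity_regularOn (h : d.IsConfiguration B) (hB : 0 < B) : RegularOn B d.gravity := by
  obtain ⟨C, hC⟩ := isCompact_Icc.exists_bound_of_continuousOn h.rho_continuousOn
  have hw := h.volDensity_continuousOn hB
  have hr := h.r_cont.mono (Ioc_subset_Icc_self (a := 0) (b := B))
  refine RegularOn.of_bound hB.le ((h.rate_regularOn hB).const_mul (C / 3)).int ?_ fun χ hχ => ?_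
  · refine (((h.mass_continuousOn hB).mono Ioc_subset_Icc_self).mul
      ((hr.inv₀ fun χ hχ => (h.r_pos χ hχ).ne').pow 4)).div
      (continuousOn_const.mul (hw.mono Ioc_subset_Icc_self)) fun χ hχ => ?_
    have := h.volDensity_pos ⟨hχ.1.le, hχ.2⟩
    positivity
  · have hχ' : χ ∈ Icc 0 B := ⟨hχ.1.le, hχ.2⟩
    rw [abs_of_nonneg (h.gravity_nonneg hB hχ)]
    have h1 := h.r_pos χ hχ
    have h2 := h.volDensity_pos hχ'
    have h3 := h.mass_le hB hχ' fun x hx =>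
      (le_abs_self _).trans (hC x ⟨hx.1.le, hx.2.trans hχ.2⟩)
    have h4 := h.inv_r_cube hχ
    have h5 : d.mass χ * (d.r χ)⁻¹ ^ 4 ≤ C * (4 * Real.pi / 3) * (d.r χ)⁻¹ := by
      rw [← h4]
      have := mul_le_mul_of_nonneg_right h3 (by positivity : 0 ≤ (d.r χ)⁻¹ ^ 4)
      linarith
    rw [gravity, rate, div_le_iff₀ (by positivity)]
    have h6 : C / 3 * ((d.r χ)⁻¹ / d.volDensity χ) * (4 * Real.pi * d.volDensity χ)
        = C * (4 * Real.pi / 3) * (d.r χ)⁻¹ := by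
      field_simp
    rw [h6]; exact h5

theorem adjoint_mul_gravity_regularOn (h : d.IsConfiguration B) (hB : 0 < B) :
    RegularOn B (fun χ => d.adjoint B χ * d.gravity χ) :=
  (h.gravity_regularOn hB).continuousOn_mul hB.le (h.adjoint_continuousOn hB)

theorem firstVariation_continuousOn (h : d.IsConfiguration B) (hB : 0 < B) :
    ContinuousOn (d.firstVariation B) (Icc 0 B) :=
  (continuousOn_const.sub ((h.adjoint_mul_gravity_regularOn hB).continuousOn_primitive hB.le)).sub
    ((h.adjoint_continuousOn hB).mul h.pressure_continuousOn)

/-- Integration by parts in the first variation. -/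
theorem integral_firstVariation (h : d.IsConfiguration B) (hB : 0 < B) {f : ℝ → ℝ}
    (hf : RegularOn B f) :
    ∫ χ in (0 : ℝ)..B, d.adjoint B χ *
        (-d.pressure χ * f χ + d.gravity χ * ∫ x in (0 : ℝ)..χ, f x)
      = ∫ χ in (0 : ℝ)..B, d.firstVariation B χ * f χ := by
  have hG := h.adjoint_mul_gravity_regularOn hB
  have cG := hG.continuousOn_primitive hB.le
  have cf := hf.continuousOn_primitive hB.le
  have hparts := integral_mul_deriv_eq_deriv_mul_of_hasDerivAt (a := 0) (b := B)
    (u := fun x => ∫ y in (0 : ℝ)..x, f y) (u' := f)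
    (v := fun χ => (∫ x in (0 : ℝ)..χ, d.adjoint B x * d.gravity x)
      - ∫ x in (0 : ℝ)..B, d.adjoint B x * d.gravity x)
    (v' := fun x => d.adjoint B x * d.gravity x)
    (by rwa [uIcc_of_le hB.le])
    (by rw [uIcc_of_le hB.le]; exact cG.sub continuousOn_const)
    (fun x hx => by
      rw [min_eq_left hB.le, max_eq_right hB.le] at hx
      exact hf.hasDerivAt_primitive hx)
    (fun x hx => by
      rw [min_eq_left hB.le, max_eq_right hB.le] at hx
      exact (hG.hasDerivAt_primitive hx).sub_const _)
    hf.int hG.int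
  have r1 : RegularOn B (fun χ => (-d.adjoint B χ * d.pressure χ) * f χ) :=
    hf.continuousOn_mul hB.le ((h.adjoint_continuousOn hB).neg.mul h.pressure_continuousOn)
  have r2 := hG.continuousOn_mul hB.le cf
  have r3 : RegularOn B (fun χ => f χ * ((∫ x in (0 : ℝ)..χ, d.adjoint B x * d.gravity x)
      - ∫ x in (0 : ℝ)..B, d.adjoint B x * d.gravity x)) :=
    (hf.continuousOn_mul hB.le (cG.sub continuousOn_const)).congr hB.le fun x _ => mul_comm _ _
  have e1 : ∀ χ, d.adjoint B χ * (-d.pressure χ * f χ + d.gravity χ * ∫ x in (0 : ℝ)..χ, f x)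
      = (-d.adjoint B χ * d.pressure χ) * f χ
        + (∫ x in (0 : ℝ)..χ, f x) * (d.adjoint B χ * d.gravity χ) := fun χ => by ring
  have e2 : ∀ χ, d.firstVariation B χ * f χ = (-d.adjoint B χ * d.pressure χ) * f χ
      - f χ * ((∫ x in (0 : ℝ)..χ, d.adjoint B x * d.gravity x)
        - ∫ x in (0 : ℝ)..B, d.adjoint B x * d.gravity x) := fun χ => by
    rw [firstVariation]; ring
  simp only [e1, e2]
  rw [intervalIntegral.integral_add r1.int r2.int, intervalIntegral.integral_sub r1.int r3.int,
    hparts]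
  simp only [sub_self, mul_zero, intervalIntegral.integral_same, zero_mul]
  ring

end IsConfiguration

end StarData

/-! ### The Euler-Lagrange equation. -/

/-- The Euler-Lagrange equation of a critical point. -/
theorem IsCriticalPoint.firstVariation_eq_zero {d : StarData} {B : ℝ} (hB : 0 < B)
    (h : d.IsConfiguration B) (hstat : ∀ χ ∈ Icc 0 B, d.rφ χ = 0) (hcrit : IsCriticalPoint d B)
    (hR : 16 * Real.pi * d.r B ^ 2 < 1) {χ : ℝ} (hχ : χ ∈ Icc 0 B) :
    d.firstVariation B χ = 0 := by
  set f := d.firstVariation B with hf_def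
  set W := d.volDensity with hW_def
  have hf : ContinuousOn f (Icc 0 B) := h.firstVariation_continuousOn hB
  have hWc : ContinuousOn W (Icc 0 B) := h.volDensity_continuousOn hB
  obtain ⟨c, hc, hcW⟩ := h.exists_le_volDensity hB
  obtain ⟨C, hC⟩ := isCompact_Icc.exists_bound_of_continuousOn hf
  -- Chosen so that the perturbed density stays between W/2 and 3W/2 for all |l| < 1.
  set ε := c / (2 * (|C| + 1)) with hε_def
  have hε : 0 < ε := by positivity
  have hsmall : ∀ l ∈ Ioo (-1 : ℝ) 1, ∀ x ∈ Icc 0 B, |ε * l * f x| ≤ W x / 2 := by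
    intro l hl x hx
    have h1 : |l| ≤ 1 := abs_le.2 ⟨hl.1.le, hl.2.le⟩
    have h2 : |f x| ≤ |C| + 1 := by
      have := hC x hx
      rw [Real.norm_eq_abs] at this
      linarith [le_abs_self C]
    have h3 : |l| * |f x| ≤ 1 * (|C| + 1) := mul_le_mul h1 h2 (abs_nonneg _) zero_le_one
    rw [mul_assoc, abs_mul, abs_mul, abs_of_pos hε]
    calc ε * (|l| * |f x|) ≤ ε * (1 * (|C| + 1)) := mul_le_mul_of_nonneg_left h3 hε.le
      _ = c / 2 := by rw [hε_def]; field_simp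
      _ ≤ W x / 2 := by linarith [hcW x hx]
  have hex : ∀ l : ℝ, ∃ d' : StarData, (l = 0 → d' = d) ∧ (l ∈ Ioo (-1 : ℝ) 1 →
      d'.IsConfiguration B ∧ (∀ x ∈ Icc 0 B, d'.rφ x = 0) ∧
      ∀ x ∈ Ioc 0 B, 4 * Real.pi * d'.r x ^ 2 * d'.rχ x = W x + ε * l * f x) := by
    intro l
    -- The member at l = 0 has to be `d` itself, not merely a configuration with the same density;
    -- for |l| ≥ 1 the value is irrelevant.
    by_cases hl0 : l = 0
    · subst hl0
      exact ⟨d, fun _ => rfl, fun _ => ⟨h, hstat, fun x hx => by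
        rw [h.density_eq hB hx]; simp [hW_def]⟩⟩
    by_cases hl : l ∈ Ioo (-1 : ℝ) 1
    swap
    · exact ⟨d, fun h => absurd h hl0, fun h => absurd h hl⟩
    have hc' : ContinuousOn (fun x => W x + ε * l * f x) (Icc 0 B) :=
      hWc.add (continuousOn_const.mul hf)
    have hrB := h.r_pos B ⟨hB, le_rfl⟩
    -- The volume at most doubles, so twice the radius is ample; the condition 4π(2r)² < 1 is then
    -- the assumption on r(B).
    obtain ⟨d', h1, h2, h3⟩ := exists_static_configuration (R := 2 * d.r B) hB hc'
      (fun x hx => by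
        have := abs_le.1 (hsmall l hl x hx)
        have := h.volDensity_pos hx
        linarith)
      (by positivity)
      (by
        have hle : ∫ x in (0 : ℝ)..B, (W x + ε * l * f x) ≤ ∫ x in (0 : ℝ)..B, 2 * W x := by
          refine integral_mono_on hB.le (RegularOn.of_continuousOn hB.le hc').int
            (RegularOn.of_continuousOn hB.le (continuousOn_const.mul hWc)).int fun x hx => ?_
          have := abs_le.1 (hsmall l hl x hx)
          have := h.volDensity_pos hx
          linarith
        rw [intervalIntegral.integral_const_mul,
          h.integral_volDensity hB ⟨hB.le, le_rfl⟩, StarData.vol] at hle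
        have : 0 < 4 * Real.pi / 3 * d.r B ^ 3 := by positivity
        nlinarith)
      (by nlinarith)
    exact ⟨d', fun h => absurd h hl0, fun _ => ⟨h1, fun x _ => h2 x, h3⟩⟩
  choose D hD0 hD using hex
  have hvar : IsVariation d B D := by
    refine ⟨hD0 0 rfl, fun l hl => (hD l hl).1, ?_, ?_⟩
    · refine ⟨fun l x => W x + ε * l * f x, fun _ x => ε * f x, fun _ _ => 0, ?_, ?_,
        continuousOn_const, fun l hl x hx => ⟨(hD l hl).2.2 x hx, ?_, hasDerivAt_const _ _⟩⟩
      · have h1 : ContinuousOn (fun q : ℝ × ℝ => W q.2) (Ioo (-1) 1 ×ˢ Icc 0 B) :=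
          hWc.comp continuousOn_snd fun q hq => hq.2
        have h2 : ContinuousOn (fun q : ℝ × ℝ => f q.2) (Ioo (-1) 1 ×ˢ Icc 0 B) :=
          hf.comp continuousOn_snd fun q hq => hq.2
        exact h1.add ((continuousOn_const.mul continuousOn_fst).mul h2)
      · exact continuousOn_const.mul (hf.comp continuousOn_snd fun q hq => hq.2)
      · have h1 : HasDerivAt (fun t => W x + ε * t * f x) (ε * f x) l := by
          have := (((hasDerivAt_id l).const_mul ε).mul_const (f x)).const_add (W x)
          simpa using this
        refine h1.congr_of_eventuallyEq ?_
        filter_upwards [isOpen_Ioo.mem_nhds hl] with t ht using (hD t ht).2.2 x hx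
    · refine ⟨fun _ _ => 0, fun _ _ => 0, fun _ _ => 0, continuousOn_const, continuousOn_const,
        continuousOn_const, fun l hl x hx => ⟨(hD l hl).2.1 x ⟨hx.1.le, hx.2⟩, ?_,
        hasDerivAt_const _ _⟩⟩
      refine (hasDerivAt_const l (0 : ℝ)).congr_of_eventuallyEq ?_
      filter_upwards [isOpen_Ioo.mem_nhds hl] with t ht using (hD t ht).2.1 x ⟨hx.1.le, hx.2⟩
  obtain ⟨w₁, w₂, v₁, v₂, hder⟩ := hvar.exists_derivatives hB
  have hbase := hvar.base
  have hw₁ : ∀ x ∈ Ioc 0 B, w₁ 0 x = ε * f x := fun x hx => by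
    refine (hder.w_deriv.deriv 0 zero_mem_halfInterval x hx).unique ?_
    have h1 : HasDerivAt (fun t => W x + ε * t * f x) (ε * f x) 0 := by
      have := (((hasDerivAt_id (0 : ℝ)).const_mul ε).mul_const (f x)).const_add (W x)
      simpa using this
    refine h1.congr_of_eventuallyEq ?_
    filter_upwards [isOpen_Ioo.mem_nhds (by norm_num : (0 : ℝ) ∈ Ioo (-1 : ℝ) 1)] with t ht
    rw [← (hD t ht).1.density_eq hB hx, (hD t ht).2.2 x hx]
  have hreg : RegularOn B (w₁ 0) :=
    hder.w_deriv.regularOn_deriv hB.le (by simp) zero_mem_halfInterval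
  have hfirst := (hder.hasSecondVariation hB (by rw [hbase]; exact hstat) rfl rfl rfl rfl rfl rfl
    rfl rfl).1
  have hzero := hfirst.unique (hcrit D hvar)
  rw [hbase, linearSolution_eq_integral] at hzero
  have h5 := h.integral_firstVariation hB hreg
  have h6 : ∫ x in (0 : ℝ)..B, d.firstVariation B x * w₁ 0 x = 0 := by
    rw [← h5]; exact hzero
  -- Along this variation the derivative of M is ε∫f², and it vanishes at a critical point.
  have h7 : ∫ x in (0 : ℝ)..B, f x ^ 2 = 0 := by
    have : ∫ x in (0 : ℝ)..B, d.firstVariation B x * w₁ 0 x = ∫ x in (0 : ℝ)..B, ε * f x ^ 2 := by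
      refine integral_congr_ae (Eventually.of_forall fun x hx => ?_)
      rw [uIoc_of_le hB.le] at hx
      rw [hw₁ x hx, ← hf_def]; ring
    rw [this, intervalIntegral.integral_const_mul] at h6
    exact (mul_eq_zero.1 h6).resolve_left hε.ne'
  by_contra hne
  have := intervalIntegral.integral_pos hB (f := fun x => f x ^ 2) (hf.pow 2)
    (fun x _ => sq_nonneg _) ⟨χ, hχ, by positivity⟩
  exact this.ne' h7

/-! ### Equilibria: the Tolman-Oppenheimer-Volkoff equation and a priori bounds. -/

namespace StarData

/-- A static configuration which satisfies the Euler-Lagrange equation, with non-negative pressure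
which vanishes at the boundary. -/
structure IsEquilibrium (d : StarData) (B : ℝ) : Prop where
  pos : 0 < B
  config : d.IsConfiguration B
  static : ∀ χ ∈ Icc 0 B, d.rφ χ = 0
  pressure_nonneg : ∀ χ ∈ Icc 0 B, 0 ≤ d.pressure χ
  pressure_boundary : d.pressure B = 0
  firstVariation_eq_zero : ∀ χ ∈ Icc 0 B, d.firstVariation B χ = 0

namespace IsEquilibrium

variable {d : StarData} {B : ℝ}

theorem n_sq (d : StarData) (χ : ℝ) : d.n χ ^ 2 = 2 * d.pressure χ + 1 := by
  rw [pressure, rho]; ring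

theorem rho_eq (d : StarData) (χ : ℝ) : d.rho χ = d.pressure χ + 1 := by
  rw [pressure]; ring

theorem n_sq_mul_sq (h : d.IsEquilibrium B) {χ : ℝ} (hχ : χ ∈ Icc 0 B) :
    d.n χ ^ 2 * d.volDensity χ ^ 2 = d.gradSq χ := by
  have := h.config.volDensity_sq hχ
  rwa [h.static χ hχ, zero_pow two_ne_zero, sub_zero] at this

theorem one_le_n (h : d.IsEquilibrium B) {χ : ℝ} (hχ : χ ∈ Icc 0 B) : 1 ≤ d.n χ := by
  have h1 := n_sq d χ
  have h2 := h.pressure_nonneg χ hχ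
  have h3 := h.config.n_pos χ hχ
  nlinarith

theorem n_mul_volDensity_le_one (h : d.IsEquilibrium B) {χ : ℝ} (hχ : χ ∈ Icc 0 B) :
    d.n χ * d.volDensity χ ≤ 1 := by
  have h1 := h.n_sq_mul_sq hχ
  have h2 := h.config.gradSq_le_one h.pos hχ
  rw [← mul_pow] at h1
  by_contra! hlt
  nlinarith

theorem volDensity_le_one (h : d.IsEquilibrium B) {χ : ℝ} (hχ : χ ∈ Icc 0 B) :
    d.volDensity χ ≤ 1 := by
  have h1 := h.n_mul_volDensity_le_one hχ
  have h2 := h.one_le_n hχ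
  have h3 := h.config.volDensity_pos hχ
  nlinarith

/-- The Tolman-Oppenheimer-Volkoff equation. -/
theorem hasDerivAt_pressure (h : d.IsEquilibrium B) {χ : ℝ} (hχ : χ ∈ Ioo 0 B) :
    HasDerivAt d.pressure (-((d.mass χ / d.r χ ^ 3 + 4 * Real.pi * d.pressure χ) /
      (4 * Real.pi * d.r χ * d.volDensity χ))) χ := by
  have hB := h.pos
  have hE := h.config.hasDerivAt_adjoint hB hχ
  have hG := (h.config.adjoint_mul_gravity_regularOn hB).hasDerivAt_primitive hχ
  have hE0 := adjoint_pos d B χ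
  set T := ∫ x in (0 : ℝ)..B, d.adjoint B x * d.gravity x with hT
  -- The pressure is only assumed continuous; its differentiability comes from solving the
  -- Euler-Lagrange equation for it.
  have heq : ∀ x ∈ Icc 0 B, d.pressure x =
      (T - ∫ y in (0 : ℝ)..x, d.adjoint B y * d.gravity y) / d.adjoint B x := fun x hx => by
    have h1 := h.firstVariation_eq_zero x hx
    rw [firstVariation] at h1
    rw [eq_div_iff (adjoint_pos d B x).ne']
    linarith
  have h2 := (hG.const_sub T).div hE hE0.ne'
  have h3 : HasDerivAt d.pressure _ χ := h2.congr_of_eventuallyEq (by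
    filter_upwards [isOpen_Ioo.mem_nhds hχ] with x hx using heq x ⟨hx.1.le, hx.2.le⟩)
  refine h3.congr_deriv ?_
  have h4 := heq χ ⟨hχ.1.le, hχ.2.le⟩
  rw [eq_div_iff hE0.ne'] at h4
  have hr := h.config.r_pos χ ⟨hχ.1, hχ.2.le⟩
  have hw := h.config.volDensity_pos ⟨hχ.1.le, hχ.2.le⟩
  rw [← h4, gravity, rate]
  field_simp
  ring

theorem hasDerivAt_mass (h : d.IsEquilibrium B) {χ : ℝ} (hχ : χ ∈ Ioo 0 B) :
    HasDerivAt d.mass (d.rho χ * d.volDensity χ) χ :=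
  (h.config.hasDerivWithinAt_mass h.pos ⟨hχ.1, hχ.2.le⟩).hasDerivAt (Icc_mem_nhds hχ.1 hχ.2)

theorem hasDerivAt_r (h : d.IsEquilibrium B) {χ : ℝ} (hχ : χ ∈ Ioo 0 B) :
    HasDerivAt d.r (d.volDensity χ / (4 * Real.pi * d.r χ ^ 2)) χ := by
  have hχ' : χ ∈ Ioc 0 B := ⟨hχ.1, hχ.2.le⟩
  refine ((h.config.r_deriv χ hχ').hasDerivAt (Icc_mem_nhds hχ.1 hχ.2)).congr_deriv ?_
  have hr := h.config.r_pos χ hχ'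
  rw [← h.config.density_eq h.pos hχ']
  field_simp

theorem pressure_antitoneOn (h : d.IsEquilibrium B) : AntitoneOn d.pressure (Icc 0 B) := by
  refine antitoneOn_of_deriv_nonpos (convex_Icc 0 B) h.config.pressure_continuousOn ?_ ?_ <;>
    rw [interior_Icc] <;> intro χ hχ
  · exact (h.hasDerivAt_pressure hχ).differentiableAt.differentiableWithinAt
  · rw [(h.hasDerivAt_pressure hχ).deriv]
    have hχ' : χ ∈ Icc 0 B := ⟨hχ.1.le, hχ.2.le⟩
    have h1 := h.config.r_pos χ ⟨hχ.1, hχ.2.le⟩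
    have h2 := h.config.volDensity_pos hχ'
    have h3 := h.config.mass_nonneg h.pos hχ'
    have h4 := h.pressure_nonneg χ hχ'
    have : 0 ≤ (d.mass χ / d.r χ ^ 3 + 4 * Real.pi * d.pressure χ) /
      (4 * Real.pi * d.r χ * d.volDensity χ) := by positivity
    linarith

/-- The density decreases outwards, so its mean over a ball is at least its value at the surface. -/
theorem rho_mul_vol_le_mass (h : d.IsEquilibrium B) {χ : ℝ} (hχ : χ ∈ Icc 0 B) :
    d.rho χ * d.vol χ ≤ d.mass χ :=
  h.config.le_mass h.pos hχ fun x hx => by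
    rw [rho_eq, rho_eq]
    have := h.pressure_antitoneOn ⟨hx.1.le, hx.2.trans hχ.2⟩ hχ hx.2
    linarith

/-- The derivative of `n² (1 - 2m/r)`. -/
theorem hasDerivAt_n_sq_mul_gradSq (h : d.IsEquilibrium B) {χ : ℝ} (hχ : χ ∈ Ioo 0 B) :
    HasDerivAt (fun χ => d.n χ ^ 2 * d.gradSq χ)
      (-(2 * d.volDensity χ * d.n χ ^ 4 / d.r χ)) χ := by
  have hχ' : χ ∈ Icc 0 B := ⟨hχ.1.le, hχ.2.le⟩
  have hr := h.config.r_pos χ ⟨hχ.1, hχ.2.le⟩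
  have hw := h.config.volDensity_pos hχ'
  have ha := h.n_sq_mul_sq hχ'
  have h1 := (h.hasDerivAt_pressure hχ).const_mul 2 |>.add_const 1
  have h2 := (((h.hasDerivAt_mass hχ).const_mul 2).div (h.hasDerivAt_r hχ) hr.ne').const_sub 1
  have h3 := h1.mul h2
  refine (h3.congr_of_eventuallyEq (Eventually.of_forall fun x => ?_)).congr_deriv ?_
  · simp only [n_sq]; rfl
  · have e1 : d.n χ ^ 4 = (2 * d.pressure χ + 1) ^ 2 := by rw [← n_sq]; ring
    have e2 : 1 - 2 * d.mass χ / d.r χ = (2 * d.pressure χ + 1) * d.volDensity χ ^ 2 := by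
      rw [← n_sq, ha, gradSq]
    simp only [Pi.div_apply]
    rw [e1, e2, rho_eq]
    field_simp
    ring

/-- Minus the derivative of the mean density, up to a factor, is non-negative. -/
theorem rho_le_mean (h : d.IsEquilibrium B) {χ : ℝ} (hχ : χ ∈ Ioc 0 B) :
    d.rho χ - 3 * d.mass χ / (4 * Real.pi * d.r χ ^ 3) ≤ 0 := by
  have h1 := h.rho_mul_vol_le_mass ⟨hχ.1.le, hχ.2⟩
  have hr := h.config.r_pos χ hχ
  rw [vol] at h1
  rw [sub_nonpos, le_div_iff₀ (by positivity)]
  linarith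

/-- The square of `e^ψ (m/r³ + 4πp) / √(1 - 2m/r)` is a decreasing function of the radius. -/
theorem buchdahl_antitoneOn (h : d.IsEquilibrium B) :
    AntitoneOn (fun χ => (d.mass χ / d.r χ ^ 3 + 4 * Real.pi * d.pressure χ) ^ 2 /
      (d.n χ ^ 2 * d.gradSq χ)) (Ioc 0 B) := by
  have hB := h.pos
  have hden : ∀ χ ∈ Ioc 0 B, 0 < d.n χ ^ 2 * d.gradSq χ := fun χ hχ => by
    have := h.config.n_pos χ ⟨hχ.1.le, hχ.2⟩
    have := h.config.gradSq_pos ⟨hχ.1.le, hχ.2⟩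
    positivity
  -- The pressure gradient cancels against the derivative of the denominator; only the derivative of
  -- m/r³ survives, and its sign is that of ρ minus the mean density.
  have hd : ∀ χ ∈ Ioo 0 B, HasDerivAt (fun χ => (d.mass χ / d.r χ ^ 3 +
      4 * Real.pi * d.pressure χ) ^ 2 / (d.n χ ^ 2 * d.gradSq χ))
      (2 * (d.mass χ / d.r χ ^ 3 + 4 * Real.pi * d.pressure χ) *
        (d.volDensity χ / d.r χ ^ 3 * (d.rho χ - 3 * d.mass χ / (4 * Real.pi * d.r χ ^ 3))) /
        (d.n χ ^ 2 * d.gradSq χ)) χ := by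
    intro χ hχ
    have hχ' : χ ∈ Icc 0 B := ⟨hχ.1.le, hχ.2.le⟩
    have hr := h.config.r_pos χ ⟨hχ.1, hχ.2.le⟩
    have hw := h.config.volDensity_pos hχ'
    have hn := h.config.n_pos χ hχ'
    have ha := h.n_sq_mul_sq hχ'
    have h1 := ((h.hasDerivAt_mass hχ).div ((h.hasDerivAt_r hχ).pow 3) (pow_pos hr 3).ne').add
      ((h.hasDerivAt_pressure hχ).const_mul (4 * Real.pi))
    have h2 := (h1.pow 2).div (h.hasDerivAt_n_sq_mul_gradSq hχ) (hden χ ⟨hχ.1, hχ.2.le⟩).ne'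
    refine h2.congr_deriv ?_
    simp only [Pi.div_apply, Pi.add_apply, Pi.pow_apply]
    rw [← ha]
    push_cast
    field_simp
    ring
  refine antitoneOn_of_deriv_nonpos (convex_Ioc 0 B) ?_ ?_ ?_
  · have hr := h.config.r_cont.mono (Ioc_subset_Icc_self (a := 0) (b := B))
    refine ContinuousOn.div ((((h.config.mass_continuousOn hB).mono Ioc_subset_Icc_self).div
      (hr.pow 3) fun χ hχ => (pow_pos (h.config.r_pos χ hχ) 3).ne').add (continuousOn_const.mul
      (h.config.pressure_continuousOn.mono Ioc_subset_Icc_self)) |>.pow 2)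
      (((h.config.n_cont.pow 2).mul (h.config.gradSq_continuousOn hB)).mono Ioc_subset_Icc_self)
      fun χ hχ => (hden χ hχ).ne'
  · rw [interior_Ioc]
    exact fun χ hχ => (hd χ hχ).differentiableAt.differentiableWithinAt
  · rw [interior_Ioc]
    intro χ hχ
    rw [(hd χ hχ).deriv]
    have hχ' : χ ∈ Icc 0 B := ⟨hχ.1.le, hχ.2.le⟩
    have h1 := h.config.r_pos χ ⟨hχ.1, hχ.2.le⟩
    have h2 := h.config.volDensity_pos hχ'
    have h3 := h.config.mass_nonneg hB hχ'
    have h4 := h.pressure_nonneg χ hχ'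
    have h5 := hden χ ⟨hχ.1, hχ.2.le⟩
    have h6 := h.rho_le_mean ⟨hχ.1, hχ.2.le⟩
    refine div_nonpos_of_nonpos_of_nonneg (mul_nonpos_of_nonneg_of_nonpos (by positivity)
      (mul_nonpos_of_nonneg_of_nonpos (by positivity) h6)) h5.le

/-- A bound of Buchdahl type: `2m/r` stays away from `1`, for all equilibria. -/
theorem one_div_lt_gradSq (h : d.IsEquilibrium B) {χ : ℝ} (hχ : χ ∈ Icc 0 B) :
    1 / 25 < d.gradSq χ := by
  have hB := h.pos
  rcases hχ.1.eq_or_lt with h0 | h0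
  · simp only [gradSq, ← h0, h.config.r_zero]; norm_num
  have hχ' : χ ∈ Ioc 0 B := ⟨h0, hχ.2⟩
  -- The non-negative root of the monotone quantity, since n²(1 - 2m/r) = (n²w)².
  set G : ℝ → ℝ := fun χ => (d.mass χ / d.r χ ^ 3 + 4 * Real.pi * d.pressure χ) /
    (d.n χ ^ 2 * d.volDensity χ) with hG
  have hG0 : ∀ x ∈ Ioc 0 B, 0 ≤ G x := fun x hx => by
    have hx' : x ∈ Icc 0 B := ⟨hx.1.le, hx.2⟩
    have h1 := h.config.r_pos x hx
    have h2 := h.config.volDensity_pos hx'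
    have h3 := h.config.mass_nonneg hB hx'
    have h4 := h.pressure_nonneg x hx'
    simp only [hG]; positivity
  have hGsq : ∀ x ∈ Ioc 0 B, G x ^ 2 = (d.mass x / d.r x ^ 3 + 4 * Real.pi * d.pressure x) ^ 2 /
      (d.n x ^ 2 * d.gradSq x) := fun x hx => by
    rw [← h.n_sq_mul_sq ⟨hx.1.le, hx.2⟩, hG]
    simp only
    rw [div_pow]; congr 1; ring
  have hGle : ∀ x ∈ Ioc 0 χ, G χ ≤ G x := fun x hx => by
    have hx' : x ∈ Ioc 0 B := ⟨hx.1, hx.2.trans hχ.2⟩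
    have := h.buchdahl_antitoneOn hx' hχ' hx.2
    simp only at this
    rw [← hGsq x hx', ← hGsq χ hχ'] at this
    exact le_of_pow_le_pow_left₀ two_ne_zero (hG0 x hx') this
  -- Buchdahl's comparison: G(x) ≥ G(χ) further inside and w ≤ 1/n, so 1/n grows at least as fast as
  -- G(χ) r²/2. Positivity of 1/n at the centre then bounds G(χ).
  have hmono : MonotoneOn (fun x => (d.n x)⁻¹ - G χ / 2 * d.r x ^ 2) (Icc 0 χ) := by
    have hs : Icc 0 χ ⊆ Icc 0 B := Icc_subset_Icc_right hχ.2
    have hd : ∀ x ∈ Ioo 0 χ, HasDerivAt (fun x => (d.n x)⁻¹ - G χ / 2 * d.r x ^ 2)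
        ((G x * (d.n x)⁻¹ - G χ * d.volDensity x) / (4 * Real.pi * d.r x)) x := by
      intro x hx
      have hxo : x ∈ Ioo 0 B := ⟨hx.1, hx.2.trans_le hχ.2⟩
      have hx' : x ∈ Icc 0 B := ⟨hx.1.le, hxo.2.le⟩
      have hr := h.config.r_pos x ⟨hx.1, hxo.2.le⟩
      have hw := h.config.volDensity_pos hx'
      have hn := h.config.n_pos x hx'
      have h1 := ((h.hasDerivAt_pressure hxo).const_mul 2).add_const 1
      have h2 := h1.sqrt (by rw [← n_sq]; positivity)
      have h3 : HasDerivAt d.n _ x := h2.congr_of_eventuallyEq (by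
        filter_upwards [isOpen_Ioo.mem_nhds hxo] with y hy
        rw [← n_sq, Real.sqrt_sq (h.config.n_pos y ⟨hy.1.le, hy.2.le⟩).le])
      refine ((h3.inv hn.ne').sub (((h.hasDerivAt_r hxo).pow 2).const_mul (G χ / 2))).congr_deriv ?_
      rw [← n_sq, Real.sqrt_sq hn.le]
      simp only [hG]
      push_cast
      field_simp
    refine monotoneOn_of_deriv_nonneg (convex_Icc 0 χ) ?_ ?_ ?_
    · exact ((h.config.n_cont.mono hs).inv₀ fun x hx => (h.config.n_pos x (hs hx)).ne').sub
        (continuousOn_const.mul ((h.config.r_cont.mono hs).pow 2))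
    · rw [interior_Icc]
      exact fun x hx => (hd x hx).differentiableAt.differentiableWithinAt
    · rw [interior_Icc]
      intro x hx
      rw [(hd x hx).deriv]
      have hxo : x ∈ Ioo 0 B := ⟨hx.1, hx.2.trans_le hχ.2⟩
      have hx' : x ∈ Icc 0 B := ⟨hx.1.le, hxo.2.le⟩
      have hr := h.config.r_pos x ⟨hx.1, hxo.2.le⟩
      have hn := h.config.n_pos x hx'
      have h1 := h.n_mul_volDensity_le_one hx'
      have h2 : d.volDensity x ≤ (d.n x)⁻¹ := by
        rw [← one_div, le_div_iff₀ hn]; linarith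
      have h3 := mul_le_mul (hGle x ⟨hx.1, hx.2.le⟩) h2 (h.config.volDensity_pos hx').le
        (hG0 x ⟨hx.1, hxo.2.le⟩)
      exact div_nonneg (sub_nonneg.2 h3) (by positivity)
  have h1 := hmono ⟨le_rfl, hχ.1⟩ ⟨hχ.1, le_rfl⟩ hχ.1
  simp only [h.config.r_zero] at h1
  have hn0 := inv_pos.2 (h.config.n_pos 0 ⟨le_rfl, hB.le⟩)
  have h2 : G χ / 2 * d.r χ ^ 2 < (d.n χ)⁻¹ := by linarith
  have hr := h.config.r_pos χ hχ'
  have hw := h.config.volDensity_pos hχ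
  have hn := h.config.n_pos χ hχ
  have hp := h.pressure_nonneg χ hχ
  have hm := h.config.mass_nonneg hB hχ
  have ha := h.n_sq_mul_sq hχ
  have h3 : (d.mass χ / d.r χ ^ 3 + 4 * Real.pi * d.pressure χ) * d.r χ ^ 2
      < 2 * (d.n χ * d.volDensity χ) := by
    rw [← one_div, lt_div_iff₀ hn] at h2
    simp only [hG] at h2
    have h4 : (d.mass χ / d.r χ ^ 3 + 4 * Real.pi * d.pressure χ) /
        (d.n χ ^ 2 * d.volDensity χ) / 2 * d.r χ ^ 2 * d.n χ
        = ((d.mass χ / d.r χ ^ 3 + 4 * Real.pi * d.pressure χ) * d.r χ ^ 2) /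
          (2 * (d.n χ * d.volDensity χ)) := by
      field_simp
    rw [h4, div_lt_one (by positivity)] at h2
    exact h2
  have h5 : d.mass χ / d.r χ ≤
      (d.mass χ / d.r χ ^ 3 + 4 * Real.pi * d.pressure χ) * d.r χ ^ 2 := by
    have : (d.mass χ / d.r χ ^ 3 + 4 * Real.pi * d.pressure χ) * d.r χ ^ 2
        = d.mass χ / d.r χ + 4 * Real.pi * d.pressure χ * d.r χ ^ 2 := by
      field_simp
    rw [this]
    have : 0 ≤ 4 * Real.pi * d.pressure χ * d.r χ ^ 2 := by positivity
    linarith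
  have h6 : 1 - d.gradSq χ = 2 * (d.mass χ / d.r χ) := by rw [gradSq]; ring
  have h7 : 0 < d.n χ * d.volDensity χ := by positivity
  have h8 : (d.n χ * d.volDensity χ) ^ 2 = d.gradSq χ := by rw [mul_pow]; exact ha
  -- If 1 - 2m/r ≤ 1/25, then nw ≤ 1/5, so `h3` and `h5` give 2m/r < 4/5, contradicting 2m/r ≥
  -- 24/25.
  by_contra! hle
  have h9 : d.n χ * d.volDensity χ ≤ 1 / 5 := by nlinarith
  linarith

theorem n_antitoneOn (h : d.IsEquilibrium B) : AntitoneOn d.n (Icc 0 B) := by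
  intro x hx y hy hxy
  have h1 := h.pressure_antitoneOn hx hy hxy
  have h2 := n_sq d x
  have h3 := n_sq d y
  exact le_of_pow_le_pow_left₀ two_ne_zero (h.config.n_pos x hx).le (by linarith)

/-- The rate of decrease 2wn⁴/r equals 4πn⁴ times the derivative of r². Outside χ one has n ≤ N, so
adding 4πN⁴r² yields an increasing function, evaluated at the boundary where n = 1. -/
theorem n_sq_mul_gradSq_le (h : d.IsEquilibrium B) {χ N : ℝ} (hχ : χ ∈ Icc 0 B)
    (hN : d.n χ ≤ N) : d.n χ ^ 2 * d.gradSq χ ≤ 1 + 4 * Real.pi * N ^ 4 * d.r B ^ 2 := by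
  have hB := h.pos
  have hs : Icc χ B ⊆ Icc 0 B := Icc_subset_Icc_left hχ.1
  have hd : ∀ x ∈ Ioo χ B, HasDerivAt (fun x => d.n x ^ 2 * d.gradSq x +
      4 * Real.pi * N ^ 4 * d.r x ^ 2) (2 * d.volDensity x / d.r x * (N ^ 4 - d.n x ^ 4)) x := by
    intro x hx
    have hxo : x ∈ Ioo 0 B := ⟨hχ.1.trans_lt hx.1, hx.2⟩
    have hr := h.config.r_pos x ⟨hxo.1, hxo.2.le⟩
    refine ((h.hasDerivAt_n_sq_mul_gradSq hxo).add
      (((h.hasDerivAt_r hxo).pow 2).const_mul (4 * Real.pi * N ^ 4))).congr_deriv ?_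
    push_cast
    field_simp
    ring
  have hmono : MonotoneOn (fun x => d.n x ^ 2 * d.gradSq x +
      4 * Real.pi * N ^ 4 * d.r x ^ 2) (Icc χ B) := by
    refine monotoneOn_of_deriv_nonneg (convex_Icc χ B) ?_ ?_ ?_
    · exact (((h.config.n_cont.pow 2).mul (h.config.gradSq_continuousOn hB)).add
        (continuousOn_const.mul (h.config.r_cont.pow 2))).mono hs
    · rw [interior_Icc]
      exact fun x hx => (hd x hx).differentiableAt.differentiableWithinAt
    · rw [interior_Icc]
      intro x hx
      rw [(hd x hx).deriv]
      have hx' : x ∈ Icc 0 B := hs ⟨hx.1.le, hx.2.le⟩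
      have hr := h.config.r_nonneg hx'
      have hw := h.config.volDensity_pos hx'
      have hn := (h.n_antitoneOn hχ hx' hx.1.le).trans hN
      have := pow_le_pow_left₀ (h.config.n_pos x hx').le hn 4
      exact mul_nonneg (by positivity) (sub_nonneg.2 this)
  have hBm : B ∈ Icc 0 B := ⟨hB.le, le_rfl⟩
  have h1 := hmono ⟨le_rfl, hχ.2⟩ ⟨hχ.2, le_rfl⟩ hχ.2
  simp only at h1
  have h2 := h.config.gradSq_le_one hB hBm
  rw [n_sq d B, h.pressure_boundary] at h1
  have h3 : 0 ≤ 4 * Real.pi * N ^ 4 * d.r χ ^ 2 := by positivity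
  linarith

theorem r_le (h : d.IsEquilibrium B) {χ : ℝ} (hχ : χ ∈ Icc 0 B) : d.r χ ≤ d.r B := by
  have hB := h.pos
  have hmono : MonotoneOn d.r (Icc 0 B) := by
    refine monotoneOn_of_deriv_nonneg (convex_Icc 0 B) h.config.r_cont ?_ ?_ <;>
      rw [interior_Icc] <;> intro x hx
    · exact (h.hasDerivAt_r hx).differentiableAt.differentiableWithinAt
    · rw [(h.hasDerivAt_r hx).deriv]
      have := h.config.volDensity_pos ⟨hx.1.le, hx.2.le⟩
      positivity
  exact hmono hχ ⟨hB.le, le_rfl⟩ hχ.2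

/-- A star of small radius has bounded density. -/
theorem n_le (h : d.IsEquilibrium B) (hR : d.r B < 1 / 1000) {χ : ℝ} (hχ : χ ∈ Icc 0 B) :
    d.n χ ≤ 8 := by
  by_contra! hlt
  have hB := h.pos
  have hnB : d.n B = 1 := by
    have h1 := n_sq d B
    rw [h.pressure_boundary] at h1
    have h2 := h.config.n_pos B ⟨hB.le, le_rfl⟩
    nlinarith
  -- Where n is exactly 8 the previous bound applies with N = 8. The Buchdahl bound makes n²(1 -
  -- 2m/r) > 64/25 there, far above 1 + O(R²).
  obtain ⟨x, hx, hnx⟩ := intermediate_value_Icc' hχ.2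
    (h.config.n_cont.mono (Icc_subset_Icc_left hχ.1)) (show (8 : ℝ) ∈ Icc (d.n B) (d.n χ) from
      ⟨by rw [hnB]; norm_num, hlt.le⟩)
  have hx' : x ∈ Icc 0 B := ⟨hχ.1.trans hx.1, hx.2⟩
  have h1 := h.n_sq_mul_gradSq_le hx' hnx.le
  have h2 := h.one_div_lt_gradSq hx'
  have h3 := h.config.r_nonneg (χ := B) ⟨hB.le, le_rfl⟩
  rw [hnx] at h1
  have h4 : d.r B ^ 2 ≤ (1 / 1000) ^ 2 := pow_le_pow_left₀ h3 hR.le 2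
  have h5 : Real.pi * d.r B ^ 2 ≤ 4 * (1 / 1000) ^ 2 :=
    mul_le_mul Real.pi_le_four h4 (sq_nonneg _) (by norm_num)
  linarith

theorem gradSq_ge (h : d.IsEquilibrium B) (hR : d.r B < 1 / 1000) {χ : ℝ} (hχ : χ ∈ Icc 0 B) :
    999 / 1000 ≤ d.gradSq χ := by
  have hB := h.pos
  -- From n ≤ 8, ρ ≤ (64 + 1)/2 < 33.
  have h1 := h.config.gradSq_ge hB (C := 33) hχ fun x hx => by
    have := h.n_le hR ⟨hx.1.le, hx.2.trans hχ.2⟩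
    have := h.config.n_pos x ⟨hx.1.le, hx.2.trans hχ.2⟩
    rw [rho]; nlinarith
  have h4 : d.r χ ^ 2 ≤ (1 / 1000) ^ 2 :=
    pow_le_pow_left₀ (h.config.r_nonneg hχ) ((h.r_le hχ).trans hR.le) 2
  have h5 : Real.pi * d.r χ ^ 2 ≤ 4 * (1 / 1000) ^ 2 :=
    mul_le_mul Real.pi_le_four h4 (sq_nonneg _) (by norm_num)
  linarith

theorem n_sq_le (h : d.IsEquilibrium B) (hR : d.r B < 1 / 1000) {χ : ℝ} (hχ : χ ∈ Icc 0 B) :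
    d.n χ ^ 2 ≤ 27 / 25 := by
  have hB := h.pos
  have h1 := h.n_sq_mul_gradSq_le hχ (h.n_le hR hχ)
  have h2 := h.gradSq_ge hR hχ
  have h3 := h.config.r_nonneg (χ := B) ⟨hB.le, le_rfl⟩
  have h4 : d.r B ^ 2 ≤ (1 / 1000) ^ 2 := pow_le_pow_left₀ h3 hR.le 2
  have h5 : Real.pi * d.r B ^ 2 ≤ 4 * (1 / 1000) ^ 2 :=
    mul_le_mul Real.pi_le_four h4 (sq_nonneg _) (by norm_num)
  nlinarith [sq_nonneg (d.n χ)]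

theorem volDensity_ge (h : d.IsEquilibrium B) (hR : d.r B < 1 / 1000) {χ : ℝ}
    (hχ : χ ∈ Icc 0 B) : 9 / 10 ≤ d.volDensity χ := by
  have h1 := h.n_sq_le hR hχ
  have h2 := h.gradSq_ge hR hχ
  have h3 := h.n_sq_mul_sq hχ
  have h4 := h.config.volDensity_pos hχ
  by_contra! hlt
  have h5 : d.volDensity χ ^ 2 ≤ (9 / 10) ^ 2 := pow_le_pow_left₀ h4.le hlt.le 2
  nlinarith [sq_nonneg (d.n χ), sq_nonneg (d.volDensity χ)]

end IsEquilibrium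

end StarData

/-! ### Coercivity of the second variation. -/

theorem RegularOn.eq_zero_of_integral_eq_zero {B : ℝ} {g : ℝ → ℝ} (hB : 0 < B)
    (hg : RegularOn B g) (hg0 : ∀ χ ∈ Ioc 0 B, 0 ≤ g χ) (hI : ∫ x in (0 : ℝ)..B, g x = 0)
    {χ : ℝ} (hχ : χ ∈ Ioc 0 B) : g χ = 0 := by
  have hP : ∀ x ∈ Icc 0 B, ∫ y in (0 : ℝ)..x, g y = 0 := fun x hx => by
    refine le_antisymm ((primitive_mono hg hg0 hx.1 hx.2 le_rfl).trans hI.le) ?_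
    simpa using primitive_mono hg hg0 le_rfl hx.1 hx.2
  have h1 := hg.hasDerivWithinAt_primitive hχ
  have h2 : HasDerivWithinAt (fun χ => ∫ x in (0 : ℝ)..χ, g x) 0 (Icc 0 B) χ :=
    (hasDerivWithinAt_const χ _ (0 : ℝ)).congr hP (hP χ ⟨hχ.1.le, hχ.2⟩)
  exact (uniqueDiffOn_Icc hB χ ⟨hχ.1.le, hχ.2⟩).eq_deriv _ h1 h2

/-- The Cauchy-Schwarz inequality on an interval. -/
theorem sq_integral_le {B : ℝ} {f : ℝ → ℝ} (hf : RegularOn B f)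
    (hf2 : RegularOn B (fun x => f x ^ 2)) {χ : ℝ} (hχ : χ ∈ Ioc 0 B) :
    (∫ x in (0 : ℝ)..χ, f x) ^ 2 ≤ χ * ∫ x in (0 : ℝ)..B, f x ^ 2 := by
  have hχ' : χ ∈ Icc 0 B := ⟨hχ.1.le, hχ.2⟩
  set I := ∫ x in (0 : ℝ)..χ, f x with hI
  set Q := ∫ x in (0 : ℝ)..χ, f x ^ 2 with hQ
  -- The integrated squared deviation from the mean value of f is non-negative.
  have h1 : 0 ≤ ∫ x in (0 : ℝ)..χ, (f x - I / χ) ^ 2 :=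
    integral_nonneg hχ.1.le fun x _ => sq_nonneg _
  have h2 : ∫ x in (0 : ℝ)..χ, (f x - I / χ) ^ 2 = Q - I ^ 2 / χ := by
    have e : ∀ x, (f x - I / χ) ^ 2 = (f x ^ 2 - (2 * (I / χ)) * f x) + (I / χ) ^ 2 :=
      fun x => by ring
    simp only [e]
    rw [intervalIntegral.integral_add ((hf2.mono hχ').int.sub ((hf.mono hχ').int.const_mul _))
      (by simp), intervalIntegral.integral_sub (hf2.mono hχ').int ((hf.mono hχ').int.const_mul _),
      intervalIntegral.integral_const_mul, ← hI, ← hQ]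
    have := hχ.1.ne'
    simp only [intervalIntegral.integral_const, sub_zero, smul_eq_mul]
    field_simp
    ring
  have h3 : I ^ 2 / χ ≤ Q := by linarith
  rw [div_le_iff₀ hχ.1] at h3
  have h4 : Q ≤ ∫ x in (0 : ℝ)..B, f x ^ 2 :=
    primitive_mono hf2 (fun x _ => sq_nonneg _) hχ.1.le hχ.2 le_rfl
  nlinarith [hχ.1]

/-- The elementary estimate behind the coercivity of the second variation. -/
theorem abs_remainder_le {χ N Y e q V w m μ y : ℝ} (hχ0 : 0 < χ) (he0 : 0 < e) (hN0 : 0 ≤ N)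
    (hY0 : 0 ≤ Y) (hq0 : 0 < q) (hm0 : 0 ≤ m) (hmχ : m ≤ 26 / 25 * χ) (hw0 : 9 / 10 ≤ w)
    (hq1 : q ≤ 2 * e) (hq4 : q ^ 4 * χ ≤ 10 * e) (hq7 : q ^ 7 * χ ^ 2 ≤ 50 * e)
    (hY2 : Y ^ 2 ≤ χ * N) (hm1 : |μ| ≤ Y) (hV : |V| ≤ Y) :
    |-(m * q ^ 7 / (4 * Real.pi ^ 2 * w) * V ^ 2) - m * q ^ 4 / (2 * Real.pi * w ^ 2) * V * y
      + μ * q ^ 4 / (2 * Real.pi * w) * V + 2 * μ * q * y / w ^ 2|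
      ≤ 4 * e * N + 8 * e * (Y * |y|) := by
  have hπ := Real.pi_gt_three
  have hz0 := abs_nonneg y
  have hww : (9 / 10) ^ 2 ≤ w ^ 2 := pow_le_pow_left₀ (by norm_num) hw0 2
  have hπw : 3 * (9 / 10) ≤ Real.pi * w := mul_le_mul hπ.le hw0 (by norm_num) (by linarith)
  have hπw2 : 3 * (9 / 10) ^ 2 ≤ Real.pi * w ^ 2 :=
    mul_le_mul hπ.le hww (by norm_num) (by linarith)
  have hπ2w : 9 * (9 / 10) ≤ Real.pi ^ 2 * w :=
    mul_le_mul (by nlinarith) hw0 (by norm_num) (by positivity)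
  -- In terms without y, Y² ≤ χN supplies a factor χ, and powers of χ against powers of q leave a
  -- single e. Terms with one y keep the product Y|y|, to be split later.
  have T1 : |m * q ^ 7 / (4 * Real.pi ^ 2 * w) * V ^ 2| ≤ 2 * e * N := by
    rw [abs_mul, abs_div, abs_of_nonneg (by positivity : 0 ≤ m * q ^ 7),
      abs_of_pos (by linarith : 0 < 4 * Real.pi ^ 2 * w), abs_pow]
    rw [div_mul_eq_mul_div, div_le_iff₀ (by linarith)]
    have h1 : |V| ^ 2 ≤ χ * N := (pow_le_pow_left₀ (abs_nonneg _) hV 2).trans hY2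
    calc m * q ^ 7 * |V| ^ 2 ≤ (26 / 25 * χ) * q ^ 7 * (χ * N) := by gcongr
      _ = 26 / 25 * (q ^ 7 * χ ^ 2) * N := by ring
      _ ≤ 26 / 25 * (50 * e) * N := by gcongr
      _ ≤ 2 * e * N * (4 * (9 * (9 / 10))) := by nlinarith [mul_nonneg he0.le hN0]
      _ ≤ 2 * e * N * (4 * Real.pi ^ 2 * w) := by
        refine mul_le_mul_of_nonneg_left ?_ (by positivity)
        linarith
  have T2 : |m * q ^ 4 / (2 * Real.pi * w ^ 2) * V * y| ≤ 3 * e * (Y * |y|) := by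
    rw [abs_mul, abs_mul, abs_div, abs_of_nonneg (by positivity : 0 ≤ m * q ^ 4),
      abs_of_pos (by linarith : 0 < 2 * Real.pi * w ^ 2), div_mul_eq_mul_div,
      div_mul_eq_mul_div, div_le_iff₀ (by linarith)]
    calc m * q ^ 4 * |V| * |y| ≤ (26 / 25 * χ) * q ^ 4 * Y * |y| := by gcongr
      _ = 26 / 25 * (q ^ 4 * χ) * (Y * |y|) := by ring
      _ ≤ 26 / 25 * (10 * e) * (Y * |y|) := by gcongr
      _ ≤ 3 * e * (Y * |y|) * (2 * (3 * (9 / 10) ^ 2)) := by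
        nlinarith [mul_nonneg he0.le (mul_nonneg hY0 hz0)]
      _ ≤ 3 * e * (Y * |y|) * (2 * Real.pi * w ^ 2) := by
        refine mul_le_mul_of_nonneg_left ?_ (by positivity)
        linarith
  have T3 : |μ * q ^ 4 / (2 * Real.pi * w) * V| ≤ 2 * e * N := by
    rw [abs_mul, abs_div, abs_mul, abs_of_nonneg (by positivity : 0 ≤ q ^ 4),
      abs_of_pos (by linarith : 0 < 2 * Real.pi * w), div_mul_eq_mul_div,
      div_le_iff₀ (by linarith)]
    calc |μ| * q ^ 4 * |V| ≤ Y * q ^ 4 * Y := by gcongr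
      _ = q ^ 4 * Y ^ 2 := by ring
      _ ≤ q ^ 4 * (χ * N) := by gcongr
      _ = q ^ 4 * χ * N := by ring
      _ ≤ 10 * e * N := by gcongr
      _ ≤ 2 * e * N * (2 * (3 * (9 / 10))) := by nlinarith [mul_nonneg he0.le hN0]
      _ ≤ 2 * e * N * (2 * Real.pi * w) := by
        refine mul_le_mul_of_nonneg_left ?_ (by positivity)
        linarith
  have T4 : |2 * μ * q * y / w ^ 2| ≤ 5 * e * (Y * |y|) := by
    rw [abs_div, abs_mul, abs_mul, abs_mul, abs_of_pos hq0, abs_two,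
      abs_of_pos (by linarith : 0 < w ^ 2), div_le_iff₀ (by linarith)]
    calc 2 * |μ| * q * |y| ≤ 2 * Y * (2 * e) * |y| := by gcongr
      _ ≤ 5 * e * (Y * |y|) * (9 / 10) ^ 2 := by
        nlinarith [mul_nonneg he0.le (mul_nonneg hY0 hz0)]
      _ ≤ 5 * e * (Y * |y|) * w ^ 2 := by gcongr
  rw [abs_le]
  obtain ⟨a1, b1⟩ := abs_le.1 T1
  obtain ⟨a2, b2⟩ := abs_le.1 T2
  obtain ⟨a3, b3⟩ := abs_le.1 T3
  obtain ⟨a4, b4⟩ := abs_le.1 T4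
  constructor <;> linarith

namespace StarData

/-- The density of the second variation of the mass, for a variation of `w = 4π r² ∂r/∂χ`,
of `∂r/∂φ` and of the Hawking mass by `w₁`, `v₁` and `m₁`. -/
noncomputable def quadraticDensity (d : StarData) (w₁ v₁ m₁ : ℝ → ℝ) (χ : ℝ) : ℝ :=
  (1 - 2 * d.mass χ * (d.r χ)⁻¹) / d.volDensity χ ^ 3 * (w₁ χ ^ 2 + v₁ χ ^ 2)
    - d.mass χ * (d.r χ)⁻¹ ^ 7 / (4 * Real.pi ^ 2 * d.volDensity χ)
      * (∫ x in (0 : ℝ)..χ, w₁ x) ^ 2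
    - d.mass χ * (d.r χ)⁻¹ ^ 4 / (2 * Real.pi * d.volDensity χ ^ 2)
      * (∫ x in (0 : ℝ)..χ, w₁ x) * w₁ χ
    + m₁ χ * (d.r χ)⁻¹ ^ 4 / (2 * Real.pi * d.volDensity χ) * (∫ x in (0 : ℝ)..χ, w₁ x)
    + 2 * m₁ χ * (d.r χ)⁻¹ * w₁ χ / d.volDensity χ ^ 2

namespace IsEquilibrium

variable {d : StarData} {B : ℝ}

theorem le_vol (h : d.IsEquilibrium B) (hR : d.r B < 1 / 1000) {χ : ℝ} (hχ : χ ∈ Icc 0 B) :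
    9 / 10 * χ ≤ d.vol χ :=
  h.config.le_vol h.pos (fun _ hx => h.volDensity_ge hR hx) hχ

theorem vol_le (h : d.IsEquilibrium B) {χ : ℝ} (hχ : χ ∈ Icc 0 B) : d.vol χ ≤ χ := by
  rw [← h.config.integral_volDensity h.pos hχ]
  have : χ = ∫ _ in (0 : ℝ)..χ, (1 : ℝ) := by simp
  nth_rewrite 2 [this]
  exact integral_mono_on hχ.1 ((RegularOn.of_continuousOn h.pos.le
    (h.config.volDensity_continuousOn h.pos)).mono hχ).int (by simp)
    fun x hx => h.volDensity_le_one ⟨hx.1, hx.2.trans hχ.2⟩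

/-- The smallness parameter χ^{2/3}: a small radius forces a small particle number, as the volume is
at least 9χ/10. Up to a factor 3/2 this is the integral of the weight. -/
theorem label_mul_weight_le (h : d.IsEquilibrium B) (hR : d.r B < 1 / 1000) {χ : ℝ}
    (hχ : χ ∈ Ioc 0 B) : χ * centralWeight χ ≤ 1 / 100000 := by
  have h1 := h.le_vol hR ⟨h.pos.le, le_rfl⟩
  have h2 := h.config.r_nonneg (χ := B) ⟨h.pos.le, le_rfl⟩
  have h3 : d.r B ^ 3 ≤ (1 / 1000) ^ 3 := pow_le_pow_left₀ h2 hR.le 3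
  have h4 : Real.pi * d.r B ^ 3 ≤ 4 * (1 / 1000) ^ 3 :=
    mul_le_mul Real.pi_le_four h3 (by positivity) (by norm_num)
  rw [vol] at h1
  have h5 : χ ≤ 8 * (1 / 1000) ^ 3 := by linarith [hχ.2]
  have h6 := centralWeight_cube hχ.1
  have h7 := centralWeight_pos hχ.1
  refine le_of_pow_le_pow_left₀ three_ne_zero (by norm_num) ?_
  have h8 : (χ * centralWeight χ) ^ 3 = χ ^ 2 := by linear_combination χ ^ 2 * h6
  rw [h8]
  have h9 : χ ^ 2 ≤ (8 * (1 / 1000) ^ 3) ^ 2 := pow_le_pow_left₀ hχ.1.le h5 2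
  norm_num at h9 ⊢
  linarith

theorem inv_r_bounds (h : d.IsEquilibrium B) (hR : d.r B < 1 / 1000) {χ : ℝ} (hχ : χ ∈ Ioc 0 B) :
    0 < (d.r χ)⁻¹ ∧ (d.r χ)⁻¹ ^ 3 * χ ≤ 5 ∧ (d.r χ)⁻¹ ≤ 2 * centralWeight χ := by
  have h1 := h.config.inv_r_cube hχ
  have h2 := h.le_vol hR ⟨hχ.1.le, hχ.2⟩
  have h3 := inv_pos.2 (h.config.r_pos χ hχ)
  have h4 := mul_le_mul_of_nonneg_left h2 (pow_pos h3 3).le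
  have h5 : (d.r χ)⁻¹ ^ 3 * χ ≤ 5 := by
    have := Real.pi_lt_d2
    linarith
  refine ⟨h3, h5, le_of_pow_le_pow_left₀ three_ne_zero (by
    have := centralWeight_pos hχ.1
    positivity) ?_⟩
  have h6 := centralWeight_cube hχ.1
  refine le_of_mul_le_mul_right ?_ hχ.1
  rw [mul_pow, mul_assoc, h6]
  linarith

theorem inv_r_pow_four_mul_le (h : d.IsEquilibrium B) (hR : d.r B < 1 / 1000) {χ : ℝ}
    (hχ : χ ∈ Ioc 0 B) : (d.r χ)⁻¹ ^ 4 * χ ≤ 10 * centralWeight χ := by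
  obtain ⟨h1, h2, h3⟩ := h.inv_r_bounds hR hχ
  have := mul_le_mul h2 h3 h1.le (by norm_num)
  linarith

theorem inv_r_pow_seven_mul_le (h : d.IsEquilibrium B) (hR : d.r B < 1 / 1000) {χ : ℝ}
    (hχ : χ ∈ Ioc 0 B) : (d.r χ)⁻¹ ^ 7 * χ ^ 2 ≤ 50 * centralWeight χ := by
  obtain ⟨h1, h2, -⟩ := h.inv_r_bounds hR hχ
  have h0 := hχ.1
  have h3 := mul_le_mul (h.inv_r_pow_four_mul_le hR hχ) h2 (by positivity)
    (by have := centralWeight_pos h0; positivity)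
  linarith

theorem pressure_le (h : d.IsEquilibrium B) (hR : d.r B < 1 / 1000) {χ : ℝ} (hχ : χ ∈ Icc 0 B) :
    d.pressure χ ≤ 1 / 25 := by
  have h1 := h.n_sq_le hR hχ
  rw [n_sq] at h1
  linarith

theorem mass_le (h : d.IsEquilibrium B) (hR : d.r B < 1 / 1000) {χ : ℝ} (hχ : χ ∈ Icc 0 B) :
    d.mass χ ≤ 26 / 25 * χ := by
  have h1 := h.config.mass_le h.pos (C := 26 / 25) hχ fun x hx => by
    rw [rho_eq]
    linarith [h.pressure_le hR ⟨hx.1.le, hx.2.trans hχ.2⟩]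
  linarith [h.vol_le hχ]

theorem gravity_le (h : d.IsEquilibrium B) (hR : d.r B < 1 / 1000) {χ : ℝ} (hχ : χ ∈ Ioc 0 B) :
    d.gravity χ ≤ centralWeight χ := by
  have hχ' : χ ∈ Icc 0 B := ⟨hχ.1.le, hχ.2⟩
  have h1 := h.mass_le hR hχ'
  have h2 := h.inv_r_pow_four_mul_le hR hχ
  have h3 := (h.inv_r_bounds hR hχ).1
  have h4 := h.volDensity_ge hR hχ'
  have he := centralWeight_pos hχ.1
  have h5 : d.mass χ * (d.r χ)⁻¹ ^ 4 ≤ 26 / 25 * χ * (d.r χ)⁻¹ ^ 4 :=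
    mul_le_mul_of_nonneg_right h1 (by positivity)
  have h6 : 3 * (9 / 10) ≤ Real.pi * d.volDensity χ :=
    mul_le_mul Real.pi_gt_three.le h4 (by norm_num) Real.pi_pos.le
  rw [gravity, div_le_iff₀ (by linarith)]
  nlinarith

theorem rate_le (h : d.IsEquilibrium B) (hR : d.r B < 1 / 1000) {χ : ℝ} (hχ : χ ∈ Ioc 0 B) :
    d.rate χ ≤ 3 * centralWeight χ := by
  have h1 := h.inv_r_bounds hR hχ
  have h2 := h.volDensity_ge hR ⟨hχ.1.le, hχ.2⟩
  have he := centralWeight_pos hχ.1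
  rw [rate, div_le_iff₀ (by linarith)]
  nlinarith

/-- The total decay ∫`rate` is O(B^{2/3}), so the exponential is close to 1. -/
theorem half_le_adjoint (h : d.IsEquilibrium B) (hR : d.r B < 1 / 1000) {χ : ℝ}
    (hχ : χ ∈ Icc 0 B) : 1 / 2 ≤ d.adjoint B χ := by
  have hB := h.pos
  have hk := h.config.rate_regularOn hB
  have h1 : 0 ≤ ∫ x in (0 : ℝ)..χ, d.rate x := by
    simpa using primitive_mono hk (fun x hx => h.config.rate_nonneg hx) le_rfl hχ.1 hχ.2
  have h2 : ∫ x in (0 : ℝ)..B, d.rate x ≤ ∫ x in (0 : ℝ)..B, 3 * centralWeight x :=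
    integral_mono_on_of_le_Ioo hB.le hk.int ((intervalIntegrable_centralWeight 0 B).const_mul 3)
      fun x hx => h.rate_le hR ⟨hx.1, hx.2.le⟩
  rw [intervalIntegral.integral_const_mul, integral_centralWeight hB] at h2
  have h3 := h.label_mul_weight_le hR ⟨hB, le_rfl⟩
  have h4 := Real.add_one_le_exp
    ((∫ y in (0 : ℝ)..χ, d.rate y) - ∫ y in (0 : ℝ)..B, d.rate y)
  rw [adjoint]
  linarith

section Coercivity

variable {w₁ v₁ m₁ : ℝ → ℝ} {C : ℝ}

/-- The variation of the Hawking mass is controlled by the variation of the volume. -/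
theorem abs_massVariation_le (h : d.IsEquilibrium B) (hR : d.r B < 1 / 1000)
    (hw : RegularOn B w₁)
    (hm : m₁ = linearSolution d.rate
      (fun χ => -d.pressure χ * w₁ χ + d.gravity χ * ∫ x in (0 : ℝ)..χ, w₁ x))
    {χ : ℝ} (hχ : χ ∈ Ioc 0 B) : |m₁ χ| ≤ ∫ x in (0 : ℝ)..χ, |w₁ x| := by
  have hχ' : χ ∈ Icc 0 B := ⟨hχ.1.le, hχ.2⟩
  have hwa : RegularOn B (fun x => |w₁ x|) := ⟨hw.cont.abs, hw.int.abs⟩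
  set Y := ∫ x in (0 : ℝ)..χ, |w₁ x| with hY
  have hY0 : 0 ≤ Y := integral_nonneg hχ.1.le fun x _ => abs_nonneg _
  have hreg : RegularOn χ (fun x => 1 / 25 * |w₁ x| + Y * centralWeight x) :=
    ((hwa.mono hχ').const_mul _).add ((centralWeight_regularOn χ).const_mul _)
  have h1 : |m₁ χ| ≤ ∫ x in (0 : ℝ)..χ, (1 / 25 * |w₁ x| + Y * centralWeight x) := by
    rw [hm]
    refine abs_linearSolution_le hχ.1.le ((h.config.rate_regularOn h.pos).mono hχ')
      (fun x hx => h.config.rate_nonneg ⟨hx.1, hx.2.trans hχ.2⟩) hreg.int (fun x hx => ?_)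
      ⟨hχ.1.le, le_rfl⟩
    have hx' : x ∈ Ioc 0 B := ⟨hx.1, hx.2.trans hχ.2⟩
    have hx'' : x ∈ Icc 0 B := ⟨hx.1.le, hx'.2⟩
    have e1 := h.pressure_le hR hx''
    have e2 := h.pressure_nonneg x hx''
    have e3 := h.gravity_le hR hx'
    have e4 := h.config.gravity_nonneg h.pos hx'
    have e5 : |∫ y in (0 : ℝ)..x, w₁ y| ≤ Y :=
      (abs_integral_le_integral_abs hx.1.le).trans
        (primitive_mono hwa (fun _ _ => abs_nonneg _) hx.1.le hx.2 hχ.2)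
    refine (abs_add_le _ _).trans (add_le_add ?_ ?_)
    · rw [abs_mul, abs_neg, abs_of_nonneg e2]
      exact mul_le_mul_of_nonneg_right e1 (abs_nonneg _)
    · rw [abs_mul, abs_of_nonneg e4, mul_comm]
      exact mul_le_mul e5 e3 e4 hY0
  -- The pressure contributes Y/25 and gravity a tiny multiple of Y, together below Y.
  rw [intervalIntegral.integral_add ((hwa.mono hχ').const_mul _).int
    ((intervalIntegrable_centralWeight 0 χ).const_mul _), intervalIntegral.integral_const_mul,
    intervalIntegral.integral_const_mul, integral_centralWeight hχ.1, ← hY] at h1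
  have h2 := h.label_mul_weight_le hR hχ
  nlinarith

/-- Pointwise, the second variation of a small star is dominated by its diagonal part. -/
theorem abs_quadraticDensity_sub_le (h : d.IsEquilibrium B) (hR : d.r B < 1 / 1000)
    (hw : RegularOn B w₁) (hw2 : RegularOn B (fun x => w₁ x ^ 2))
    (hm : m₁ = linearSolution d.rate
      (fun χ => -d.pressure χ * w₁ χ + d.gravity χ * ∫ x in (0 : ℝ)..χ, w₁ x))
    {χ : ℝ} (hχ : χ ∈ Ioc 0 B) :
    |d.quadraticDensity w₁ v₁ m₁ χ - d.gradSq χ / d.volDensity χ ^ 3 * (w₁ χ ^ 2 + v₁ χ ^ 2)|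
      ≤ 8 * centralWeight χ * (∫ x in (0 : ℝ)..B, w₁ x ^ 2) + 1 / 1000 * w₁ χ ^ 2 := by
  have hχ' : χ ∈ Icc 0 B := ⟨hχ.1.le, hχ.2⟩
  have hwa : RegularOn B (fun x => |w₁ x|) := ⟨hw.cont.abs, hw.int.abs⟩
  set Y := ∫ x in (0 : ℝ)..χ, |w₁ x| with hY
  set N := ∫ x in (0 : ℝ)..B, w₁ x ^ 2 with hN
  set e := centralWeight χ with he_def
  set q := (d.r χ)⁻¹ with hq_def
  set V := ∫ x in (0 : ℝ)..χ, w₁ x with hV_def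
  set w := d.volDensity χ with hw_def
  set m := d.mass χ with hm_def
  set z := |w₁ χ| with hz
  have hY0 : 0 ≤ Y := integral_nonneg hχ.1.le fun x _ => abs_nonneg _
  have hY2 : Y ^ 2 ≤ χ * N := by
    have := sq_integral_le hwa (by simpa using hw2) hχ
    simpa using this
  have hN0 : 0 ≤ N := integral_nonneg h.pos.le fun x _ => sq_nonneg _
  have hm1 : |m₁ χ| ≤ Y := h.abs_massVariation_le hR hw hm hχ
  have hV : |V| ≤ Y := abs_integral_le_integral_abs hχ.1.le
  have hmχ := h.mass_le hR hχ'
  have hm0 := h.config.mass_nonneg h.pos hχ'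
  have hq4 := h.inv_r_pow_four_mul_le hR hχ
  have hq7 := h.inv_r_pow_seven_mul_le hR hχ
  obtain ⟨hq0, -, hq1⟩ := h.inv_r_bounds hR hχ
  have hw0 := h.volDensity_ge hR hχ'
  have he0 : 0 < e := centralWeight_pos hχ.1
  have hχe := h.label_mul_weight_le hR hχ
  have hz0 : 0 ≤ z := abs_nonneg _
  have hχ0 := hχ.1
  rw [← he_def] at hq4 hq7 hq1 hχe
  rw [← hq_def] at hq4 hq7 hq0 hq1
  -- Arithmetic-geometric mean for Yz ≤ √N · √χ z; multiplied by e, the last term carries the small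
  -- factor χe.
  have hYz : 2 * (Y * z) ≤ N + χ * z ^ 2 := by
    refine abs_le_of_sq_le_sq' ?_ (by positivity) |>.2
    have : (Y * z) ^ 2 ≤ χ * N * z ^ 2 := by
      rw [mul_pow]; exact mul_le_mul_of_nonneg_right hY2 (sq_nonneg _)
    nlinarith [sq_nonneg (N - χ * z ^ 2)]
  have hT := abs_remainder_le hχ0 he0 hN0 hY0 hq0 hm0 hmχ hw0 hq1 hq4 hq7 hY2 hm1 hV
    (y := w₁ χ)
  have hsum : d.quadraticDensity w₁ v₁ m₁ χ
      - d.gradSq χ / w ^ 3 * (w₁ χ ^ 2 + v₁ χ ^ 2)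
      = -(m * q ^ 7 / (4 * Real.pi ^ 2 * w) * V ^ 2)
        - m * q ^ 4 / (2 * Real.pi * w ^ 2) * V * w₁ χ
        + m₁ χ * q ^ 4 / (2 * Real.pi * w) * V + 2 * m₁ χ * q * w₁ χ / w ^ 2 := by
    rw [quadraticDensity, gradSq, div_eq_mul_inv (2 * d.mass χ)]
    ring
  rw [hsum]
  refine hT.trans ?_
  have h5 : 8 * e * (Y * z) ≤ 4 * e * N + 4 * (χ * e) * z ^ 2 := by
    have := mul_le_mul_of_nonneg_left hYz (by positivity : 0 ≤ 4 * e)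
    linarith
  have h6 : 4 * (χ * e) * z ^ 2 ≤ 1 / 1000 * w₁ χ ^ 2 := by
    have : z ^ 2 = w₁ χ ^ 2 := sq_abs _
    rw [this]
    exact mul_le_mul_of_nonneg_right (by linarith) (sq_nonneg _)
  rw [← hz]
  linarith

/-- The comparison with the diagonal part already bounds the density by a constant plus a multiple
of χ^{-1/3}. -/
theorem quadraticDensity_regularOn (h : d.IsEquilibrium B) (hR : d.r B < 1 / 1000)
    (hw : ContinuousOn w₁ (Ioc 0 B)) (hv : ContinuousOn v₁ (Ioc 0 B))
    (hC : ∀ χ ∈ Ioc 0 B, |w₁ χ| ≤ C ∧ |v₁ χ| ≤ C)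
    (hw1 : RegularOn B w₁) (hw2 : RegularOn B (fun x => w₁ x ^ 2))
    (hm : m₁ = linearSolution d.rate
      (fun χ => -d.pressure χ * w₁ χ + d.gravity χ * ∫ x in (0 : ℝ)..χ, w₁ x)) :
    RegularOn B (d.quadraticDensity w₁ v₁ m₁) := by
  have hB := h.pos
  have hV := hw1.continuousOn_primitive hB.le
  have hmc : ContinuousOn m₁ (Icc 0 B) := by
    rw [hm]
    refine continuousOn_linearSolution hB.le (h.config.rate_regularOn hB)
      ((hw1.continuousOn_mul hB.le h.config.pressure_continuousOn.neg).add ?_)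
    exact ((h.config.gravity_regularOn hB).continuousOn_mul hB.le hV).congr hB.le
      fun x _ => mul_comm _ _
  have hV := hV.mono (Ioc_subset_Icc_self (a := 0) (b := B))
  have hmc := hmc.mono (Ioc_subset_Icc_self (a := 0) (b := B))
  have hM := (h.config.mass_continuousOn hB).mono (Ioc_subset_Icc_self (a := 0) (b := B))
  have hW := (h.config.volDensity_continuousOn hB).mono (Ioc_subset_Icc_self (a := 0) (b := B))
  have hW0 : ∀ χ ∈ Ioc 0 B, 0 < d.volDensity χ := fun χ hχ =>
    h.config.volDensity_pos ⟨hχ.1.le, hχ.2⟩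
  have hq := (h.config.r_cont.mono (Ioc_subset_Icc_self (a := 0) (b := B))).inv₀
    fun χ hχ => (h.config.r_pos χ hχ).ne'
  refine RegularOn.of_bound hB.le (((intervalIntegrable_centralWeight 0 B).const_mul
    (8 * (∫ x in (0 : ℝ)..B, w₁ x ^ 2))).add
    (intervalIntegrable_const (c := 1 / 1000 * C ^ 2 + 2 * (C ^ 2 + C ^ 2)))) ?_ fun χ hχ => ?_
  · have hden : ∀ c : ℝ, 0 < c → ∀ k : ℕ, ∀ χ ∈ Ioc 0 B, c * d.volDensity χ ^ k ≠ 0 :=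
      fun c hc k χ hχ => (mul_pos hc (pow_pos (hW0 χ hχ) k)).ne'
    have hπ := Real.pi_pos
    refine ContinuousOn.add (ContinuousOn.add (ContinuousOn.sub (ContinuousOn.sub ?_ ?_) ?_) ?_) ?_
    · exact ((continuousOn_const.sub ((continuousOn_const.mul hM).mul hq)).div (hW.pow 3)
        fun χ hχ => (pow_pos (hW0 χ hχ) 3).ne').mul ((hw.pow 2).add (hv.pow 2))
    · exact ((hM.mul (hq.pow 7)).div (continuousOn_const.mul hW)
        fun χ hχ => (mul_pos (by positivity) (hW0 χ hχ)).ne').mul (hV.pow 2)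
    · exact (((hM.mul (hq.pow 4)).div (continuousOn_const.mul (hW.pow 2))
        (hden _ (by positivity) 2)).mul hV).mul hw
    · exact ((hmc.mul (hq.pow 4)).div (continuousOn_const.mul hW)
        fun χ hχ => (mul_pos (by positivity) (hW0 χ hχ)).ne').mul hV
    · exact (((continuousOn_const.mul hmc).mul hq).mul hw).div (hW.pow 2)
        fun χ hχ => (pow_pos (hW0 χ hχ) 2).ne'
  · have hχ' : χ ∈ Icc 0 B := ⟨hχ.1.le, hχ.2⟩
    have h1 := h.abs_quadraticDensity_sub_le (v₁ := v₁) hR hw1 hw2 hm hχ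
    have h2 : w₁ χ ^ 2 ≤ C ^ 2 := by
      rw [← sq_abs]; exact pow_le_pow_left₀ (abs_nonneg _) (hC χ hχ).1 2
    have h3 : v₁ χ ^ 2 ≤ C ^ 2 := by
      rw [← sq_abs]; exact pow_le_pow_left₀ (abs_nonneg _) (hC χ hχ).2 2
    have h4 : d.gradSq χ / d.volDensity χ ^ 3 ≤ 2 := by
      have e1 := h.config.gradSq_le_one hB hχ'
      have e2 := pow_le_pow_left₀ (by norm_num) (h.volDensity_ge hR hχ') 3
      rw [div_le_iff₀ (pow_pos (hW0 χ hχ) 3)]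
      linarith
    have h5 : 0 ≤ d.gradSq χ / d.volDensity χ ^ 3 :=
      div_nonneg (h.config.gradSq_pos hχ').le (pow_pos (hW0 χ hχ) 3).le
    have h6 : d.gradSq χ / d.volDensity χ ^ 3 * (w₁ χ ^ 2 + v₁ χ ^ 2) ≤ 2 * (C ^ 2 + C ^ 2) :=
      mul_le_mul h4 (add_le_add h2 h3) (by positivity) (by norm_num)
    have h7 : 0 ≤ d.gradSq χ / d.volDensity χ ^ 3 * (w₁ χ ^ 2 + v₁ χ ^ 2) := by positivity
    rw [abs_le] at h1 ⊢
    constructor <;> linarith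

/-- Coercivity of the second variation for stars of small radius. -/
theorem le_integral_quadraticDensity (h : d.IsEquilibrium B) (hR : d.r B < 1 / 1000)
    (hw : ContinuousOn w₁ (Ioc 0 B)) (hv : ContinuousOn v₁ (Ioc 0 B))
    (hC : ∀ χ ∈ Ioc 0 B, |w₁ χ| ≤ C ∧ |v₁ χ| ≤ C)
    (hw1 : RegularOn B w₁) (hw2 : RegularOn B (fun x => w₁ x ^ 2))
    (hv2 : RegularOn B (fun x => v₁ x ^ 2))
    (hm : m₁ = linearSolution d.rate
      (fun χ => -d.pressure χ * w₁ χ + d.gravity χ * ∫ x in (0 : ℝ)..χ, w₁ x)) :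
    1 / 4 * ((∫ x in (0 : ℝ)..B, w₁ x ^ 2) + ∫ x in (0 : ℝ)..B, v₁ x ^ 2) ≤
      ∫ x in (0 : ℝ)..B, d.adjoint B x * d.quadraticDensity w₁ v₁ m₁ x := by
  have hB := h.pos
  set N := ∫ x in (0 : ℝ)..B, w₁ x ^ 2 with hN
  have hN0 : 0 ≤ N := integral_nonneg hB.le fun x _ => sq_nonneg _
  have hreg := (h.quadraticDensity_regularOn hR hw hv hC hw1 hw2 hm).continuousOn_mul hB.le
    (h.config.adjoint_continuousOn hB)
  have he := (intervalIntegrable_centralWeight 0 B).const_mul (8 * N)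
  -- Adjoint weight at least 1/2 times diagonal coefficient at least 9/10, less 1/1000, leaves more
  -- than 3/10. The weight term integrates to 12 N B^{2/3}, small enough to keep 1/4.
  have hlow : ∫ x in (0 : ℝ)..B, (3 / 10 * w₁ x ^ 2 + 3 / 10 * v₁ x ^ 2
      - 8 * N * centralWeight x) ≤
      ∫ x in (0 : ℝ)..B, d.adjoint B x * d.quadraticDensity w₁ v₁ m₁ x := by
    refine integral_mono_on_of_le_Ioo hB.le
      (((hw2.int.const_mul _).add (hv2.int.const_mul _)).sub he) hreg.int fun χ hχ => ?_
    have hχ₁ : χ ∈ Ioc 0 B := ⟨hχ.1, hχ.2.le⟩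
    have hχ' : χ ∈ Icc 0 B := ⟨hχ.1.le, hχ.2.le⟩
    have h1 := (abs_le.1 (h.abs_quadraticDensity_sub_le (v₁ := v₁) hR hw1 hw2 hm hχ₁)).1
    have h2 := h.half_le_adjoint hR hχ'
    have h3 := h.config.adjoint_le_one hB hχ'
    have h4 := h.gradSq_ge hR hχ'
    have h5 := h.config.volDensity_pos hχ'
    have h6 := h.volDensity_le_one hχ'
    have h7 : 9 / 10 ≤ d.gradSq χ / d.volDensity χ ^ 3 := by
      rw [le_div_iff₀ (pow_pos h5 3)]
      have := pow_le_one₀ h5.le h6 (n := 3)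
      linarith
    have h8 : 9 / 10 * (w₁ χ ^ 2 + v₁ χ ^ 2)
        ≤ d.gradSq χ / d.volDensity χ ^ 3 * (w₁ χ ^ 2 + v₁ χ ^ 2) :=
      mul_le_mul_of_nonneg_right h7 (by positivity)
    have h9 : 0 ≤ 8 * centralWeight χ * N + 1 / 1000 * w₁ χ ^ 2 := by
      have := centralWeight_pos hχ.1
      positivity
    have h10 : d.adjoint B χ * (9 / 10 * (w₁ χ ^ 2 + v₁ χ ^ 2)
        - (8 * centralWeight χ * N + 1 / 1000 * w₁ χ ^ 2))
        ≤ d.adjoint B χ * d.quadraticDensity w₁ v₁ m₁ χ :=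
      mul_le_mul_of_nonneg_left (by linarith) (by linarith)
    have h11 : 1 / 2 * (9 / 10 * (w₁ χ ^ 2 + v₁ χ ^ 2))
        ≤ d.adjoint B χ * (9 / 10 * (w₁ χ ^ 2 + v₁ χ ^ 2)) :=
      mul_le_mul_of_nonneg_right h2 (by positivity)
    have h12 : d.adjoint B χ * (8 * centralWeight χ * N + 1 / 1000 * w₁ χ ^ 2)
        ≤ 1 * (8 * centralWeight χ * N + 1 / 1000 * w₁ χ ^ 2) :=
      mul_le_mul_of_nonneg_right h3 h9
    linarith [sq_nonneg (w₁ χ), sq_nonneg (v₁ χ)]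
  rw [intervalIntegral.integral_sub ((hw2.int.const_mul _).add (hv2.int.const_mul _)) he,
    intervalIntegral.integral_add (hw2.int.const_mul _) (hv2.int.const_mul _),
    intervalIntegral.integral_const_mul, intervalIntegral.integral_const_mul,
    intervalIntegral.integral_const_mul, integral_centralWeight hB, ← hN] at hlow
  have hv0 : 0 ≤ ∫ x in (0 : ℝ)..B, v₁ x ^ 2 := integral_nonneg hB.le fun x _ => sq_nonneg _
  have h2 := mul_le_mul_of_nonneg_left (h.label_mul_weight_le hR ⟨hB, le_rfl⟩) hN0
  linarith

end Coercivity

end IsEquilibrium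

theorem IsStaticHardStar.isEquilibrium {d : StarData} {B : ℝ} (h : d.IsStaticHardStar B)
    (hB : 0 < B) (hcrit : IsCriticalPoint d B) (hR : d.r B < 1 / 1000) : d.IsEquilibrium B := by
  refine ⟨hB, h.config, h.static, fun χ hχ => ?_, h.pressure_boundary, fun χ hχ =>
    hcrit.firstVariation_eq_zero hB h.config h.static ?_ hχ⟩
  · rcases hχ.2.lt_or_eq with hlt | heq
    · exact (h.pressure_pos χ ⟨hχ.1, hlt⟩).le
    · rw [heq, h.pressure_boundary]
  · have h1 := h.config.r_nonneg (χ := B) ⟨hB.le, le_rfl⟩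
    have h2 : d.r B ^ 2 ≤ (1 / 1000) ^ 2 := pow_le_pow_left₀ h1 hR.le 2
    have h3 : Real.pi * d.r B ^ 2 ≤ 4 * (1 / 1000) ^ 2 :=
      mul_le_mul Real.pi_le_four h2 (sq_nonneg _) (by norm_num)
    linarith

end StarData

/-! ### Sign of the second variation and the case of equality. -/

/-- The variation of the area radius. -/
theorem VariationDerivatives.hasDerivAt_r {B : ℝ} {D : ℝ → StarData} {w₁ w₂ v₁ v₂ : ℝ → ℝ → ℝ}
    (h : VariationDerivatives B D w₁ w₂ v₁ v₂) (hB : 0 < B) {χ : ℝ} (hχ : χ ∈ Ioc 0 B) :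
    HasDerivAt (fun l => (D l).r χ)
      ((∫ x in (0 : ℝ)..χ, w₁ 0 x) / (4 * Real.pi * (D 0).r χ ^ 2)) 0 := by
  have h0 := zero_mem_halfInterval
  have hcfg := h.config 0 h0
  have hr := hcfg.r_pos χ hχ
  have h1 := (hasDerivAt_invRadius (hcfg.vol_pos hχ)).comp 0 ((h.vol_deriv hB).deriv 0 h0 χ hχ)
  have h2 := h1.inv (by simpa using (invRadius_pos (hcfg.vol_pos hχ)).ne')
  refine (h2.congr_of_eventuallyEq ?_).congr_deriv ?_
  · filter_upwards [isOpen_Ioo.mem_nhds h0] with l hl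
    simp only [Pi.inv_apply, Function.comp_apply]
    rw [(h.config l hl).inv_r_eq hχ, inv_inv]
  · simp only [Function.comp_apply]
    rw [hcfg.inv_r_eq hχ]
    field_simp

theorem proposition3p2 :
    ∃ R₀ : ℝ, 0 < R₀ ∧
      ∀ (B : ℝ) (d : StarData), 0 < B → d.IsStaticHardStar B → IsCriticalPoint d B →
        d.r B < R₀ →
        ∀ D : ℝ → StarData, IsVariation d B D →
          ∃ Mddot : ℝ, HasSecondVariation (fun l => (D l).mass B) Mddot ∧
            0 ≤ Mddot ∧
            (Mddot = 0 ↔ ∀ χ ∈ Set.Icc 0 B,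
              deriv (fun l => (D l).r χ) 0 = 0 ∧ deriv (fun l => (D l).rφ χ) 0 = 0) := by
  refine ⟨1 / 1000, by norm_num, fun B d hB hstar hcrit hR D hD => ?_⟩
  have h := hstar.isEquilibrium hB hcrit hR
  obtain ⟨w₁, w₂, v₁, v₂, hder⟩ := hD.exists_derivatives hB
  have h0 := zero_mem_halfInterval
  obtain ⟨m₁, hm₁⟩ : ∃ m₁, m₁ = linearSolution d.rate
    (fun χ => -d.pressure χ * w₁ 0 χ + d.gravity χ * ∫ x in (0 : ℝ)..χ, w₁ 0 x) := ⟨_, rfl⟩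
  have hsecond := (hder.hasSecondVariation hB (by rw [hD.base]; exact h.static)
    rfl rfl rfl rfl rfl rfl rfl rfl).2
  rw [hD.base, linearSolution_eq_integral] at hsecond
  have r1 : ∀ {g g₁ : ℝ → ℝ → ℝ}, BoundedFamily halfInterval B (fun _ => 1) g g₁ →
      RegularOn B (g₁ 0) := fun hg => hg.regularOn_deriv hB.le (by simp) h0
  have r2 : ∀ {g g₁ : ℝ → ℝ → ℝ}, BoundedFamily halfInterval B (fun _ => 1) g g₁ →
      RegularOn B (fun x => g₁ 0 x ^ 2) := fun hg => by
    obtain ⟨C, hC, hb⟩ := hg.bound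
    refine RegularOn.of_bound hB.le (intervalIntegrable_const (c := C ^ 2))
      ((hg.cont_deriv 0 h0).pow 2) fun χ hχ => ?_
    rw [abs_pow]
    exact pow_le_pow_left₀ (abs_nonneg _) (by simpa using (hb 0 h0 χ hχ).2) 2
  have hw1 := r1 hder.w_deriv
  have hw2 := r2 hder.w_deriv
  have hv2 := r2 hder.v_deriv
  obtain ⟨C, hC⟩ : ∃ C, ∀ χ ∈ Ioc 0 B, |w₁ 0 χ| ≤ C ∧ |v₁ 0 χ| ≤ C := by
    obtain ⟨C, -, hb⟩ := hder.w_deriv.bound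
    obtain ⟨C', -, hb'⟩ := hder.v_deriv.bound
    refine ⟨max C C', fun χ hχ => ⟨?_, ?_⟩⟩
    · exact le_max_of_le_left (by simpa using (hb 0 h0 χ hχ).2)
    · exact le_max_of_le_right (by simpa using (hb' 0 h0 χ hχ).2)
  have hcw := hder.w_deriv.cont_deriv 0 h0
  have hcv := hder.v_deriv.cont_deriv 0 h0
  have hQ := h.quadraticDensity_regularOn hR hcw hcv hC hw1 hw2 hm₁
  have hcoer := h.le_integral_quadraticDensity hR hcw hcv hC hw1 hw2 hv2 hm₁
  -- The second derivative w₂ enters M̈ as w₁ enters Ṁ, so the Euler-Lagrange equation removes it.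
  have hEL : ∫ χ in (0 : ℝ)..B, d.adjoint B χ *
      (-d.pressure χ * w₂ 0 χ + d.gravity χ * ∫ x in (0 : ℝ)..χ, w₂ 0 x) = 0 := by
    rw [h.config.integral_firstVariation hB (r1 hder.w₁_deriv)]
    have : ∫ x in (0 : ℝ)..B, d.firstVariation B x * w₂ 0 x = ∫ x in (0 : ℝ)..B, (0 : ℝ) := by
      refine integral_congr_ae (Eventually.of_forall fun x hx => ?_)
      rw [uIoc_of_le hB.le] at hx
      simp only [h.firstVariation_eq_zero x ⟨hx.1.le, hx.2⟩, zero_mul]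
    rw [this]; simp
  have hELr : RegularOn B (fun χ => d.adjoint B χ *
      (-d.pressure χ * w₂ 0 χ + d.gravity χ * ∫ x in (0 : ℝ)..χ, w₂ 0 x)) := by
    have hw₂ := r1 hder.w₁_deriv
    refine RegularOn.continuousOn_mul hB.le (h.config.adjoint_continuousOn hB)
      ((hw₂.continuousOn_mul hB.le h.config.pressure_continuousOn.neg).add ?_)
    exact ((h.config.gravity_regularOn hB).continuousOn_mul hB.le
      (hw₂.continuousOn_primitive hB.le)).congr hB.le fun x _ => mul_comm _ _
  have hvalue : HasSecondVariation (fun l => (D l).mass B)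
      (∫ x in (0 : ℝ)..B, d.adjoint B x * d.quadraticDensity (w₁ 0) (v₁ 0) m₁ x) := by
    have hQr := hQ.continuousOn_mul hB.le (h.config.adjoint_continuousOn hB)
    have := intervalIntegral.integral_add hELr.int hQr.int
    rw [hEL, zero_add] at this
    rw [← this]
    subst hm₁
    simp only [← mul_add]
    exact hsecond
  have hrd := fun χ (hχ : χ ∈ Ioc 0 B) => hder.hasDerivAt_r hB hχ
  have hvd := fun χ (hχ : χ ∈ Ioc 0 B) => hder.v_deriv.deriv 0 h0 χ hχ
  have hNw : 0 ≤ ∫ x in (0 : ℝ)..B, w₁ 0 x ^ 2 := integral_nonneg hB.le fun x _ => sq_nonneg _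
  have hNv : 0 ≤ ∫ x in (0 : ℝ)..B, v₁ 0 x ^ 2 := integral_nonneg hB.le fun x _ => sq_nonneg _
  refine ⟨_, hvalue, by linarith, fun hzero χ hχ => ?_, fun hall => ?_⟩
  · rcases hχ.1.eq_or_lt with hχ0 | hχ0
    -- The derivative formulas hold for χ > 0 only; at the centre r and ∂r/∂φ vanish for every
    -- member of the family.
    · subst hχ0
      have hr0 : (fun l => (D l).r 0) =ᶠ[𝓝 0] fun _ => 0 := by
        filter_upwards [isOpen_Ioo.mem_nhds h0] with l hl using (hder.config l hl).r_zero
      have hv0 : (fun l => (D l).rφ 0) =ᶠ[𝓝 0] fun _ => 0 := by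
        filter_upwards [isOpen_Ioo.mem_nhds h0] with l hl using (hder.config l hl).rφ_zero
      rw [hr0.deriv_eq, hv0.deriv_eq]
      simp
    · have hχ' : χ ∈ Ioc 0 B := ⟨hχ0, hχ.2⟩
      have hw0 : ∀ x ∈ Ioc 0 B, w₁ 0 x = 0 := fun x hx => by
        have := hw2.eq_zero_of_integral_eq_zero hB (fun _ _ => sq_nonneg _) (by linarith) hx
        simpa using this
      have hv0 : ∀ x ∈ Ioc 0 B, v₁ 0 x = 0 := fun x hx => by
        have := hv2.eq_zero_of_integral_eq_zero hB (fun _ _ => sq_nonneg _) (by linarith) hx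
        simpa using this
      rw [(hrd χ hχ').deriv, (hvd χ hχ').deriv, hv0 χ hχ']
      have : ∫ x in (0 : ℝ)..χ, w₁ 0 x = ∫ x in (0 : ℝ)..χ, (0 : ℝ) := by
        refine integral_congr_ae (Eventually.of_forall fun x hx => ?_)
        rw [uIoc_of_le hχ.1] at hx
        exact hw0 x ⟨hx.1, hx.2.trans hχ.2⟩
      rw [this]
      simp
  -- If ṙ = 0 on every shell, the volume variation vanishes identically, and differentiating it in χ
  -- gives w₁ = 0.
  · have hV : ∀ χ ∈ Icc 0 B, ∫ x in (0 : ℝ)..χ, w₁ 0 x = 0 := fun χ hχ => by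
      rcases hχ.1.eq_or_lt with hχ0 | hχ0
      · simp [← hχ0]
      · have h1 := (hall χ hχ).1
        rw [(hrd χ ⟨hχ0, hχ.2⟩).deriv, div_eq_zero_iff] at h1
        refine h1.resolve_right ?_
        have := (hder.config 0 h0).r_pos χ ⟨hχ0, hχ.2⟩
        positivity
    have hw0 : ∀ χ ∈ Ioc 0 B, w₁ 0 χ = 0 := fun χ hχ => by
      have h1 := hw1.hasDerivWithinAt_primitive hχ
      have h2 : HasDerivWithinAt (fun χ => ∫ x in (0 : ℝ)..χ, w₁ 0 x) 0 (Icc 0 B) χ :=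
        (hasDerivWithinAt_const χ _ (0 : ℝ)).congr hV (hV χ ⟨hχ.1.le, hχ.2⟩)
      exact (uniqueDiffOn_Icc hB χ ⟨hχ.1.le, hχ.2⟩).eq_deriv _ h1 h2
    have hv0 : ∀ χ ∈ Ioc 0 B, v₁ 0 χ = 0 := fun χ hχ => by
      rw [← (hvd χ hχ).deriv]; exact (hall χ ⟨hχ.1.le, hχ.2⟩).2
    have : ∫ x in (0 : ℝ)..B, d.adjoint B x * d.quadraticDensity (w₁ 0) (v₁ 0) m₁ x
        = ∫ x in (0 : ℝ)..B, (0 : ℝ) := by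
      refine integral_congr_ae (Eventually.of_forall fun x hx => ?_)
      rw [uIoc_of_le hB.le] at hx
      simp only [StarData.quadraticDensity, hw0 x hx, hv0 x hx, hV x ⟨hx.1.le, hx.2⟩]
      simp
    rw [this]; simp
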